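/- Let $F$ be a field, $K \supseteq F$ an algebraically closed field, and let $A \ne 0$ be a Zariski closed $F$-subalgebra of $M_n(K)$ (not necessarily with unit), i.e. an $F$-subalgebra which is closed in the Zariski topology of the affine space $M_n(K)=K^{n^2}$. Let $J$ be the Jacobson radical of $A$. Then $J$ is nilpotent, and $A$ has a faithful representation $\rho : A \to M_N(K)$, with $\rho(A)$ Zariski closed and in Wedderburn block form, such that the maximal length of the branches of the full quiver of $\rho$ is $m-1$, where $m \ge 1$ is the nilpotence index of $J$ (the least $m \ge 1$ with $J^m = 0$). Here an injective homomorphism $\rho : A\to M_N(K)$ of $F$-algebras is in Wedderburn block form if $A = S \oplus J$ for a subalgebra $S \cong \prod_{u=1}^k M_{n_u}(F_u)$, where each $F_u$ with $F \subseteq F_u\subseteq K$ is a finite field or equal to $K$, and the indices $1,\dots,N$ are partitioned into consecutive nonempty intervals defining blocks such that: $\rho(J)$ lies in the strictly upper triangular blocks; $\rho(S)$ lies in the diagonal blocks; each diagonal block $r$ either is a zero block, on which $\rho(S)$ vanishes (allowed only if $A$ has no unit), or belongs to some $u = u(r)$, in which case it has size $n_u$ and the $r$-th diagonal block of $\rho(s)$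 is the $u$-component of $s \in S$ with all entries raised to the power $q^{t_r}$ for some $t_r\ge 0$ depending only on $r$ (Frobenius gluing), where $q = |F|$ if $F$ is finite and $q=1$ if $F$ is infinite; and each $u$ occurs as $u(r)$ for some $r$. The full quiver of $\rho$ has the diagonal blocks as its vertices (labelled by $u(r)$, $n_{u(r)}$, $F_{u(r)}$, $t_r$), and an arrow from $r$ to $s \neq r$ iff $e_r\rho(A)e_s \ne 0$, where $e_r$ is the unit of the $r$-th diagonal block of $M_N(K)$. A branch is a directed path that cannot be extended (no arrow enters its first vertex and no arrow exits its last vertex); its length is its number of arrows. -/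

import Mathlib

namespace ZariskiClosedAlgebra

/-- `X` is closed in the Zariski topology of the affine space of `m × m` matrices over `K`:
it is the set of common zeros of a set of polynomials (with coefficients in `K`) in the matrix
entries. -/
def IsZariskiClosed {K : Type*} [Field K] {m : Type*} (X : Set (Matrix m m K)) : Prop :=
  ∃ I : Ideal (MvPolynomial (m × m) K),
    X = {M | (fun p : m × m => M p.1 p.2) ∈ MvPolynomial.zeroLocus K I}

/-- The Jacobson radical of an `F`-algebra `A`, possibly without unit, given as a subalgebra of an
ambient algebra `R`. Since `A` is an ideal of its unitization `F ⊕ A`, its Jacobson radical is the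
intersection of `A` with the Jacobson radical of `F ⊕ A` (and it is the usual Jacobson radical
when `A` has a unit). It is regarded as an `F`-subspace of `R`, so that its powers, in the
semiring of `F`-subspaces of `R`, are the usual powers of the radical. -/
def radical {F R : Type*} [Field F] [Ring R] [Algebra F R] (A : NonUnitalSubalgebra F R) :
    Submodule F R where
  carrier := {x | ∃ h : x ∈ A,
    (Unitization.inr (⟨x, h⟩ : A) : Unitization F A) ∈ Ring.jacobson (Unitization F A)}
  zero_mem' := by
    refine ⟨A.zero_mem, ?_⟩
    have h : (Unitization.inr (⟨0, A.zero_mem⟩ : A) : Unitization F A) = 0 :=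
      Unitization.inr_zero F
    rw [h]
    exact Submodule.zero_mem _
  add_mem' := by
    rintro x y ⟨hx, hx'⟩ ⟨hy, hy'⟩
    refine ⟨A.add_mem hx hy, ?_⟩
    have h : (Unitization.inr (⟨x + y, A.add_mem hx hy⟩ : A) : Unitization F A)
        = Unitization.inr (⟨x, hx⟩ : A) + Unitization.inr (⟨y, hy⟩ : A) :=
      Unitization.inr_add F (⟨x, hx⟩ : A) ⟨y, hy⟩
    rw [h]
    exact Submodule.add_mem _ hx' hy'
  smul_mem' := by
    rintro c x ⟨hx, hx'⟩
    refine ⟨SMulMemClass.smul_mem c hx, ?_⟩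
    have h : (Unitization.inr (⟨c • x, SMulMemClass.smul_mem c hx⟩ : A) : Unitization F A)
        = (Unitization.inl c : Unitization F A) * Unitization.inr (⟨x, hx⟩ : A) :=
      (Unitization.inl_mul_inr c (⟨x, hx⟩ : A)).symm
    rw [h]
    exact Submodule.smul_mem _ _ hx'

open scoped Classical in
/-- The number `q` whose powers are the exponents of the Frobenius maps `x ↦ x ^ (q ^ t)`: the
order of `F` if `F` is finite, and `1` if `F` is infinite (there is then no Frobenius twist). -/
noncomputable def frobeniusBase (F : Type*) : ℕ :=
  if Finite F then Nat.card F else 1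

/-- A faithful representation of the `F`-algebra `A` by matrices over `K ⊇ F` in Wedderburn block
form, all identifications among the diagonal blocks being Frobenius gluings.

The rows and columns are partitioned into `numBlocks` consecutive intervals, the `r`-th one of
length `blockSize r`; thus the matrices have degree `∑ r, blockSize r`. The simple components of
the semisimple part of `A` are the algebras `M_{deg u}(fld u)` for `u : Fin numSimple`. -/
structure WedderburnBlockForm (K : Type*) {F R : Type*} [Field F] [Field K] [Algebra F K]
    [Ring R] [Algebra F R] (A : NonUnitalSubalgebra F R) where
  /-- The number of diagonal blocks. -/
  numBlocks : ℕ
  /-- The sizes of the diagonal blocks. -/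
  blockSize : Fin numBlocks → ℕ
  blockSize_pos : ∀ r, 0 < blockSize r
  /-- The representation. -/
  rep : A →ₙₐ[F]
    Matrix (Σ r : Fin numBlocks, Fin (blockSize r)) (Σ r : Fin numBlocks, Fin (blockSize r)) K
  rep_injective : Function.Injective rep
  /-- The number of simple components of the semisimple part of `A`. -/
  numSimple : ℕ
  /-- The matrix degrees of the simple components. -/
  deg : Fin numSimple → ℕ
  deg_pos : ∀ u, 0 < deg u
  /-- The centers of the simple components. -/
  fld : Fin numSimple → IntermediateField F K
  fld_closed : ∀ u, Finite (fld u) ∨ fld u = ⊤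
  /-- The embedding into `A` of the direct product of the simple components. -/
  semisimple : (∀ u : Fin numSimple, Matrix (Fin (deg u)) (Fin (deg u)) (fld u)) →ₙₐ[F] A
  /-- `A` is the sum of its semisimple part and its radical (the sum is direct by
  `rep_semisimple` and `rep_radical`). -/
  decomposition : ∀ a : A, ∃ x, ∃ b : A, (b : R) ∈ radical A ∧ a = semisimple x + b
  /-- The glued component of a diagonal block: two blocks are glued if they have the same
  component `some u`; the value `none` indicates a zero diagonal block. -/
  component : Fin numBlocks → Option (Fin numSimple)
  component_surjective : ∀ u, ∃ r, component r = some u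
  /-- There are zero diagonal blocks only if `A` has no unit element. -/
  component_ne_none : (∃ e : A, ∀ a : A, e * a = a ∧ a * e = a) → ∀ r, component r ≠ none
  blockSize_eq : ∀ r u, component r = some u → blockSize r = deg u
  /-- The Frobenius exponent of a diagonal block. -/
  exponent : Fin numBlocks → ℕ
  /-- The diagonal block `r` of a semisimple element is its component, twisted by the power
  of the Frobenius map given by the exponent of the block. -/
  rep_semisimple : ∀ r u (h : component r = some u) x (i j : Fin (blockSize r)),
    rep (semisimple x) ⟨r, i⟩ ⟨r, j⟩ =
      ((x u (Fin.cast (blockSize_eq r u h) i) (Fin.cast (blockSize_eq r u h) j) : fld u) : K) ^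
        (frobeniusBase F ^ exponent r)
  /-- A semisimple element vanishes on the zero diagonal blocks. -/
  rep_semisimple_zero : ∀ r, component r = none → ∀ x (i j : Fin (blockSize r)),
    rep (semisimple x) ⟨r, i⟩ ⟨r, j⟩ = 0
  /-- A semisimple element vanishes off the diagonal blocks. -/
  rep_semisimple_offDiag : ∀ r s, r ≠ s → ∀ x (i : Fin (blockSize r)) (j : Fin (blockSize s)),
    rep (semisimple x) ⟨r, i⟩ ⟨s, j⟩ = 0
  /-- The radical is mapped into the strictly upper triangular blocks. -/
  rep_radical : ∀ a : A, (a : R) ∈ radical A → ∀ r s, s ≤ r →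
    ∀ (i : Fin (blockSize r)) (j : Fin (blockSize s)), rep a ⟨r, i⟩ ⟨s, j⟩ = 0

/-- The directed graph of the full quiver of a representation in Wedderburn block form. The
vertices are the diagonal blocks, and there is an arrow from `r` to `s ≠ r` iff the `(r, s)` block
`e_r ρ(a) e_s` is nonzero for some `a ∈ A`. The labels of the vertex `r` are those of the block
form: the glued component, the matrix degree, the center, and the Frobenius exponent. -/
def WedderburnBlockForm.fullQuiver {K F R : Type*} [Field F] [Field K] [Algebra F K]
    [Ring R] [Algebra F R] {A : NonUnitalSubalgebra F R} (W : WedderburnBlockForm K A) :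
    Digraph (Fin W.numBlocks) where
  Adj r s := r ≠ s ∧ ∃ (a : A) (i : Fin (W.blockSize r)) (j : Fin (W.blockSize s)),
    W.rep a ⟨r, i⟩ ⟨s, j⟩ ≠ 0

/-- `p 0 → p 1 → ⋯ → p L` is a branch of length `L` of the directed graph `Q`: it is a path which
cannot be extended, i.e. no arrow enters its first vertex and no arrow exits its last vertex. -/
def IsBranch {V : Type*} (Q : Digraph V) (L : ℕ) (p : Fin (L + 1) → V) : Prop :=
  (∀ i : Fin L, Q.Adj (p i.castSucc) (p i.succ)) ∧
    (∀ v, ¬ Q.Adj v (p 0)) ∧ ∀ v, ¬ Q.Adj (p (Fin.last L)) v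

end ZariskiClosedAlgebra

/-!
# Closed algebras of matrices in Wedderburn block form

Let `A` be a closed `F`-subalgebra of the `n × n` matrices over `K`, with radical `J`. The
Wedderburn principal theorem and the representation are obtained together, as follows.

*Idempotents.* For `a ∈ A` the descending chain condition for closed sets shows that the Drazin
inverse of `a`, computed among all matrices, belongs to `A` (`exists_drazin_inverse`). Hence every
non-nilpotent element of `A` has a multiple which is a nonzero idempotent of `A`, and `J` consists
of the `x ∈ A` with `x * y` nilpotent for all `y ∈ A` (`mem_radical_iff`). Being a multiplicatively
closed set of nilpotent matrices, `J` is nilpotent (`isNilpotent_submodule_of_nil`).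

*Residue fields.* The corner `R = e A e` of a primitive idempotent is a closed ring all of whose
elements are nilpotent or invertible. Over an infinite `F` it is a `K`-space, and its residue field
is `K`. Over a finite `F` a maximal commuting set of semisimple elements of `R` is a field `L`,
diagonalized by finitely many injective characters `L → K`. Characters not related by powers of the
Frobenius map are algebraically independent (`eq_zero_of_forall_eval_eq_zero`, by comparing the
characters of the monomials on `L × L`), so, if `L` is infinite, closedness would provide an element
killed by one of them but not by the other, which is impossible. Hence `L` is a finite field or a
copy of `K`, and the characters are powers of the Frobenius map (`exists_torus_parametrization`). A
finite subfield of `L` grades `R` by conjugation; the graded parts of nonzero degree turn out to be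
nilpotent, and those of degree `0` commute with `L`, which therefore represents all residue classes
(`exists_residue_field_lift`).

*The semisimple part.* A maximal orthogonal family of primitive idempotents of `A`, sorted by
equivalence of idempotents, yields matrix units; with the lifts of the residue fields these span a
complement of `J` (`exists_semisimpleFrame`).

*The representation.* Let `U k` be the space of vectors annihilated by `J ^ k`. The eigenprojections
of the lifted residue fields lie in the `K`-span of `A`, so they preserve this filtration, and their
ranges have bases adapted to it (`exists_adapted_basis`). Transporting these basis vectors by matrix
units gives a basis of `K ^ n` (or of the range of the unit element of `A`, if there is one) grouped
into blocks on which the semisimple part acts by zero or by a Frobenius twist of one of its simple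
components. Each block has a level, the least `k` with its vectors in `U k`, and `J` maps
`U (k + 1)` to `U k`. So, with the blocks sorted by level, `J` becomes strictly block triangular,
and the levels, which are between `1` and the nilpotency class `m` of `J`, increase along the arrows
of the full quiver: a path has at most `m - 1` arrows. Conversely, a nonzero product of `m - 1`
elements of `J` gives a path with `m - 1` arrows, and by the levels it cannot be extended
(`WedderburnBlockForm.isGreatest_branch`).
-/

namespace ZariskiClosedAlgebra

/-! ### Zariski closed subsets of finite-dimensional vector spaces -/

/-- The polynomial functions on a vector space, in a coordinate-free form: the algebra of
functions generated by the linear functionals. -/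
def polyFun (K M : Type*) [Field K] [AddCommGroup M] [Module K M] : Subalgebra K (M → K) :=
  Algebra.adjoin K (Set.range fun l : Module.Dual K M => (l : M → K))

/-- A subset of a vector space is closed if it is the set of common zeros of the polynomial
functions vanishing on it. -/
def PolyClosed (K : Type*) {M : Type*} [Field K] [AddCommGroup M] [Module K M]
    (X : Set M) : Prop :=
  ∀ y, (∀ g ∈ polyFun K M, (∀ x ∈ X, g x = 0) → g y = 0) → y ∈ X

section PolyClosed

variable {K M N : Type*} [Field K] [AddCommGroup M] [Module K M] [AddCommGroup N] [Module K N]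

theorem dual_mem_polyFun (l : Module.Dual K M) : (l : M → K) ∈ polyFun K M :=
  Algebra.subset_adjoin ⟨l, rfl⟩

theorem comp_mem_polyFun (T : M →ₗ[K] N) {g : N → K} (hg : g ∈ polyFun K N) :
    g ∘ T ∈ polyFun K M := by
  induction hg using Algebra.adjoin_induction with
  | mem x hx =>
    obtain ⟨l, rfl⟩ := hx
    exact dual_mem_polyFun (l ∘ₗ T)
  | algebraMap r => exact (polyFun K M).algebraMap_mem r
  | add x y _ _ hx hy => exact (polyFun K M).add_mem hx hy
  | mul x y _ _ hx hy => exact (polyFun K M).mul_mem hx hy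

theorem PolyClosed.preimage {X : Set N} (hX : PolyClosed K X) (T : M →ₗ[K] N) :
    PolyClosed K (T ⁻¹' X) := fun y hy =>
  hX (T y) fun _ hg hgX => hy _ (comp_mem_polyFun T hg) fun x hx => hgX (T x) hx

theorem PolyClosed.inter {X Y : Set M} (hX : PolyClosed K X) (hY : PolyClosed K Y) :
    PolyClosed K (X ∩ Y) := fun y hy =>
  ⟨hX y fun g hg h => hy g hg fun x hx => h x hx.1,
    hY y fun g hg h => hy g hg fun x hx => h x hx.2⟩

theorem polyClosed_ker (T : M →ₗ[K] N) : PolyClosed K {x | T x = 0} := by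
  intro y hy
  refine (Module.forall_dual_apply_eq_zero_iff K (T y)).1 fun l => ?_
  refine hy _ (dual_mem_polyFun (l ∘ₗ T)) fun x hx => ?_
  have : T x = 0 := hx
  simp [this]

theorem polyFun_fg [FiniteDimensional K M] : (polyFun K M).FG := by
  classical
  let b := Module.finBasis K M
  refine ⟨Finset.univ.image fun i => (b.coord i : M → K), le_antisymm ?_ ?_⟩
  · refine Algebra.adjoin_mono ?_
    intro f hf
    simp only [Finset.coe_image, Finset.coe_univ, Set.image_univ, Set.mem_range] at hf
    obtain ⟨i, rfl⟩ := hf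
    exact ⟨b.coord i, rfl⟩
  · refine Algebra.adjoin_le ?_
    rintro _ ⟨l, rfl⟩
    have : (l : M → K) = ∑ i, l (b i) • (b.coord i : M → K) := by
      funext x
      conv_lhs => rw [← b.sum_repr x]
      simp only [map_sum, map_smul, smul_eq_mul, Finset.sum_apply, Pi.smul_apply,
        Module.Basis.coord_apply]
      exact Finset.sum_congr rfl fun i _ => mul_comm _ _
    change (l : M → K) ∈ _
    rw [this]
    refine Subalgebra.sum_mem _ fun i _ => Subalgebra.smul_mem _ (Algebra.subset_adjoin ?_) _
    simp

/-- The closed subsets of a finite-dimensional vector space satisfy the descending chain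
condition. -/
theorem PolyClosed.stabilizes [FiniteDimensional K M] {X : ℕ → Set M} (hX : Antitone X)
    (hc : ∀ k, PolyClosed K (X k)) : ∃ k, ∀ j, k ≤ j → X j = X k := by
  have : Algebra.FiniteType K (polyFun K M) :=
    (Subalgebra.fg_iff_finiteType _).1 polyFun_fg
  have : IsNoetherianRing (polyFun K M) := Algebra.FiniteType.isNoetherianRing K _
  let I : ℕ → Ideal (polyFun K M) := fun k =>
    { carrier := {g | ∀ x ∈ X k, (g : M → K) x = 0}
      zero_mem' := fun x _ => rfl
      add_mem' := fun {a b} ha hb x hx => by simp [ha x hx, hb x hx]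
      smul_mem' := fun c a ha x hx => by simp [ha x hx] }
  have hI : Monotone I := fun i j hij g hg x hx => hg x (hX hij hx)
  obtain ⟨k, hk⟩ := monotone_stabilizes_iff_noetherian.2 this ⟨I, hI⟩
  refine ⟨k, fun j hj => Set.Subset.antisymm (hX hj) fun y hy => hc j y fun g hg hgX => ?_⟩
  have h1 : (⟨g, hg⟩ : polyFun K M) ∈ I j := hgX
  have h2 : I k = I j := hk j hj
  rw [← h2] at h1
  exact h1 y hy

theorem mem_polyFun_of_mvPolynomial {m : Type*} (f : MvPolynomial (m × m) K) :
    (fun A : Matrix m m K => MvPolynomial.eval (fun p => A p.1 p.2) f) ∈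
      polyFun K (Matrix m m K) := by
  induction f using MvPolynomial.induction_on with
  | C a =>
    simp only [MvPolynomial.eval_C]
    exact (polyFun K (Matrix m m K)).algebraMap_mem a
  | add p q hp hq =>
    simp only [map_add]
    exact (polyFun K (Matrix m m K)).add_mem hp hq
  | mul_X p i hp =>
    simp only [map_mul, MvPolynomial.eval_X]
    refine (polyFun K (Matrix m m K)).mul_mem hp ?_
    exact dual_mem_polyFun (Matrix.entryLinearMap K K i.1 i.2)

theorem exists_mvPolynomial_of_mem_polyFun {σ : Type*} [Finite σ] (b : Module.Basis σ K M)
    {g : M → K} (hg : g ∈ polyFun K M) :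
    ∃ f : MvPolynomial σ K, ∀ x, MvPolynomial.eval (fun i => b.repr x i) f = g x := by
  have := Fintype.ofFinite σ
  induction hg using Algebra.adjoin_induction with
  | mem x hx =>
    obtain ⟨l, rfl⟩ := hx
    refine ⟨∑ i, MvPolynomial.C (l (b i)) * MvPolynomial.X i, fun x => ?_⟩
    conv_rhs => rw [← b.sum_repr x]
    change _ = l _
    simp only [map_sum, map_mul, MvPolynomial.eval_C, MvPolynomial.eval_X, map_smul, smul_eq_mul]
    exact Finset.sum_congr rfl fun i _ => mul_comm _ _
  | algebraMap r => exact ⟨MvPolynomial.C r, fun A => by simp⟩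
  | add x y _ _ hx hy =>
    obtain ⟨p, hp⟩ := hx
    obtain ⟨q, hq⟩ := hy
    exact ⟨p + q, fun A => by simp [hp, hq]⟩
  | mul x y _ _ hx hy =>
    obtain ⟨p, hp⟩ := hx
    obtain ⟨q, hq⟩ := hy
    exact ⟨p * q, fun A => by simp [hp, hq]⟩

theorem isZariskiClosed_iff_polyClosed {m : Type*} [Finite m] {X : Set (Matrix m m K)} :
    IsZariskiClosed X ↔ PolyClosed K X := by
  classical
  constructor
  · rintro ⟨I, rfl⟩ y hy f hf
    have := hy _ (mem_polyFun_of_mvPolynomial f) fun x hx => by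
      have := hx f hf
      rwa [MvPolynomial.aeval_eq_eval] at this
    rwa [MvPolynomial.aeval_eq_eval]
  · intro h
    refine ⟨MvPolynomial.vanishingIdeal K ((fun (A : Matrix m m K) (p : m × m) => A p.1 p.2) '' X),
      Set.Subset.antisymm (fun A hA f hf => hf _ ⟨A, hA, rfl⟩) fun A hA => h A fun g hg hgX => ?_⟩
    have := Fintype.ofFinite m
    obtain ⟨f, hf'⟩ := exists_mvPolynomial_of_mem_polyFun (Matrix.stdBasis K m m) hg
    have hf : ∀ A : Matrix m m K, MvPolynomial.eval (fun p => A p.1 p.2) f = g A := fun A => by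
      rw [← hf']
      congr 2
    rw [← hf, ← MvPolynomial.aeval_eq_eval]
    refine hA f ?_
    rintro _ ⟨B, hB, rfl⟩
    rw [MvPolynomial.aeval_eq_eval]
    exact (hf B).trans (hgX B hB)

end PolyClosed

/-! ### Drazin inverses in closed algebras -/

section Drazin

variable {K M : Type*} [Field K] [Ring M] [Algebra K M]

theorem NonUnitalSubring.pow_mem' {A : NonUnitalSubring M} {a : M} (ha : a ∈ A) {n : ℕ}
    (hn : n ≠ 0) : a ^ n ∈ A := by
  obtain ⟨n, rfl⟩ := Nat.exists_eq_succ_of_ne_zero hn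
  clear hn
  induction n with
  | zero => simpa using ha
  | succ n ih => rw [pow_succ]; exact A.mul_mem ih ha

theorem exists_pow_eq_pow_succ_mul (K : Type*) {M : Type*} [Field K] [Ring M] [Algebra K M]
    [FiniteDimensional K M] (a : M) :
    ∃ (k : ℕ) (c : M), Commute a c ∧ a ^ k = a ^ (k + 1) * c := by
  let S := Algebra.adjoin K {a}
  let a' : S := ⟨a, Algebra.self_mem_adjoin_singleton K a⟩
  have : IsMulCommutative S := Algebra.isMulCommutative_adjoin K (by simp)
  have : IsArtinianRing S := IsArtinianRing.of_finite K S
  obtain ⟨k, c, hc⟩ := IsArtinian.exists_pow_succ_smul_dvd a' (1 : S)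
  refine ⟨k, c, congrArg Subtype.val (mul_comm' a' c), ?_⟩
  simpa using (congrArg Subtype.val hc).symm

/-- A closed algebra contains the Drazin inverse `b` of each of its elements `a`: the inverse of
`a` on the part of the Fitting decomposition on which `a` is invertible, and zero on the other
part. The reason is that, with `e = a * b`, the closed sets `{x | e * x = x ∧ b ^ j * x ∈ A}`
decrease with `j`, and that the `j`-th one contains high powers of `a`. -/
theorem exists_drazin_inverse [FiniteDimensional K M] {A : NonUnitalSubring M}
    (hA : PolyClosed K (A : Set M)) {a : M} (ha : a ∈ A) :
    ∃ b ∈ A, ∃ k : ℕ, a * b = b * a ∧ b * a * b = b ∧ a * b * a ^ k = a ^ k := by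
  obtain ⟨k, c, hac, hk⟩ := exists_pow_eq_pow_succ_mul K a
  have hkj : ∀ j, a ^ k = a ^ (k + j) * c ^ j := by
    intro j
    induction j with
    | zero => simp
    | succ j ih =>
      have h1 : a ^ (k + (j + 1)) * c ^ (j + 1) = a ^ j * (a ^ (k + 1) * c) * c ^ j := by
        rw [show k + (j + 1) = j + (k + 1) by ring, pow_add a j, pow_succ' c]
        simp only [mul_assoc]
      rw [h1, ← hk, ← pow_add, add_comm j k, ← ih]
  set e := a ^ k * c ^ k with he
  have hae : Commute a e := ((Commute.refl a).pow_right k).mul_right (hac.pow_right k)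
  have hce : Commute c e := (hac.symm.pow_right k).mul_right ((Commute.refl c).pow_right k)
  have hek : e * a ^ k = a ^ k := by
    conv_rhs => rw [hkj k, pow_add]
    rw [he, mul_assoc, mul_assoc, (hac.pow_pow k k).eq]
  have hee : e * e = e := by
    conv_lhs => rw [he, ← mul_assoc, ← he, hek]
  set b := e * c with hb
  have hab : a * b = e := by
    have h1 : a * (a ^ k * c ^ k * c) = (a ^ (k + 1) * c) * c ^ k := by
      rw [← mul_assoc, ← mul_assoc, ← pow_succ', mul_assoc, mul_assoc, ← pow_succ, ← pow_succ']
    rw [hb, he, h1, ← hk]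
  have hba : b * a = e := by
    rw [hb, mul_assoc, ← hac.eq, ← mul_assoc, ← hae.eq, mul_assoc, ← hb, hab]
  have heb : e * b = b := by rw [hb, ← mul_assoc, hee]
  have hbe : b * e = b := by rw [hb, mul_assoc, hce.eq, ← mul_assoc, hee]
  clear_value b e
  have hcomm : Commute b a := hba.trans hab.symm
  have hjab : ∀ j, a ^ j * b ^ j * e = e := by
    intro j
    induction j with
    | zero => simp
    | succ j ih =>
      have heb' : Commute e (b ^ j) := Commute.pow_right (heb.trans hbe.symm) j
      have h1 : a ^ (j + 1) * b ^ (j + 1) * e = a ^ j * (a * b * b ^ j) * e := by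
        rw [pow_succ a, pow_succ' b]
        simp only [mul_assoc]
      rw [h1, hab, heb'.eq, ← mul_assoc, ih, hee]
  let X : ℕ → Set M := fun j => {x | (1 - e) * x = 0} ∩ {x | b ^ j * x ∈ A}
  have hXc : ∀ j, PolyClosed K (X j) := fun j =>
    (polyClosed_ker (LinearMap.mulLeft K (1 - e))).inter
      (hA.preimage (LinearMap.mulLeft K (b ^ j)))
  have hXa : Antitone X := by
    refine antitone_nat_of_succ_le fun j x hx => ⟨hx.1, ?_⟩
    have h1 : e * x = x := by
      have := hx.1
      simp only [Set.mem_ofPred_eq, sub_mul, one_mul, sub_eq_zero] at this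
      exact this.symm
    have h2 : a * (b ^ (j + 1) * x) ∈ A := A.mul_mem ha hx.2
    have h3 : a * (b ^ (j + 1) * x) = b ^ j * x := by
      rw [pow_succ, mul_assoc, ← mul_assoc a, (hcomm.symm.pow_right j).eq, mul_assoc,
        ← mul_assoc a b, hab, h1]
    rw [h3] at h2
    exact h2
  obtain ⟨s, hs⟩ := PolyClosed.stabilizes hXa hXc
  have key : ∀ i, b ^ i * a ^ (k + 1) ∈ A := by
    intro i
    have hx : e * a ^ (k + 1) = a ^ (k + 1) := by
      rw [pow_succ, ← mul_assoc, hek]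
    have h1 : a ^ (s + (k + 1)) ∈ X s := by
      refine ⟨?_, ?_⟩
      · change (1 - e) * _ = 0
        rw [sub_mul, one_mul, sub_eq_zero, add_comm, pow_add, ← mul_assoc, hx]
      · change b ^ s * _ ∈ A
        rw [pow_add, ← mul_assoc, (hcomm.pow_pow s s).eq, ← hx, ← mul_assoc, hjab, hx]
        exact NonUnitalSubring.pow_mem' ha (by omega)
    rw [← hs (i + s) (by omega)] at h1
    have h2 : b ^ (i + s) * a ^ (s + (k + 1)) ∈ A := h1.2
    have h3 : b ^ (i + s) * a ^ (s + (k + 1)) = b ^ i * a ^ (k + 1) := by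
      rw [pow_add, pow_add, mul_assoc, ← mul_assoc (b ^ s), (hcomm.pow_pow s s).eq, ← hx,
        ← mul_assoc (a ^ s * b ^ s), hjab, hx]
    rwa [h3] at h2
  have hjba : b ^ (k + 1) * a ^ (k + 1) = e := by
    have h1 : b ^ (k + 1) * a ^ (k + 1) = a ^ (k + 1) * b ^ (k + 1) * e := by
      rw [(hcomm.pow_pow _ _).eq, mul_assoc]
      rw [show b ^ (k + 1) * e = b ^ (k + 1) by rw [pow_succ, mul_assoc, hbe]]
    rw [h1, hjab]
  refine ⟨b, ?_, k, hab.trans hba.symm, by rw [hba, heb], by rw [hab, hek]⟩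
  have := key (k + 2)
  rwa [show k + 2 = 1 + (k + 1) by ring, pow_add, pow_one, mul_assoc, hjba, hbe] at this

/-- An element of a closed algebra is nilpotent, or the algebra contains a partial inverse. -/
theorem isNilpotent_or_exists_inverse [FiniteDimensional K M] {A : NonUnitalSubring M}
    (hA : PolyClosed K (A : Set M)) {a : M} (ha : a ∈ A) :
    IsNilpotent a ∨ ∃ b ∈ A, a * b = b * a ∧ b * a * b = b ∧ a * b ≠ 0 := by
  obtain ⟨b, hb, k, h1, h2, h3⟩ := exists_drazin_inverse hA ha
  by_cases h : a * b = 0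
  · left
    exact ⟨k, by rw [← h3, h, zero_mul]⟩
  · exact Or.inr ⟨b, hb, h1, h2, h⟩

end Drazin

/-! ### The Jacobson radical -/

theorem isNilpotent_mul_comm {M : Type*} [MonoidWithZero M] {a b : M}
    (h : IsNilpotent (a * b)) : IsNilpotent (b * a) := by
  obtain ⟨k, hk⟩ := h
  have key : ∀ n, (b * a) ^ (n + 1) = b * (a * b) ^ n * a := by
    intro n
    induction n with
    | zero => simp
    | succ n ih => rw [pow_succ, ih, pow_succ]; simp only [mul_assoc]
  exact ⟨k + 1, by rw [key, hk, mul_zero, zero_mul]⟩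

section Radical

variable {F K M : Type*} [Field F] [Field K] [Ring M] [Algebra K M] [Algebra F M]

theorem inr_pow_succ {A : NonUnitalSubalgebra F M} (a : A) (k : ℕ) :
    ∃ b : A, (b : M) = (a : M) ^ (k + 1) ∧
      (Unitization.inr a : Unitization F A) ^ (k + 1) = Unitization.inr b := by
  induction k with
  | zero => exact ⟨a, by simp, by simp⟩
  | succ k ih =>
    obtain ⟨b, hb, hb'⟩ := ih
    refine ⟨b * a, by simp [hb, pow_succ], ?_⟩
    rw [pow_succ, hb', Unitization.inr_mul]

theorem isNilpotent_inr {A : NonUnitalSubalgebra F M} {a : A} (h : IsNilpotent (a : M)) :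
    IsNilpotent (Unitization.inr a : Unitization F A) := by
  obtain ⟨k, hk⟩ := h
  obtain ⟨b, hb, hb'⟩ := inr_pow_succ a k
  refine ⟨k + 1, ?_⟩
  have : b = 0 := Subtype.ext (by rw [hb, pow_succ, hk, zero_mul]; rfl)
  rw [hb', this, Unitization.inr_zero]

/-- The radical of a closed algebra consists of the elements generating a nil right ideal. -/
theorem mem_radical_iff [FiniteDimensional K M] {A : NonUnitalSubalgebra F M}
    (hA : PolyClosed K (A : Set M)) {x : M} :
    x ∈ radical A ↔ x ∈ A ∧ ∀ y ∈ A, IsNilpotent (x * y) := by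
  constructor
  · rintro ⟨hx, hxJ⟩
    refine ⟨hx, fun y hy => ?_⟩
    obtain h | ⟨b, hb, h1, h2, h3⟩ := isNilpotent_or_exists_inverse
      (A := A.toNonUnitalSubring) hA (A.mul_mem hx hy)
    · exact h
    -- Otherwise `x * y * b` is an idempotent of the Jacobson radical, hence zero.
    exfalso
    apply h3
    set e : A := ⟨x, hx⟩ * ⟨y, hy⟩ * ⟨b, hb⟩ with he
    have hee : e * e = e := by
      apply Subtype.ext
      change x * y * b * (x * y * b) = x * y * b
      rw [← mul_assoc, mul_assoc (x * y), mul_assoc (x * y), h2]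
    have heJ : (Unitization.inr e : Unitization F A) ∈ Ring.jacobson (Unitization F A) := by
      rw [he, Unitization.inr_mul, Unitization.inr_mul]
      exact Ideal.mul_mem_right _ _ (Ideal.mul_mem_right _ _ hxJ)
    rw [← Ideal.jacobson_bot, Ideal.mem_jacobson_iff] at heJ
    obtain ⟨z, hz⟩ := heJ (Unitization.inr (-e))
    rw [Ideal.mem_bot, sub_eq_zero, mul_assoc, ← Unitization.inr_mul] at hz
    have hne : -e * e * e + e = 0 := by
      apply Subtype.ext
      change -(e : M) * e * e + e = 0
      have h4 : (e : M) * e = e := congrArg Subtype.val hee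
      rw [neg_mul, neg_mul, h4, h4, neg_add_cancel]
    have h4 : (Unitization.inr e : Unitization F A) = 0 := by
      have h5 := congrArg (· * (Unitization.inr e : Unitization F A)) hz
      simp only [add_mul, one_mul, mul_assoc] at h5
      rw [← Unitization.inr_mul, ← mul_add, ← Unitization.inr_add, hne, Unitization.inr_zero,
        mul_zero] at h5
      exact h5.symm
    have h6 : e = 0 := Unitization.inr_injective (h4.trans (Unitization.inr_zero F).symm)
    exact congrArg Subtype.val h6
  · rintro ⟨hx, h⟩
    refine ⟨hx, ?_⟩
    rw [← Ideal.jacobson_bot, Ideal.mem_jacobson_iff]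
    intro y
    have h1 : IsNilpotent (y * (Unitization.inr (⟨x, hx⟩ : A))) := by
      apply isNilpotent_mul_comm
      set X : Unitization F A := Unitization.inr (⟨x, hx⟩ : A)
      -- `y` need not belong to `A`, but `y * X * y` does.
      have h2 : ∃ s : A, y * X * y = Unitization.inr s := by
        refine ⟨(y * X * y).snd, ?_⟩
        refine Unitization.ext ?_ ?_ <;> simp [X]
      obtain ⟨s, hs⟩ := h2
      have h3 : IsNilpotent ((X * y) ^ 2) := by
        rw [pow_two, mul_assoc, ← mul_assoc y, hs]
        change IsNilpotent (Unitization.inr (⟨x, hx⟩ : A) * Unitization.inr s)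
        rw [← Unitization.inr_mul]
        exact isNilpotent_inr (h s s.2)
      exact (IsNilpotent.pow_iff_pos (by norm_num)).1 h3
    obtain ⟨u, hu⟩ := h1.isUnit_one_add
    refine ⟨↑u⁻¹, ?_⟩
    rw [Ideal.mem_bot, sub_eq_zero, mul_assoc]
    have : (↑u⁻¹ : Unitization F A) * (1 + y * Unitization.inr (⟨x, hx⟩ : A)) = 1 := by
      rw [← hu, Units.inv_mul]
    rw [mul_add, mul_one, add_comm] at this
    exact this

theorem mul_mem_radical [FiniteDimensional K M] {A : NonUnitalSubalgebra F M}
    (hA : PolyClosed K (A : Set M)) {x y : M} (hx : x ∈ radical A) (hy : y ∈ A) :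
    x * y ∈ radical A := by
  rw [mem_radical_iff hA] at hx ⊢
  refine ⟨A.mul_mem hx.1 hy, fun z hz => ?_⟩
  rw [mul_assoc]
  exact hx.2 _ (A.mul_mem hy hz)

theorem mul_mem_radical' [FiniteDimensional K M] {A : NonUnitalSubalgebra F M}
    (hA : PolyClosed K (A : Set M)) {x y : M} (hx : x ∈ A) (hy : y ∈ radical A) :
    x * y ∈ radical A := by
  rw [mem_radical_iff hA] at hy ⊢
  refine ⟨A.mul_mem hx hy.1, fun z hz => ?_⟩
  rw [mul_assoc]
  apply isNilpotent_mul_comm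
  rw [mul_assoc]
  exact hy.2 _ (A.mul_mem hz hx)

theorem isNilpotent_of_mem_radical [FiniteDimensional K M] {A : NonUnitalSubalgebra F M}
    (hA : PolyClosed K (A : Set M)) {x : M} (hx : x ∈ radical A) : IsNilpotent x := by
  rw [mem_radical_iff hA] at hx
  have := hx.2 x hx.1
  rw [← pow_two] at this
  exact (IsNilpotent.pow_iff_pos (by norm_num)).1 this

end Radical

/-! ### Multiplicative sets of nilpotent endomorphisms -/

section NilSet

variable {K V : Type*} [Field K] [AddCommGroup V] [Module K V] [FiniteDimensional K V]

/-- A multiplicatively closed set `N` of nilpotent endomorphisms maps each nonzero invariant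
subspace `W` into a proper invariant subspace. Indeed, if `U` is a maximal proper invariant
subspace of `W`, and `x ∈ N` does not map `W` into `U` and has the least possible rank modulo `U`,
then nilpotency forces `x * N * x` and `x * x` to map `W` into `U`; but `W` is generated by `U`,
`x W` and `N x W`. -/
theorem exists_lt_of_nil {N : Set (Module.End K V)} (hmul : ∀ x ∈ N, ∀ y ∈ N, x * y ∈ N)
    (hnil : ∀ x ∈ N, IsNilpotent x) {W : Submodule K V} (hW : W ≠ ⊥)
    (hinv : ∀ y ∈ N, W.map y ≤ W) : ∃ U < W, ∀ y ∈ N, W.map y ≤ U := by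
  obtain ⟨U, ⟨hUW, hUinv⟩, hUmax⟩ := (wellFounded_gt (α := Submodule K V)).has_min
    {U | U < W ∧ ∀ y ∈ N, U.map y ≤ U} ⟨⊥, bot_lt_iff_ne_bot.2 hW, fun y _ => by simp⟩
  refine ⟨U, hUW, ?_⟩
  by_contra! hcon
  obtain ⟨x, ⟨hxN, hxU⟩, hxmin⟩ := (measure fun x : Module.End K V =>
      Module.finrank K ↥(W.map x ⊔ U)).wf.has_min {x | x ∈ N ∧ ¬ W.map x ≤ U} hcon
  set T := W.map x ⊔ U with hT
  have hTW : T ≤ W := sup_le (hinv x hxN) hUW.le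
  have claim : ∀ z ∈ N, T.map z ≤ W.map x → W.map (z * x) ≤ U := by
    intro z hz hzT
    by_contra hzU
    have hle : T.map z ⊔ U ≤ T := sup_le_sup_right hzT U
    have hne : T.map z ⊔ U ≠ T := by
      intro heq
      have hk : ∀ k : ℕ, T ≤ T.map (z ^ k) ⊔ U := by
        intro k
        induction k with
        | zero => simp [Module.End.one_eq_id]
        | succ k ih =>
          refine ih.trans (sup_le ?_ le_sup_right)
          have hU : ∀ j : ℕ, U.map (z ^ j) ≤ U := by
            intro j
            induction j with
            | zero => simp [Module.End.one_eq_id]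
            | succ j ihj =>
              rw [pow_succ, Module.End.mul_eq_comp, Submodule.map_comp]
              exact (Submodule.map_mono (hUinv z hz)).trans ihj
          calc T.map (z ^ k) = (T.map z ⊔ U).map (z ^ k) := by rw [heq]
            _ = T.map (z ^ (k + 1)) ⊔ U.map (z ^ k) := by
              rw [Submodule.map_sup, pow_succ, Module.End.mul_eq_comp, Submodule.map_comp]
            _ ≤ _ := sup_le_sup_left (hU k) _
      obtain ⟨k, hk0⟩ := hnil z hz
      have := hk k
      rw [hk0, Submodule.map_zero, bot_sup_eq] at this
      exact hxU (le_sup_left.trans this)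
    have hlt := Submodule.finrank_lt_finrank_of_lt (lt_of_le_of_ne hle hne)
    refine hxmin (z * x) ⟨hmul z hz x hxN, hzU⟩ (lt_of_le_of_lt ?_ hlt)
    refine Submodule.finrank_mono (sup_le_sup_right ?_ U)
    rw [Module.End.mul_eq_comp, Submodule.map_comp]
    exact Submodule.map_mono le_sup_left
  have hxx : W.map (x * x) ≤ U := claim x hxN (Submodule.map_mono hTW)
  have hxyx : ∀ y ∈ N, W.map (x * y * x) ≤ U := fun y hy => by
    refine claim (x * y) (hmul x hxN y hy) ?_
    rw [Module.End.mul_eq_comp, Submodule.map_comp]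
    exact Submodule.map_mono ((Submodule.map_mono hTW).trans (hinv y hy))
  set P := T ⊔ ⨆ y ∈ N, W.map (y * x) with hP
  have hPW : P ≤ W := by
    refine sup_le hTW (iSup₂_le fun y hy => ?_)
    exact hinv _ (hmul y hy x hxN)
  have hPinv : ∀ y ∈ N, P.map y ≤ P := by
    intro y hy
    simp only [hP, hT, Submodule.map_sup, Submodule.map_iSup]
    refine sup_le (sup_le ?_ ?_) (iSup₂_le fun z hz => ?_)
    · rw [← Submodule.map_comp, ← Module.End.mul_eq_comp]
      exact le_sup_of_le_right (le_iSup₂_of_le y hy le_rfl)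
    · exact (hUinv y hy).trans (le_sup_of_le_left le_sup_right)
    · rw [← Submodule.map_comp, ← Module.End.mul_eq_comp, ← mul_assoc]
      exact le_sup_of_le_right (le_iSup₂_of_le (y * z) (hmul y hy z hz) le_rfl)
  have hUP : U < P := by
    refine lt_of_le_of_ne (le_sup_of_le_left le_sup_right) fun h => hxU ?_
    rw [h]
    exact le_sup_of_le_left le_sup_left
  have hPeq : P = W := by
    by_contra hne
    exact hUmax P ⟨lt_of_le_of_ne hPW hne, hPinv⟩ hUP
  apply hxU
  rw [← hPeq]
  simp only [hP, hT, Submodule.map_sup, Submodule.map_iSup]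
  refine sup_le (sup_le ?_ (hUinv x hxN)) (iSup₂_le fun z hz => ?_)
  · rw [← Submodule.map_comp, ← Module.End.mul_eq_comp]
    exact hxx
  · rw [← Submodule.map_comp, ← Module.End.mul_eq_comp, ← mul_assoc]
    exact hxyx z hz

theorem isNilpotent_submodule_of_nil {F : Type*} [Field F] {n : Type*} [Fintype n]
    [DecidableEq n] [Algebra F K] {J : Submodule F (Matrix n n K)}
    (hmul : ∀ x ∈ J, ∀ y ∈ J, x * y ∈ J) (hnil : ∀ x ∈ J, IsNilpotent x) : IsNilpotent J := by
  let N : Set (Module.End K (n → K)) := (Matrix.toLinAlgEquiv' : Matrix n n K ≃ₐ[K] _) '' J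
  have hNmul : ∀ x ∈ N, ∀ y ∈ N, x * y ∈ N := by
    rintro _ ⟨x, hx, rfl⟩ _ ⟨y, hy, rfl⟩
    exact ⟨x * y, hmul x hx y hy, map_mul _ _ _⟩
  have hNnil : ∀ x ∈ N, IsNilpotent x := by
    rintro _ ⟨x, hx, rfl⟩
    exact (hnil x hx).map _
  -- The descending chain `V ⊇ N V ⊇ N N V ⊇ ⋯` is strict until it reaches zero.
  obtain ⟨W, hW0, hWs⟩ : ∃ W : ℕ → Submodule K (n → K),
      W 0 = ⊤ ∧ ∀ k, W (k + 1) = ⨆ y ∈ N, (W k).map y :=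
    ⟨fun k => Nat.rec ⊤ (fun _ U => ⨆ y ∈ N, U.map y) k, rfl, fun k => rfl⟩
  have hanti : ∀ k, W (k + 1) ≤ W k := by
    intro k
    induction k with
    | zero => rw [hW0]; exact le_top
    | succ k ih =>
      rw [hWs (k + 1)]
      conv_rhs => rw [hWs k]
      exact iSup₂_mono fun y _ => Submodule.map_mono ih
  have hdim : ∀ k, Module.finrank K ↥(W k) + k ≤ Module.finrank K (n → K) ∨ W k = ⊥ := by
    intro k
    induction k with
    | zero => exact Or.inl (by simpa using Submodule.finrank_le (W 0))
    | succ k ih =>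
      by_cases hk : W k = ⊥
      · exact Or.inr (le_bot_iff.1 (hk ▸ hanti k))
      obtain ⟨U, hU, hU'⟩ := exists_lt_of_nil hNmul hNnil hk fun y hy =>
        ((hWs k).symm ▸ le_iSup₂_of_le y hy le_rfl : _ ≤ W (k + 1)).trans (hanti k)
      have h1 : W (k + 1) ≤ U := hWs k ▸ iSup₂_le hU'
      have h2 := Submodule.finrank_mono h1
      have h3 := Submodule.finrank_lt_finrank_of_lt hU
      left
      have := ih.resolve_right hk
      omega
  have hbot : W (Module.finrank K (n → K) + 1) = ⊥ := (hdim _).resolve_left (by omega)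
  refine ⟨Module.finrank K (n → K) + 1, ?_⟩
  have key : ∀ k, ∀ x ∈ J ^ k, LinearMap.range (Matrix.toLinAlgEquiv' x) ≤ W k := by
    intro k
    induction k with
    | zero => rw [hW0]; exact fun x _ => le_top
    | succ k ih =>
      intro x hx
      rw [pow_succ'] at hx
      induction hx using Submodule.mul_induction_on' with
      | mem_mul_mem y hy z hz =>
        rw [map_mul, Module.End.mul_eq_comp, LinearMap.range_comp, hWs]
        exact (Submodule.map_mono (ih z hz)).trans
          (le_iSup₂_of_le (Matrix.toLinAlgEquiv' y) ⟨y, hy, rfl⟩ le_rfl)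
      | add y _ z _ hy hz =>
        rintro _ ⟨v, rfl⟩
        rw [map_add]
        exact Submodule.add_mem _ (hy ⟨v, rfl⟩) (hz ⟨v, rfl⟩)
  refine (Submodule.eq_bot_iff _).2 fun x hx => ?_
  have h1 := key _ x hx
  rw [hbot, le_bot_iff, LinearMap.range_eq_bot] at h1
  exact (map_eq_zero_iff _ (AlgEquiv.injective _)).1 h1

end NilSet

/-! ### Algebraic independence of ring homomorphisms -/

section Characters

/-- Dedekind's independence of characters, for a family in which only the character `ψ i₀` is
required to occur once. -/
theorem coeff_eq_zero_of_sum_characters {G K ι : Type*} [Monoid G] [Field K] {s : Finset ι}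
    {c : ι → K} {ψ : ι → G →* K} (h : ∀ g, ∑ i ∈ s, c i * ψ i g = 0) {i₀ : ι} (hi₀ : i₀ ∈ s)
    (huniq : ∀ i ∈ s, ψ i = ψ i₀ → i = i₀) : c i₀ = 0 := by
  classical
  have hli := linearIndependent_iff'.1 (linearIndependent_monoidHom G K) (s.image ψ)
    (fun φ => ∑ i ∈ s with ψ i = φ, c i) (by
      funext g
      rw [Finset.sum_apply, Pi.zero_apply, ← h g,
        ← Finset.sum_fiberwise_of_maps_to (fun i hi => Finset.mem_image_of_mem ψ hi)]
      refine Finset.sum_congr rfl fun φ _ => ?_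
      rw [Pi.smul_apply, smul_eq_mul, Finset.sum_mul]
      refine Finset.sum_congr rfl fun i hi => ?_
      rw [(Finset.mem_filter.1 hi).2])
    (ψ i₀) (Finset.mem_image_of_mem ψ hi₀)
  have h1 : (s.filter fun i => ψ i = ψ i₀) = {i₀} := by
    ext i
    simp only [Finset.mem_filter, Finset.mem_singleton]
    refine ⟨fun hi => huniq i hi.1 hi.2, ?_⟩
    rintro rfl
    exact ⟨hi₀, rfl⟩
  rwa [h1, Finset.sum_singleton] at hli

variable {C K X : Type*} [CommRing C] [Field K] [Fintype X]

/-- The monomial with exponents `m` in the ring homomorphisms `χ x`, as a multiplicative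
character of `C`. -/
def charMono (χ : X → C →+* K) (m : X → ℕ) : C →* K :=
  ∏ x, (χ x : C →* K) ^ m x

theorem charMono_apply (χ : X → C →+* K) (m : X → ℕ) (c : C) :
    charMono χ m c = ∏ x, χ x c ^ m x := by
  simp [charMono]

theorem charMono_zero_right (χ : X → C →+* K) {m : X → ℕ} (hm : m ≠ 0) : charMono χ m 0 = 0 := by
  obtain ⟨x, hx⟩ := Function.ne_iff.1 hm
  rw [charMono_apply]
  exact Finset.prod_eq_zero (Finset.mem_univ x) (by rw [map_zero, zero_pow hx])

theorem charMono_ne_of_ne_zero (χ : X → C →+* K) {m : X → ℕ} (hm : m ≠ 0) :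
    charMono χ 0 ≠ charMono χ m := by
  intro h
  have := congrArg (fun f : C →* K => f 0) h
  simp only [charMono_zero_right χ hm] at this
  simp [charMono_apply] at this

/-- The character `(u, v) ↦ χ ^ j (u) * χ ^ l (v)` of `C × C`. -/
def charPair (χ : X → C →+* K) (j l : X → ℕ) : C × C →* K :=
  (charMono χ j).comp (MonoidHom.fst C C) * (charMono χ l).comp (MonoidHom.snd C C)

theorem charPair_apply (χ : X → C →+* K) (j l : X → ℕ) (g : C × C) :
    charPair χ j l g = charMono χ j g.1 * charMono χ l g.2 := rfl

theorem charPair_eq_iff {χ : X → C →+* K} {j l j' l' : X → ℕ} :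
    charPair χ j l = charPair χ j' l' ↔
      charMono χ j = charMono χ j' ∧ charMono χ l = charMono χ l' := by
  constructor
  · intro h
    constructor
    · ext c
      simpa [charPair_apply] using congrArg (fun f : C × C →* K => f (c, 1)) h
    · ext c
      simpa [charPair_apply] using congrArg (fun f : C × C →* K => f (1, c)) h
  · rintro ⟨h1, h2⟩
    simp [charPair, h1, h2]

theorem charMono_add [DecidableEq X] (p : ℕ) [ExpChar K p] (χ : X → C →+* K) (a : ℕ) (m : X → ℕ)
    (g : C × C) :
    charMono χ (fun x => p ^ a * m x) (g.1 + g.2) =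
      ∑ j ∈ Fintype.piFinset fun x => Finset.range (m x + 1),
        (∏ x, ((m x).choose (j x) : K)) *
          charPair χ (fun x => p ^ a * j x) (fun x => p ^ a * (m x - j x)) g := by
  have h1 : charMono χ (fun x => p ^ a * m x) (g.1 + g.2) =
      ∏ x, ∑ k ∈ Finset.range (m x + 1), ((χ x g.1 ^ p ^ a) ^ k *
        (χ x g.2 ^ p ^ a) ^ (m x - k) * ((m x).choose k : K)) := by
    rw [charMono_apply]
    refine Finset.prod_congr rfl fun x _ => ?_
    rw [map_add, pow_mul, add_pow_expChar_pow, add_pow]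
  rw [h1, Finset.prod_univ_sum]
  refine Finset.sum_congr rfl fun j _ => ?_
  rw [charPair_apply, charMono_apply, charMono_apply, ← Finset.prod_mul_distrib,
    ← Finset.prod_mul_distrib]
  refine Finset.prod_congr rfl fun x _ => ?_
  rw [pow_mul, pow_mul, mul_comm]

theorem exists_eq_pow_mul {p : ℕ} (hp : p.Prime) (m : X → ℕ) (hm : m ≠ 0) :
    ∃ (a : ℕ) (m₁ : X → ℕ) (x : X), m = (fun y => p ^ a * m₁ y) ∧ ¬ p ∣ m₁ x := by
  induction h : ∑ x, m x using Nat.strong_induction_on generalizing m with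
  | _ d ih =>
    by_cases hx : ∃ x, ¬ p ∣ m x
    · obtain ⟨x, hx⟩ := hx
      exact ⟨0, m, x, by simp, hx⟩
    push Not at hx
    choose m' hm' using hx
    have hm0 : m' ≠ 0 := by
      rintro rfl
      exact hm (funext fun x => by simp [hm' x])
    obtain ⟨y, hy⟩ := Function.ne_iff.1 hm0
    have hpos : 0 < ∑ x, m' x :=
      Finset.sum_pos' (fun _ _ => Nat.zero_le _) ⟨y, Finset.mem_univ y, Nat.pos_of_ne_zero hy⟩
    have hlt : ∑ x, m' x < d := by
      rw [← h, Finset.sum_congr rfl fun x _ => hm' x, ← Finset.mul_sum]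
      nlinarith [hp.two_le]
    obtain ⟨a, m₁, x, h1, h2⟩ := ih _ hlt m' hm0 rfl
    refine ⟨a + 1, m₁, x, funext fun z => ?_, h2⟩
    rw [hm' z, h1, pow_succ', mul_assoc]

/-- The inductive step for `charMono_injective`: the coefficients of `χ ^ m (u + v)` in terms of
characters of `C × C` show that a monomial which coincides with another one of the same or smaller
degree is a `p`-power of a variable. -/
theorem eq_single_of_charMono_eq [DecidableEq X] {p : ℕ} [Fact p.Prime] [CharP K p]
    (χ : X → C →+* K) {d : ℕ}
    (ih : ∀ m m' : X → ℕ, ∑ x, m x < d → ∑ x, m' x < d → charMono χ m = charMono χ m' → m = m')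
    {a : ℕ} {m₁ m' : X → ℕ} {x : X} (hx : ¬ p ∣ m₁ x) (hd : ∑ y, p ^ a * m₁ y ≤ d)
    (hd' : ∑ y, m' y ≤ d)
    (heq : charMono χ (fun y => p ^ a * m₁ y) = charMono χ m')
    (hne : (fun y => p ^ a * m₁ y) ≠ m') : m₁ = Pi.single x 1 := by
  have hp : p.Prime := Fact.out
  have : ExpChar K p := ExpChar.prime hp
  by_contra hcon
  have hpa : 0 < p ^ a := pow_pos hp.pos a
  set j₀ : X → ℕ := Pi.single x 1 with hj₀
  have hm₁x : 0 < m₁ x := Nat.pos_of_ne_zero fun h => hx (h ▸ dvd_zero p)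
  have hj₀le : ∀ y, j₀ y ≤ m₁ y := by
    intro y
    by_cases hy : y = x
    · subst hy; simpa [hj₀] using Nat.succ_le_of_lt hm₁x
    · simp [hj₀, Pi.single_eq_of_ne hy]
  have hj₀0 : (fun y => p ^ a * j₀ y) ≠ 0 := fun h => by
    have := congrFun h x
    simp [hj₀, hp.ne_zero] at this
  have hl₀0 : (fun y => p ^ a * (m₁ y - j₀ y)) ≠ 0 := fun h => hcon <| funext fun y => by
    have h1 := congrFun h y
    have h2 := hj₀le y
    simp only [Pi.zero_apply, mul_eq_zero, hpa.ne', false_or] at h1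
    omega
  have hdeg : ∑ y, p ^ a * j₀ y + ∑ y, p ^ a * (m₁ y - j₀ y) ≤ d := by
    rw [← Finset.sum_add_distrib]
    refine le_trans (le_of_eq (Finset.sum_congr rfl fun y _ => ?_)) hd
    rw [← mul_add, Nat.add_sub_cancel' (hj₀le y)]
  have degpos : ∀ j : X → ℕ, j ≠ 0 → 0 < ∑ y, j y := by
    intro j hj
    obtain ⟨y, hy⟩ := Function.ne_iff.1 hj
    exact Finset.sum_pos' (fun _ _ => Nat.zero_le _) ⟨y, Finset.mem_univ y, Nat.pos_of_ne_zero hy⟩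
  have pair : ∀ j l : X → ℕ, ∑ y, j y + ∑ y, l y ≤ d →
      charPair χ j l = charPair χ (fun y => p ^ a * j₀ y) (fun y => p ^ a * (m₁ y - j₀ y)) →
      j = (fun y => p ^ a * j₀ y) ∧ l = fun y => p ^ a * (m₁ y - j₀ y) := by
    intro j l hjl h
    obtain ⟨h1, h2⟩ := charPair_eq_iff.1 h
    have hj : j ≠ 0 := fun h0 => charMono_ne_of_ne_zero χ hj₀0 (h0 ▸ h1)
    have hl : l ≠ 0 := fun h0 => charMono_ne_of_ne_zero χ hl₀0 (h0 ▸ h2)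
    have d1 := degpos j hj
    have d2 := degpos l hl
    have d3 := degpos _ hj₀0
    have d4 := degpos _ hl₀0
    exact ⟨ih _ _ (by omega) (by omega) h1, ih _ _ (by omega) (by omega) h2⟩
  let box : (X → ℕ) → Finset (X → ℕ) := fun m => Fintype.piFinset fun x => Finset.range (m x + 1)
  have hbox : ∀ m j, j ∈ box m ↔ ∀ y, j y ≤ m y := fun m j => by
    simp [box]
  have key := coeff_eq_zero_of_sum_characters (G := C × C) (K := K)
    (s := (box m₁).disjSum (box m'))
    (c := Sum.elim (fun j => ∏ y, ((m₁ y).choose (j y) : K))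
      (fun j => - ∏ y, ((m' y).choose (j y) : K)))
    (ψ := Sum.elim (fun j => charPair χ (fun y => p ^ a * j y) (fun y => p ^ a * (m₁ y - j y)))
      (fun j => charPair χ (fun y => p ^ 0 * j y) (fun y => p ^ 0 * (m' y - j y))))
    (i₀ := Sum.inl j₀) ?_ (Finset.inl_mem_disjSum.2 ((hbox _ _).2 hj₀le)) ?_
  · simp only [Sum.elim_inl] at key
    rw [Finset.prod_eq_single x] at key
    · rw [hj₀, Pi.single_eq_same, Nat.choose_one_right] at key
      exact hx ((CharP.cast_eq_zero_iff K p _).1 key)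
    · intro y _ hy
      simp [hj₀, Pi.single_eq_of_ne hy]
    · simp
  · intro g
    rw [Finset.sum_disjSum]
    simp only [Sum.elim_inl, Sum.elim_inr, neg_mul, Finset.sum_neg_distrib]
    rw [← charMono_add p χ a m₁ g, ← charMono_add p χ 0 m' g, heq]
    simp
  · rintro (j | j) hj h
    · have hj' := (hbox _ _).1 (Finset.inl_mem_disjSum.1 hj)
      obtain ⟨h1, -⟩ := pair _ _ (by
        rw [← Finset.sum_add_distrib]
        refine le_trans (le_of_eq (Finset.sum_congr rfl fun y _ => ?_)) hd
        rw [← mul_add, Nat.add_sub_cancel' (hj' y)]) h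
      congr 1
      funext y
      exact Nat.eq_of_mul_eq_mul_left hpa (congrFun h1 y)
    · exfalso
      have hj' := (hbox _ _).1 (Finset.inr_mem_disjSum.1 hj)
      obtain ⟨h1, h2⟩ := pair _ _ (by
        rw [← Finset.sum_add_distrib]
        refine le_trans (le_of_eq (Finset.sum_congr rfl fun y _ => ?_)) hd'
        rw [← mul_add, Nat.add_sub_cancel' (hj' y), pow_zero, one_mul]) h
      apply hne
      funext y
      have h3 := congrFun h1 y
      have h4 := congrFun h2 y
      have h5 := hj' y
      have h6 := hj₀le y
      simp only [pow_zero, one_mul] at h3 h4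
      calc p ^ a * m₁ y = p ^ a * j₀ y + p ^ a * (m₁ y - j₀ y) := by
            rw [← mul_add, Nat.add_sub_cancel' h6]
        _ = m' y := by omega

/-- Ring homomorphisms with distinct Frobenius twists have distinct monomials. -/
theorem charMono_injective {p : ℕ} [Fact p.Prime] [CharP K p] (χ : X → C →+* K)
    (hrel : ∀ x y a b, (∀ c, χ x c ^ p ^ a = χ y c ^ p ^ b) → x = y ∧ a = b) :
    Function.Injective (charMono χ) := by
  classical
  have main : ∀ d, ∀ m m' : X → ℕ, ∑ x, m x ≤ d → ∑ x, m' x ≤ d →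
      charMono χ m = charMono χ m' → m = m' := by
    intro d
    induction d using Nat.strong_induction_on with
    | _ d ih =>
      intro m m' hd hd' h
      by_contra hne
      have ih' : ∀ m m' : X → ℕ, ∑ x, m x < d → ∑ x, m' x < d →
          charMono χ m = charMono χ m' → m = m' := fun m m' h1 h2 =>
        ih _ (max_lt h1 h2) m m' (le_max_left _ _) (le_max_right _ _)
      have hm : m ≠ 0 := by
        rintro rfl
        exact charMono_ne_of_ne_zero χ (Ne.symm hne) h
      have hm' : m' ≠ 0 := by
        rintro rfl
        exact charMono_ne_of_ne_zero χ hne h.symm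
      obtain ⟨a, m₁, x, rfl, hx⟩ := exists_eq_pow_mul (Fact.out : p.Prime) m hm
      obtain ⟨b, m₂, y, rfl, hy⟩ := exists_eq_pow_mul (Fact.out : p.Prime) m' hm'
      obtain rfl := eq_single_of_charMono_eq χ ih' hx hd hd' h hne
      obtain rfl := eq_single_of_charMono_eq χ ih' hy hd' hd h.symm (Ne.symm hne)
      have hval : ∀ (a : ℕ) (x : X) (c : C),
          charMono χ (fun y => p ^ a * (Pi.single x 1 : X → ℕ) y) c = χ x c ^ p ^ a := by
        intro a x c
        rw [charMono_apply, Finset.prod_eq_single x]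
        · simp
        · intro y _ hy
          simp [Pi.single_eq_of_ne hy]
        · simp
      obtain ⟨rfl, rfl⟩ := hrel x y a b fun c => by rw [← hval, h, hval]
      exact hne rfl
  intro m m' h
  exact main _ m m' (le_max_left _ _) (le_max_right _ _) h

/-- Ring homomorphisms with distinct Frobenius twists are algebraically independent. -/
theorem eq_zero_of_forall_eval_eq_zero {p : ℕ} [Fact p.Prime] [CharP K p] (χ : X → C →+* K)
    (hrel : ∀ x y a b, (∀ c, χ x c ^ p ^ a = χ y c ^ p ^ b) → x = y ∧ a = b)
    {f : MvPolynomial X K} (hf : ∀ c, MvPolynomial.eval (fun x => χ x c) f = 0) : f = 0 := by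
  by_contra hne
  obtain ⟨m, hm⟩ := MvPolynomial.ne_zero_iff.1 hne
  apply hm
  refine coeff_eq_zero_of_sum_characters (G := C) (s := f.support)
    (c := fun m => MvPolynomial.coeff m f) (ψ := fun m => charMono χ m) (fun c => ?_)
    (MvPolynomial.mem_support_iff.2 hm) fun m' _ h => DFunLike.coe_injective
      (charMono_injective χ hrel h)
  rw [← hf c, MvPolynomial.eval_eq']
  exact Finset.sum_congr rfl fun m _ => by rw [charMono_apply]

end Characters

section ClosedField

variable {C K X : Type*} [CommRing C] [Field K] [Finite X]

theorem eq_of_forall_pow_eq {p : ℕ} (hp : p.Prime) [Infinite C] {χ : C →+* K}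
    (hχ : Function.Injective χ) {a b : ℕ} (h : ∀ c, χ c ^ p ^ a = χ c ^ p ^ b) : a = b := by
  have h1 : (Polynomial.X ^ p ^ a - Polynomial.X ^ p ^ b : Polynomial K) = 0 := by
    refine Polynomial.eq_zero_of_infinite_isRoot _ ?_
    refine (Set.infinite_range_of_injective hχ).mono ?_
    rintro _ ⟨c, rfl⟩
    simp [Polynomial.IsRoot, h c]
  have h2 := congrArg Polynomial.natDegree (sub_eq_zero.1 h1)
  simp only [Polynomial.natDegree_X_pow] at h2
  exact Nat.pow_right_injective hp.two_le h2

/-- An infinite ring `C`, embedded in a finite power of a field `K` of characteristic `p` as a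
closed subset whose coordinate maps `χ x` are injective, is a copy of `K` embedded by powers of the
Frobenius map: choosing a minimal coordinate in each class of coordinates related by powers of
Frobenius, algebraic independence identifies `C` with a power of `K`, and injectivity of the
coordinates implies that there is only one class. -/
theorem exists_frobenius_parametrization {p : ℕ} [Fact p.Prime] [CharP K p] [Infinite C]
    [Nonempty X] (χ : X → C →+* K) (hχ : ∀ x, Function.Injective (χ x))
    (hclosed : ∀ y : X → K, (∀ f : MvPolynomial X K,
      (∀ c, MvPolynomial.eval (fun x => χ x c) f = 0) → MvPolynomial.eval y f = 0) →
      ∃ c, ∀ x, χ x c = y x) :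
    ∃ (s : X → ℕ) (x₀ : X), s x₀ = 0 ∧ ∀ z : K, ∃ c, ∀ x, χ x c = z ^ p ^ s x := by
  classical
  have := Fintype.ofFinite X
  have hp : p.Prime := Fact.out
  have : ExpChar K p := ExpChar.prime hp
  let r : Setoid X :=
    { r := fun x y => ∃ a b : ℕ, ∀ c, χ x c ^ p ^ a = χ y c ^ p ^ b
      iseqv := ⟨fun x => ⟨0, 0, fun _ => rfl⟩, fun ⟨a, b, h⟩ => ⟨b, a, fun c => (h c).symm⟩,
        fun {x y z} ⟨a, b, h⟩ ⟨c, d, h'⟩ => ⟨a + c, d + b, fun e => by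
          rw [pow_add, pow_mul, h, ← pow_mul, mul_comm, pow_mul, h', ← pow_mul, ← pow_add]⟩⟩ }
  let le : X → X → Prop := fun x y => ∃ a : ℕ, ∀ c, χ y c = χ x c ^ p ^ a
  have le_trans' : ∀ x y z, le x y → le y z → le x z := by
    rintro x y z ⟨a, h⟩ ⟨b, h'⟩
    exact ⟨a + b, fun c => by rw [h', h, ← pow_mul, ← pow_add]⟩
  have le_of_rel : ∀ x y a b, a ≤ b → (∀ c, χ x c ^ p ^ a = χ y c ^ p ^ b) → le y x := by
    intro x y a b hab h
    refine ⟨b - a, fun c => iterateFrobenius_inj K p a ?_⟩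
    rw [iterateFrobenius_def, iterateFrobenius_def, h, ← pow_mul, ← pow_add, Nat.sub_add_cancel hab]
  have le_total' : ∀ x y, r x y → le x y ∨ le y x := by
    rintro x y ⟨a, b, h⟩
    rcases _root_.le_total a b with hab | hab
    · exact Or.inr (le_of_rel x y a b hab h)
    · exact Or.inl (le_of_rel y x b a hab fun c => (h c).symm)
  have hmin : ∀ q : Quotient r, ∃ x, Quotient.mk r x = q ∧ ∀ y, Quotient.mk r y = q → le x y := by
    intro q
    obtain ⟨x, hx, hmax⟩ := Finset.exists_max_image
      (Finset.univ.filter fun x => Quotient.mk r x = q)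
      (fun x => (Finset.univ.filter fun y => le x y).card)
      ⟨q.out, by simp⟩
    have hxq : Quotient.mk r x = q := by simpa using hx
    refine ⟨x, hxq, fun y hy => ?_⟩
    by_contra hxy
    have hyx := (le_total' x y (Quotient.exact (hxq.trans hy.symm))).resolve_left hxy
    have h1 := hmax y (by simpa using hy)
    refine absurd h1 (not_le_of_gt (Finset.card_lt_card ?_))
    refine Finset.ssubset_iff_of_subset (fun z hz => ?_) |>.2 ⟨y, ?_, ?_⟩
    · simp only [Finset.mem_filter, Finset.mem_univ, true_and] at hz ⊢
      exact le_trans' y x z hyx hz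
    · simpa using (⟨0, fun c => by simp⟩ : le y y)
    · simpa using hxy
  choose g hg hgle using hmin
  have hrel : ∀ x y a b, (∀ c, χ (g x) c ^ p ^ a = χ (g y) c ^ p ^ b) → x = y ∧ a = b := by
    intro x y a b h
    have hxy : x = y := by
      rw [← hg x, ← hg y]
      exact Quotient.sound ⟨a, b, h⟩
    subst hxy
    exact ⟨rfl, eq_of_forall_pow_eq hp (hχ (g x)) h⟩
  choose s hs using fun x => hgle (Quotient.mk r x) x rfl
  have hs0 : ∀ q, s (g q) = 0 := by
    intro q
    refine (eq_of_forall_pow_eq hp (hχ (g q)) (a := 0) fun c => ?_).symm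
    have := hs (g q) c
    rw [hg] at this
    rw [pow_zero, pow_one]
    exact this
  have hsurj : ∀ z : Quotient r → K, ∃ c, ∀ x, χ x c = z (Quotient.mk r x) ^ p ^ s x := by
    intro z
    refine hclosed _ fun f hf => ?_
    have h0 : ∀ (f : MvPolynomial X K) (w : Quotient r → K), MvPolynomial.eval w (MvPolynomial.aeval
        (fun x => (MvPolynomial.X (Quotient.mk r x) : MvPolynomial (Quotient r) K) ^ p ^ s x) f) =
        MvPolynomial.eval (fun x => w (Quotient.mk r x) ^ p ^ s x) f := by
      intro f w
      induction f using MvPolynomial.induction_on with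
      | C a => simp [MvPolynomial.algebraMap_eq]
      | add p q hp hq => simp only [map_add, hp, hq]
      | mul_X p i hp =>
        simp only [map_mul, hp, MvPolynomial.aeval_X, map_pow, MvPolynomial.eval_X]
    have h1 := eq_zero_of_forall_eval_eq_zero (fun q => χ (g q)) hrel (f := MvPolynomial.aeval
        (fun x => (MvPolynomial.X (Quotient.mk r x) : MvPolynomial (Quotient r) K) ^ p ^ s x) f)
      fun c => by
        rw [h0, ← hf c]
        congr 2
        funext x
        exact (hs x c).symm
    rw [← h0, h1, map_zero]
  obtain ⟨x₁⟩ := ‹Nonempty X›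
  have hone : ∀ q q' : Quotient r, q = q' := by
    intro q q'
    by_contra hne
    obtain ⟨c, hc⟩ := hsurj (Pi.single q 1)
    have h1 := hc (g q)
    have h2 := hc (g q')
    rw [hg, Pi.single_eq_same, one_pow] at h1
    rw [hg, Pi.single_eq_of_ne (Ne.symm hne), zero_pow (pow_pos hp.pos _).ne'] at h2
    rw [(map_eq_zero_iff _ (hχ _)).1 h2, map_zero] at h1
    exact zero_ne_one h1
  refine ⟨s, g (Quotient.mk r x₁), hs0 _, fun z => ?_⟩
  obtain ⟨c, hc⟩ := hsurj fun _ => z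
  exact ⟨c, hc⟩

end ClosedField

/-! ### Rings in which every element is nilpotent or invertible -/

section LocalRing

variable {M : Type*} [Ring M] [Nontrivial M] {R : Subring M}

theorem mul_ne_one_of_isNilpotent {a c : M} (ha : IsNilpotent a) : c * a ≠ 1 := by
  intro h
  obtain ⟨k, hk⟩ := ha
  have key : ∀ k, c ^ k * a ^ k = 1 := by
    intro k
    induction k with
    | zero => simp
    | succ k ih => rw [pow_succ, pow_succ', mul_assoc, ← mul_assoc c a, h, one_mul, ih]
  have := key k
  rw [hk, mul_zero] at this
  exact zero_ne_one this

theorem isNilpotent_mul_of_isNilpotent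
    (hR : ∀ a ∈ R, IsNilpotent a ∨ ∃ b ∈ R, a * b = 1 ∧ b * a = 1)
    {a r : M} (hr : r ∈ R) (ha : a ∈ R) (h : IsNilpotent a) : IsNilpotent (r * a) := by
  refine (hR _ (R.mul_mem hr ha)).resolve_right ?_
  rintro ⟨b, -, -, hb⟩
  rw [← mul_assoc] at hb
  exact mul_ne_one_of_isNilpotent h hb

theorem isNilpotent_add_of_isNilpotent
    (hR : ∀ a ∈ R, IsNilpotent a ∨ ∃ b ∈ R, a * b = 1 ∧ b * a = 1)
    {a b : M} (ha : a ∈ R) (hb : b ∈ R) (h : IsNilpotent a) (h' : IsNilpotent b) :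
    IsNilpotent (a + b) := by
  refine (hR _ (R.add_mem ha hb)).resolve_right ?_
  rintro ⟨u, hu, -, h1⟩
  have h2 := isNilpotent_mul_of_isNilpotent hR hu ha h
  have h3 := h2.isUnit_one_sub
  rw [← h1, mul_add, add_sub_cancel_left] at h3
  obtain ⟨v, hv⟩ := h3.exists_left_inv
  rw [← mul_assoc] at hv
  exact mul_ne_one_of_isNilpotent h' hv

theorem isNilpotent_sum_of_isNilpotent
    (hR : ∀ a ∈ R, IsNilpotent a ∨ ∃ b ∈ R, a * b = 1 ∧ b * a = 1) {ι : Type*} (s : Finset ι)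
    {a : ι → M} (ha : ∀ i ∈ s, a i ∈ R) (h : ∀ i ∈ s, IsNilpotent (a i)) :
    IsNilpotent (∑ i ∈ s, a i) := by
  classical
  induction s using Finset.induction_on with
  | empty => simp
  | insert i s hi ih =>
    rw [Finset.sum_insert hi]
    exact isNilpotent_add_of_isNilpotent hR (ha i (Finset.mem_insert_self i s))
      (R.sum_mem fun j hj => ha j (Finset.mem_insert_of_mem hj)) (h i (Finset.mem_insert_self i s))
      (ih (fun j hj => ha j (Finset.mem_insert_of_mem hj))
        fun j hj => h j (Finset.mem_insert_of_mem hj))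

/-- If finitely many elements represent all residue classes modulo the nilpotent elements, then the
residue ring is a finite division ring, hence commutative. -/
theorem isNilpotent_commutator (hR : ∀ a ∈ R, IsNilpotent a ∨ ∃ b ∈ R, a * b = 1 ∧ b * a = 1)
    {ι : Type*} [Finite ι] (f : ι → M) (hf : ∀ i, f i ∈ R)
    (hsurj : ∀ a ∈ R, ∃ i, IsNilpotent (a - f i)) {a b : M} (ha : a ∈ R) (hb : b ∈ R) :
    IsNilpotent (a * b - b * a) := by
  let I : Ideal R :=
    { carrier := {a | IsNilpotent (a : M)}
      zero_mem' := by simp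
      add_mem' := fun {a b} h h' => isNilpotent_add_of_isNilpotent hR a.2 b.2 h h'
      smul_mem' := fun c a h => isNilpotent_mul_of_isNilpotent hR c.2 a.2 h }
  have hI : ∀ a : R, a ∈ I ↔ IsNilpotent (a : M) := fun _ => Iff.rfl
  have : I.IsTwoSided := ⟨fun {a} b h => isNilpotent_mul_comm
    (isNilpotent_mul_of_isNilpotent hR b.2 a.2 h)⟩
  have : Finite (R ⧸ I) := by
    refine Finite.of_surjective (fun i => Ideal.Quotient.mk I ⟨f i, hf i⟩) fun x => ?_
    obtain ⟨a, rfl⟩ := Ideal.Quotient.mk_surjective x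
    obtain ⟨i, hi⟩ := hsurj a a.2
    exact ⟨i, ((Ideal.Quotient.mk_eq_mk_iff_sub_mem _ _).2 ((hI _).2 hi)).symm⟩
  have : Nontrivial (R ⧸ I) := Ideal.Quotient.nontrivial_iff.2 fun h => by
    have h1 : (1 : R) ∈ I := h ▸ Submodule.mem_top
    exact not_isNilpotent_one ((hI _).1 h1)
  have : NoZeroDivisors (R ⧸ I) := by
    refine ⟨fun {x y} hxy => ?_⟩
    obtain ⟨a, rfl⟩ := Ideal.Quotient.mk_surjective x
    obtain ⟨b, rfl⟩ := Ideal.Quotient.mk_surjective y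
    rw [← map_mul, Ideal.Quotient.eq_zero_iff_mem] at hxy
    rw [Ideal.Quotient.eq_zero_iff_mem, Ideal.Quotient.eq_zero_iff_mem]
    refine (hR a a.2).imp id ?_
    rintro ⟨c, hc, -, h⟩
    have := I.mul_mem_left ⟨c, hc⟩ hxy
    rw [hI] at this ⊢
    have h2 : (c : M) * (a * b) = b := by rw [← mul_assoc, h, one_mul]
    rwa [← h2]
  have : IsDomain (R ⧸ I) := { }
  have h1 := (Finite.isDomain_to_isField (R ⧸ I)).mul_comm (Ideal.Quotient.mk I ⟨a, ha⟩)
    (Ideal.Quotient.mk I ⟨b, hb⟩)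
  rw [← map_mul, ← map_mul] at h1
  exact (hI _).1 ((Ideal.Quotient.mk_eq_mk_iff_sub_mem _ _).1 h1)

end LocalRing

/-! ### Simultaneous diagonalization -/

section Diagonalization

theorem linearMap_ext_of_iSup_eq_top {K V : Type*} [Field K] [AddCommGroup V] [Module K V]
    {ι : Sort*} {W : ι → Submodule K V} (hW : ⨆ i, W i = ⊤)
    {f g : Module.End K V} (h : ∀ i, ∀ v ∈ W i, f v = g v) : f = g := by
  have : ⨆ i, W i ≤ LinearMap.eqLocus f g := iSup_le fun i v hv => h i v hv
  rw [hW] at this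
  exact LinearMap.ext fun v => this Submodule.mem_top

variable {K V : Type*} [Field K] [IsAlgClosed K] [AddCommGroup V] [Module K V]
  [FiniteDimensional K V]

open scoped IsMulCommutative in
/-- A commutative ring of semisimple endomorphisms is simultaneously diagonalizable, and the
projections onto the simultaneous eigenspaces are linear combinations of elements of the ring. -/
theorem exists_simultaneous_diagonalization (C : Subring (Module.End K V)) [IsMulCommutative C]
    (hC : ∀ c ∈ C, c.IsSemisimple) :
    ∃ (k : ℕ) (χ : Fin k → C →+* K) (π : Fin k → Module.End K V),
      (∀ x, π x ∈ Submodule.span K (C : Set (Module.End K V))) ∧ ∑ x, π x = 1 ∧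
      (∀ x y, π x * π y = if x = y then π x else 0) ∧ (∀ x, π x ≠ 0) ∧
      ∀ c : C, (c : Module.End K V) = ∑ x, χ x c • π x := by
  classical
  let W : (C → K) → Submodule K V := fun χ => ⨅ c : C, (c : Module.End K V).maxGenEigenspace (χ c)
  have hcomm : Pairwise fun c d : C => Commute (c : Module.End K V) d := fun c d _ =>
    congrArg Subtype.val (mul_comm c d)
  have htop : ⨆ χ, W χ = ⊤ :=
    Module.End.iSup_iInf_maxGenEigenspace_eq_top_of_iSup_maxGenEigenspace_eq_top_of_commute _ hcomm
      fun c => Module.End.iSup_maxGenEigenspace_eq_top _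
  have hind : iSupIndep W := by
    refine Module.End.independent_iInf_maxGenEigenspace_of_forall_mapsTo _ fun i j φ => ?_
    exact Module.End.mapsTo_maxGenEigenspace_of_comm
      (congrArg Subtype.val (mul_comm j i)) φ
  have hfin : {χ | W χ ≠ ⊥}.Finite := WellFoundedGT.finite_ne_bot_of_iSupIndep hind
  have hact : ∀ χ, ∀ v ∈ W χ, ∀ c : C, (c : Module.End K V) v = χ c • v := by
    intro χ v hv c
    have h1 := (Submodule.mem_iInf _).1 hv c
    rw [(hC c c.2).isFinitelySemisimple.maxGenEigenspace_eq_eigenspace] at h1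
    exact Module.End.mem_eigenspace_iff.1 h1
  have := hfin.fintype
  let e := (Fintype.equivFin {χ | W χ ≠ ⊥}).symm
  have hex : ∀ x, ∃ v ∈ W (e x).1, v ≠ 0 := fun x => Submodule.exists_mem_ne_zero_of_ne_bot (e x).2
  choose v hv hv0 using hex
  have inj : ∀ {x} {r s : K}, r • v x = s • v x → r = s := fun {x r s} h =>
    smul_left_injective K (hv0 x) h
  let χ : Fin (Fintype.card {χ | W χ ≠ ⊥}) → C →+* K := fun x =>
    { toFun := (e x).1
      map_one' := inj (x := x) (by rw [← hact _ _ (hv x)]; simp)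
      map_mul' := fun c d => inj (x := x) (by
        rw [← hact _ _ (hv x), mul_smul, ← hact _ _ (hv x) d, ← map_smul, mul_comm,
          ← hact _ _ (hv x) c, Subring.coe_mul]
        rfl)
      map_zero' := inj (x := x) (by rw [← hact _ _ (hv x)]; simp)
      map_add' := fun c d => inj (x := x) (by
        rw [← hact _ _ (hv x), add_smul, ← hact _ _ (hv x), ← hact _ _ (hv x)]
        simp) }
  have hχ : ∀ x, (χ x : C → K) = (e x).1 := fun x => rfl
  have hχinj : ∀ x y, χ x = χ y → x = y := by
    intro x y h
    apply e.injective
    apply Subtype.ext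
    rw [← hχ, ← hχ, h]
  have htop' : ⨆ x, W (e x).1 = ⊤ := by
    rw [← htop]
    refine le_antisymm (iSup_le fun x => le_iSup W _) (iSup_le fun φ => ?_)
    by_cases h : W φ = ⊥
    · rw [h]; exact bot_le
    · refine le_iSup_of_le (e.symm ⟨φ, h⟩) ?_
      rw [Equiv.apply_symm_apply]
  -- By independence of characters, the vectors of values of the characters span everything.
  have hspan : Submodule.span K (Set.range fun (c : C) x => χ x c) = ⊤ := by
    by_contra hne
    obtain ⟨f, hf0, hf⟩ := Submodule.exists_le_ker_of_lt_top _ (lt_top_iff_ne_top.2 hne)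
    apply hf0
    have hfe : ∀ w : Fin _ → K, f w = ∑ x, f (Pi.single x 1) * w x := by
      intro w
      conv_lhs => rw [pi_eq_sum_univ' w, map_sum]
      exact Finset.sum_congr rfl fun x _ => by rw [map_smul, smul_eq_mul, mul_comm]
    have h0 : ∀ x, f (Pi.single x 1) = 0 := by
      intro x
      refine coeff_eq_zero_of_sum_characters (G := C) (s := Finset.univ)
        (c := fun x => f (Pi.single x 1)) (ψ := fun x => (χ x : C →* K)) (fun c => ?_)
        (Finset.mem_univ x) fun y _ h => hχinj y x (RingHom.ext fun c => DFunLike.congr_fun h c)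
      have := hf (Submodule.subset_span ⟨c, rfl⟩)
      rw [LinearMap.mem_ker, hfe] at this
      exact this
    ext x
    simpa using h0 x
  have hproj : ∀ w : Fin (Fintype.card {χ | W χ ≠ ⊥}) → K,
      ∃ P ∈ Submodule.span K (C : Set (Module.End K V)),
        ∀ y, ∀ u ∈ W (e y).1, P u = w y • u := by
    intro w
    have hw : w ∈ Submodule.span K (Set.range fun (c : C) x => χ x c) := hspan ▸ Submodule.mem_top
    induction hw using Submodule.span_induction with
    | mem w hw =>
      obtain ⟨c, rfl⟩ := hw
      exact ⟨c, Submodule.subset_span c.2, fun y u hu => hact _ _ hu c⟩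
    | zero => exact ⟨0, Submodule.zero_mem _, fun y u _ => by simp⟩
    | add w w' _ _ h h' =>
      obtain ⟨P, hP, hP'⟩ := h
      obtain ⟨Q, hQ, hQ'⟩ := h'
      exact ⟨P + Q, Submodule.add_mem _ hP hQ, fun y u hu => by
        rw [LinearMap.add_apply, hP' y u hu, hQ' y u hu, Pi.add_apply, add_smul]⟩
    | smul r w _ h =>
      obtain ⟨P, hP, hP'⟩ := h
      exact ⟨r • P, Submodule.smul_mem _ r hP, fun y u hu => by
        rw [LinearMap.smul_apply, hP' y u hu, Pi.smul_apply, smul_eq_mul, mul_smul]⟩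
  choose π hπ hπ' using fun x => hproj (Pi.single x 1)
  have hπ1 : ∀ x y, ∀ u ∈ W (e y).1, π x u = if y = x then u else 0 := by
    intro x y u hu
    rw [hπ' x y u hu, Pi.single_apply, ite_smul, one_smul, zero_smul]
  refine ⟨_, χ, π, hπ, ?_, fun x y => ?_, fun x h => ?_, fun c => ?_⟩
  · refine linearMap_ext_of_iSup_eq_top htop' fun y u hu => ?_
    rw [LinearMap.sum_apply, Finset.sum_congr rfl fun x _ => hπ1 x y u hu]
    simp
  · refine linearMap_ext_of_iSup_eq_top htop' fun z u hu => ?_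
    rw [Module.End.mul_apply, hπ1 y z u hu]
    by_cases hzy : z = y
    · subst hzy
      rw [if_pos rfl, hπ1 x z u hu]
      by_cases hzx : z = x
      · subst hzx
        rw [if_pos rfl, if_pos rfl, hπ1 z z u hu, if_pos rfl]
      · rw [if_neg hzx, if_neg (Ne.symm hzx), LinearMap.zero_apply]
    · rw [if_neg hzy, map_zero]
      by_cases hxy : x = y
      · rw [if_pos hxy, hπ1 x z u hu, if_neg (hxy ▸ hzy)]
      · rw [if_neg hxy, LinearMap.zero_apply]
  · have := hπ1 x x (v x) (hv x)
    rw [h, if_pos rfl, LinearMap.zero_apply] at this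
    exact hv0 x this.symm
  · refine linearMap_ext_of_iSup_eq_top htop' fun y u hu => ?_
    rw [LinearMap.sum_apply, Finset.sum_congr rfl fun x _ => by
      rw [LinearMap.smul_apply, hπ1 x y u hu], hact _ _ hu c]
    simp [hχ]

end Diagonalization

/-! ### Maximal tori over finite fields -/

section Torus

theorem coeff_eq_of_sum_smul_eq {K V : Type*} [Field K] [AddCommGroup V] [Module K V] {k : ℕ}
    {π : Fin k → Module.End K V}
    (hπ : ∀ x y, π x * π y = if x = y then π x else 0) (hπ0 : ∀ x, π x ≠ 0) {y z : Fin k → K}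
    (h : ∑ x, y x • π x = ∑ x, z x • π x) (x : Fin k) : y x = z x := by
  have key : ∀ y : Fin k → K, (∑ x, y x • π x) * π x = y x • π x := by
    intro y
    rw [Finset.sum_mul, Finset.sum_eq_single x]
    · rw [smul_mul_assoc, hπ, if_pos rfl]
    · intro z _ hz
      rw [smul_mul_assoc, hπ, if_neg hz, smul_zero]
    · simp
  have h1 : y x • π x = z x • π x := by rw [← key y, ← key z, h]
  exact smul_left_injective K (hπ0 x) h1

variable {K V : Type*} [Field K] [IsAlgClosed K] [AddCommGroup V] [Module K V]
  [FiniteDimensional K V]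

/-- Every subring of `End K V` contains a maximal commutative subring of semisimple elements. -/
theorem exists_maximal_torus (R : Subring (Module.End K V)) :
    ∃ C : Subring (Module.End K V), C ≤ R ∧ IsMulCommutative C ∧ (∀ c ∈ C, c.IsSemisimple) ∧
      ∀ a ∈ R, a.IsSemisimple → (∀ c ∈ C, Commute a c) → a ∈ C := by
  let S : Set (Set (Module.End K V)) :=
    {s | s ⊆ R ∧ (∀ c ∈ s, c.IsSemisimple) ∧ ∀ c ∈ s, ∀ d ∈ s, Commute c d}
  obtain ⟨s, ⟨hsR, hss, hsc⟩, hmax⟩ := zorn_subset S (by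
    intro c hc hchain
    refine ⟨⋃₀ c, ⟨Set.sUnion_subset fun t ht => (hc ht).1, ?_, ?_⟩, fun t ht =>
      Set.subset_sUnion_of_mem ht⟩
    · rintro x ⟨t, ht, hx⟩
      exact (hc ht).2.1 x hx
    · rintro x ⟨t, ht, hx⟩ y ⟨u, hu, hy⟩
      rcases hchain.total ht hu with h | h
      · exact (hc hu).2.2 x (h hx) y hy
      · exact (hc ht).2.2 x hx y (h hy))
  have key : ∀ a ∈ R, a.IsSemisimple → (∀ c ∈ s, Commute a c) → a ∈ s := by
    intro a ha hass hac
    have h1 : insert a s ∈ S := by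
      refine ⟨Set.insert_subset ha hsR, ?_, ?_⟩
      · rintro c (rfl | hc)
        · exact hass
        · exact hss c hc
      · rintro c (rfl | hc) d (rfl | hd)
        · exact Commute.refl _
        · exact hac d hd
        · exact (hac c hc).symm
        · exact hsc c hc d hd
    exact hmax h1 (Set.subset_insert a s) (Set.mem_insert a s)
  let C : Subring (Module.End K V) :=
    { carrier := s
      mul_mem' := fun {a b} ha hb => key _ (R.mul_mem (hsR ha) (hsR hb))
        ((hss a ha).mul_of_commute (hsc a ha b hb) (hss b hb))
        fun c hc => (hsc a ha c hc).mul_left (hsc b hb c hc)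
      one_mem' := key _ R.one_mem Module.End.isSemisimple_id fun c _ => Commute.one_left c
      add_mem' := fun {a b} ha hb => key _ (R.add_mem (hsR ha) (hsR hb))
        ((hss a ha).add_of_commute (hsc a ha b hb) (hss b hb))
        fun c hc => (hsc a ha c hc).add_left (hsc b hb c hc)
      zero_mem' := key _ R.zero_mem Module.End.isSemisimple_zero fun c _ => Commute.zero_left c
      neg_mem' := fun {a} ha => key _ (R.neg_mem (hsR ha))
        (Module.End.isSemisimple_neg.2 (hss a ha)) fun c hc => (hsc a ha c hc).neg_left }
  exact ⟨C, hsR, ⟨⟨fun a b => Subtype.ext (hsc a a.2 b b.2)⟩⟩, hss, key⟩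

theorem isSemisimple_of_mem_span (C : Subring (Module.End K V)) [IsMulCommutative C]
    (hC : ∀ c ∈ C, c.IsSemisimple) {a : Module.End K V}
    (ha : a ∈ Submodule.span K (C : Set (Module.End K V))) :
    a.IsSemisimple ∧ ∀ c ∈ C, Commute a c := by
  have h1 : ∀ a ∈ Submodule.span K (C : Set (Module.End K V)), ∀ c ∈ C, Commute a c := by
    intro a ha c hc
    induction ha using Submodule.span_induction with
    | mem x hx => exact congrArg Subtype.val (mul_comm' (⟨x, hx⟩ : C) ⟨c, hc⟩)
    | zero => exact Commute.zero_left c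
    | add x y _ _ hx hy => exact hx.add_left hy
    | smul r x _ hx => exact hx.smul_left r
  have h2 : ∀ a ∈ Submodule.span K (C : Set (Module.End K V)),
      ∀ b ∈ Submodule.span K (C : Set (Module.End K V)), Commute a b := by
    intro a ha b hb
    induction hb using Submodule.span_induction with
    | mem x hx => exact h1 a ha x hx
    | zero => exact Commute.zero_right a
    | add x y _ _ hx hy => exact hx.add_right hy
    | smul r x _ hx => exact hx.smul_right r
  refine ⟨?_, h1 a ha⟩
  induction ha using Submodule.span_induction with
  | mem x hx => exact hC x hx
  | zero => exact Module.End.isSemisimple_zero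
  | add x y hx' hy' hx hy => exact hx.add_of_commute (h2 x hx' y hy') hy
  | smul r x _ hx => exact Module.End.IsSemisimple_smul r hx

/-- If `x ↦ x ^ p ^ s` is the identity of a finite field of characteristic `p`, then `p ^ s` is a
power of its order. -/
theorem exists_pow_eq_card_pow {F : Type*} [Field F] [Fintype F] {p : ℕ} [Fact p.Prime] [CharP F p]
    {s : ℕ} (h : ∀ x : F, x ^ p ^ s = x) : ∃ t, p ^ s = Fintype.card F ^ t := by
  let _ := ZMod.algebra F p
  have h1 : FiniteField.frobeniusAlgHom (ZMod p) F ^ s = 1 := by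
    refine AlgHom.ext fun x => ?_
    rw [AlgHom.coe_pow, FiniteField.coe_frobeniusAlgHom, pow_iterate, ZMod.card, AlgHom.one_apply]
    exact h x
  have h2 := orderOf_dvd_of_pow_eq_one h1
  rw [FiniteField.orderOf_frobeniusAlgHom] at h2
  obtain ⟨t, rfl⟩ := h2
  refine ⟨t, ?_⟩
  rw [Module.card_eq_pow_finrank (K := ZMod p) (V := F), ZMod.card, pow_mul]

open scoped IsMulCommutative in
/-- A maximal torus of a closed ring over a finite field, all of whose elements are nilpotent or
invertible, is a finite field or a copy of `K`, and it acts by powers of the Frobenius map on its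
simultaneous eigenspaces. -/
theorem exists_torus_parametrization {F : Type*} [Field F] [Fintype F] [Algebra F K] [Nontrivial V]
    {R : Subring (Module.End K V)} (hRc : PolyClosed K (R : Set (Module.End K V)))
    (hRF : ∀ c : F, algebraMap F K c • (1 : Module.End K V) ∈ R)
    (hR : ∀ a ∈ R, IsNilpotent a ∨ ∃ b ∈ R, a * b = 1 ∧ b * a = 1) :
    ∃ L : IntermediateField F K, (Finite L ∨ L = ⊤) ∧ ∃ (φ : L →+* Module.End K V) (k : ℕ)
      (π : Fin k → Module.End K V) (t : Fin k → ℕ), (∀ l, φ l ∈ R) ∧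
      (∀ x, π x ∈ Submodule.span K (R : Set (Module.End K V))) ∧ ∑ x, π x = 1 ∧
      (∀ x y, π x * π y = if x = y then π x else 0) ∧ (∀ x, π x ≠ 0) ∧
      (∀ l : L, φ l = ∑ x, (l : K) ^ Fintype.card F ^ t x • π x) ∧
      ∀ a ∈ R, a.IsSemisimple → (∀ l, Commute a (φ l)) → ∃ l, a = φ l := by
  obtain ⟨C, hCR, hcomm, hCss, hCmax⟩ := exists_maximal_torus R
  obtain ⟨k, χ, π, hπC, hπ1, hππ, hπ0, hC⟩ := exists_simultaneous_diagonalization C hCss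
  have hcoef : ∀ (c : C) (y : Fin k → K), (c : Module.End K V) = ∑ x, y x • π x →
      ∀ x, χ x c = y x := fun c y h x => coeff_eq_of_sum_smul_eq hππ hπ0 ((hC c).symm.trans h) x
  have hCF : ∀ c : F, algebraMap F K c • (1 : Module.End K V) ∈ C := fun c =>
    hCmax _ (hRF c) (Module.End.IsSemisimple_smul _ Module.End.isSemisimple_id)
      fun d _ => (Commute.one_left d).smul_left _
  have hχF : ∀ (c : F) x, χ x ⟨_, hCF c⟩ = algebraMap F K c := fun c x =>
    hcoef ⟨_, hCF c⟩ (fun _ => algebraMap F K c) (by rw [← Finset.smul_sum, hπ1]) x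
  have hχinj : ∀ x, Function.Injective (χ x) := by
    intro x
    refine (injective_iff_map_eq_zero _).2 fun c hc => ?_
    rcases hR c (hCR c.2) with h | ⟨b, -, -, hb⟩
    · exact Subtype.ext (Module.End.eq_zero_of_isNilpotent_isSemisimple h (hCss c c.2))
    · exfalso
      apply hπ0 x
      have h1 : (c : Module.End K V) * π x = 0 := by
        rw [hC c, Finset.sum_mul, Finset.sum_eq_single x]
        · rw [hc, zero_smul, zero_mul]
        · intro z _ hz
          rw [smul_mul_assoc, hππ, if_neg hz, smul_zero]
        · simp
      rw [← one_mul (π x), ← hb, mul_assoc, h1, mul_zero]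
  have hk : Nonempty (Fin k) := by
    by_contra h
    rw [not_nonempty_iff] at h
    rw [Finset.univ_eq_empty, Finset.sum_empty] at hπ1
    exact zero_ne_one hπ1
  have hCspan : ∀ a ∈ R, a ∈ Submodule.span K (C : Set (Module.End K V)) → a ∈ C := fun a ha haC =>
    hCmax a ha (isSemisimple_of_mem_span C hCss haC).1 (isSemisimple_of_mem_span C hCss haC).2
  have hπR : ∀ x, π x ∈ Submodule.span K (R : Set (Module.End K V)) := fun x =>
    Submodule.span_mono hCR (hπC x)
  -- It remains to find a parametrization of `C` by a subfield.
  suffices H : ∃ L : IntermediateField F K, (Finite L ∨ L = ⊤) ∧ ∃ (e : L ≃+* C) (t : Fin k → ℕ),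
      ∀ l x, χ x (e l) = (l : K) ^ Fintype.card F ^ t x by
    obtain ⟨L, hL, e, t, he⟩ := H
    refine ⟨L, hL, C.subtype.comp e.toRingHom, k, π, t, fun l => hCR (e l).2, hπR, hπ1, hππ, hπ0,
      fun l => ?_, fun a ha hass hac => ?_⟩
    · simp only [← he]
      exact hC (e l)
    · refine ⟨e.symm ⟨a, hCmax a ha hass fun c hc => ?_⟩, ?_⟩
      · have := hac (e.symm ⟨c, hc⟩)
        simpa using this
      · simp
  obtain ⟨x₁⟩ := hk
  rcases finite_or_infinite C with hfin | hinf
  · have hrange : Finite (Set.range (χ x₁)) := Set.finite_range _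
    let S : Subalgebra F K :=
      { (χ x₁).range with
        algebraMap_mem' := fun c => ⟨⟨_, hCF c⟩, hχF c x₁⟩ }
    have hSfin : Finite S := hrange
    let L : IntermediateField F K := S.toIntermediateField' (Finite.isField_of_domain S)
    have hLfin : Finite L := hSfin
    let e : C ≃+* L := RingEquiv.ofBijective ((χ x₁).codRestrict L fun c => ⟨c, rfl⟩)
      ⟨fun c d h => hχinj x₁ (congrArg Subtype.val h), by
        rintro ⟨_, c, rfl⟩
        exact ⟨c, rfl⟩⟩
    have he : ∀ c, (e c : K) = χ x₁ c := fun c => rfl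
    refine ⟨L, Or.inl hLfin, e.symm, ?_⟩
    have hex : ∀ x, ∃ t : ℕ, ∀ l : L, χ x (e.symm l) = (l : K) ^ Fintype.card F ^ t := by
      intro x
      let ψ : L →ₐ[F] K :=
        { (χ x).comp e.symm.toRingHom with
          commutes' := fun c => by
            change χ x (e.symm (algebraMap F L c)) = _
            rw [← hχF c x]
            congr 1
            rw [RingEquiv.symm_apply_eq]
            apply Subtype.ext
            rw [he, hχF c x₁]
            rfl }
      obtain ⟨t, ht⟩ := (FiniteField.bijective_frobeniusAlgHom_pow F L).2 (ψ.restrictNormal L)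
      refine ⟨t, fun l => ?_⟩
      have h1 : ψ l = algebraMap L K (ψ.restrictNormal L l) :=
        (AlgHom.restrictNormal_commutes ψ L l).symm
      have h2 := congrArg (fun f : L →ₐ[F] L => f l) ht
      simp only [AlgHom.coe_pow, FiniteField.coe_frobeniusAlgHom, pow_iterate] at h2
      rw [← h2] at h1
      exact h1
    choose t ht using hex
    exact ⟨t, fun l x => ht x l⟩
  · obtain ⟨p, hpF⟩ := CharP.exists F
    have hp : Fact p.Prime := ⟨CharP.char_is_prime F p⟩
    have hpK : CharP K p := charP_of_injective_algebraMap (algebraMap F K).injective p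
    have : Nonempty (Fin k) := ⟨x₁⟩
    obtain ⟨s, x₀, hs0, hs⟩ := exists_frobenius_parametrization χ hχinj fun y hy => by
      let T : (Fin k → K) →ₗ[K] Module.End K V :=
        ∑ x, (LinearMap.proj x : (Fin k → K) →ₗ[K] K).smulRight (π x)
      have hT : ∀ y, T y = ∑ x, y x • π x := fun y => by simp [T]
      have h1 : T y ∈ R := by
        refine hRc.preimage T y fun g hg hgR => ?_
        obtain ⟨f, hf⟩ := exists_mvPolynomial_of_mem_polyFun (Pi.basisFun K (Fin k)) hg
        rw [← hf]
        refine hy f fun c => ?_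
        refine (hf fun x => χ x c).trans (hgR _ ?_)
        change T _ ∈ R
        rw [hT, ← hC]
        exact hCR c.2
      have h2 : T y ∈ C := hCspan _ h1 (by
        rw [hT]
        exact Submodule.sum_mem _ fun x _ => Submodule.smul_mem _ _ (hπC x))
      exact ⟨⟨T y, h2⟩, hcoef _ _ (hT y)⟩
    let e₀ : C ≃+* K := RingEquiv.ofBijective (χ x₀) ⟨hχinj x₀, fun z => by
      obtain ⟨c, hc⟩ := hs z
      exact ⟨c, by rw [hc, hs0, pow_zero, pow_one]⟩⟩
    have he₀ : ∀ z x, χ x (e₀.symm z) = z ^ p ^ s x := by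
      intro z x
      obtain ⟨c, hc⟩ := hs z
      have h1 : e₀.symm z = c := by
        rw [RingEquiv.symm_apply_eq]
        change z = χ x₀ c
        rw [hc, hs0, pow_zero, pow_one]
      rw [h1, hc]
    have hex : ∀ x, ∃ t, p ^ s x = Fintype.card F ^ t := by
      intro x
      refine exists_pow_eq_card_pow fun c => (algebraMap F K).injective ?_
      rw [map_pow, ← he₀, ← hχF c x]
      congr 1
      rw [RingEquiv.symm_apply_eq, hχF c x]
      exact (hχF c x₀).symm
    choose t ht using hex
    refine ⟨⊤, Or.inr rfl, IntermediateField.topEquiv.toRingEquiv.trans e₀.symm, t, fun l x => ?_⟩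
    rw [← ht, ← he₀]
    rfl

end Torus

/-! ### Averaging over finite subfields -/

section FiniteSubfield

variable {F K : Type*} [Field F] [Fintype F] [Field K] [Algebra F K]

theorem frobenius_pow_eq_iff (E : Type*) [Field E] [Finite E] [Algebra F E] (i j : ℕ) :
    (∀ z : E, z ^ Fintype.card F ^ i = z ^ Fintype.card F ^ j) ↔
      i ≡ j [MOD Module.finrank F E] := by
  rw [← FiniteField.orderOf_frobeniusAlgEquivOfAlgebraic, ← pow_eq_pow_iff_modEq]
  have key : ∀ (i : ℕ) (z : E), (FiniteField.frobeniusAlgEquivOfAlgebraic F E ^ i) z =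
      z ^ Fintype.card F ^ i := by
    intro i z
    rw [AlgEquiv.coe_pow, FiniteField.coe_frobeniusAlgEquivOfAlgebraic_iterate]
  constructor
  · intro h
    exact AlgEquiv.ext fun z => by rw [key, key, h]
  · intro h z
    rw [← key, ← key, h]

/-- The orthogonality relation for the multiplicative characters `z ↦ z ^ q ^ i` of a finite
extension of a field of order `q`. -/
theorem sum_units_pow_mul_inv_pow (E : IntermediateField F K) [Finite E] [Fintype Eˣ] (i j : ℕ) :
    ∑ z : Eˣ, ((z : E) : K) ^ Fintype.card F ^ i * (((z⁻¹ : Eˣ) : E) : K) ^ Fintype.card F ^ j =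
      if i ≡ j [MOD Module.finrank F E] then -1 else 0 := by
  classical
  let f : Eˣ →* K :=
    { toFun := fun z => ((z : E) : K) ^ Fintype.card F ^ i *
        (((z⁻¹ : Eˣ) : E) : K) ^ Fintype.card F ^ j
      map_one' := by simp
      map_mul' := fun z w => by
        simp only [mul_inv, Units.val_mul, IntermediateField.coe_mul, mul_pow]
        ring }
  have hf : f = 1 ↔ i ≡ j [MOD Module.finrank F E] := by
    rw [← frobenius_pow_eq_iff E i j]
    have h1 : ∀ z : Eˣ, f z = 1 ↔ (z : E) ^ Fintype.card F ^ i = (z : E) ^ Fintype.card F ^ j := by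
      intro z
      have hz : ((z : E) : K) ≠ 0 := fun h => z.ne_zero (Subtype.ext h)
      change ((z : E) : K) ^ Fintype.card F ^ i *
        (((z⁻¹ : Eˣ) : E) : K) ^ Fintype.card F ^ j = 1 ↔ _
      rw [Units.val_inv_eq_inv_val, IntermediateField.coe_inv, inv_pow,
        mul_inv_eq_one₀ (pow_ne_zero _ hz)]
      exact ⟨fun h => Subtype.ext h, fun h => congrArg Subtype.val h⟩
    constructor
    · intro h z
      by_cases hz : z = 0
      · rw [hz, zero_pow (pow_pos Fintype.card_pos _).ne',
          zero_pow (pow_pos Fintype.card_pos _).ne']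
      · exact (h1 (Units.mk0 z hz)).1 (by rw [h]; rfl)
    · intro h
      exact MonoidHom.ext fun z => (h1 z).2 (h z)
  have h2 := sum_hom_units f
  have hcard : ((Fintype.card Eˣ : ℕ) : K) = -1 := by
    have := Fintype.ofFinite E
    rw [← Nat.card_eq_fintype_card, Nat.card_units, Nat.card_eq_fintype_card,
      Nat.cast_sub Fintype.card_pos, Module.card_eq_pow_finrank (K := F), Nat.cast_pow]
    have h3 : ((Fintype.card F : ℕ) : K) = 0 := by
      rw [← map_natCast (algebraMap F K), FiniteField.cast_card_eq_zero, map_zero]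
    rw [h3, zero_pow Module.finrank_pos.ne', Nat.cast_one, zero_sub]
  refine h2.trans ?_
  by_cases h : f = 1
  · rw [if_pos h, if_pos (hf.1 h), hcard]
  · rw [if_neg h, if_neg (fun h' => h (hf.2 h')), Nat.cast_zero]

theorem exists_finite_subfield [IsAlgClosed K] (m : ℕ) :
    ∃ E : IntermediateField F K, Finite E ∧ m ≤ Module.finrank F E := by
  classical
  by_cases hm : m = 0
  · refine ⟨⊥, ?_, by omega⟩
    exact Finite.of_surjective _ (IntermediateField.botEquiv F K).symm.surjective
  obtain ⟨p, hp⟩ := CharP.exists F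
  obtain ⟨n, hprime, hn⟩ := FiniteField.card F p
  set P : Polynomial F := Polynomial.X ^ (Fintype.card F ^ m) - Polynomial.X with hP
  have hsep : P.Separable := by
    refine galois_poly_separable p _ ?_
    rw [hn, ← pow_mul]
    exact dvd_pow_self p (mul_ne_zero n.ne_zero hm)
  have h1 := Polynomial.card_rootSet_eq_natDegree (K := K) hsep (IsAlgClosed.splits _)
  have hdeg : P.natDegree = Fintype.card F ^ m := by
    rw [hP]
    exact FiniteField.X_pow_card_sub_X_natDegree_eq F
      (Nat.one_lt_pow hm Fintype.one_lt_card)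
  have hfd : FiniteDimensional F (IntermediateField.adjoin F (P.rootSet K)) := by
    refine IntermediateField.finiteDimensional_adjoin fun x hx => ?_
    exact IsAlgebraic.isIntegral
      ⟨P, (Polynomial.mem_rootSet.1 hx).1, (Polynomial.mem_rootSet.1 hx).2⟩
  have hfin : Finite (IntermediateField.adjoin F (P.rootSet K)) := Module.finite_of_finite F
  refine ⟨_, hfin, ?_⟩
  have := Fintype.ofFinite (IntermediateField.adjoin F (P.rootSet K))
  have h2 : Fintype.card (P.rootSet K) ≤ Fintype.card (IntermediateField.adjoin F (P.rootSet K)) :=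
    Fintype.card_le_of_injective (fun x => ⟨x, IntermediateField.subset_adjoin F _ x.2⟩)
      fun x y h => Subtype.ext
      (congrArg (Subtype.val : IntermediateField.adjoin F (P.rootSet K) → K) h)
  rw [h1, hdeg, Module.card_eq_pow_finrank (K := F)
    (V := IntermediateField.adjoin F (P.rootSet K))] at h2
  exact (Nat.pow_le_pow_iff_right Fintype.one_lt_card).1 h2

end FiniteSubfield

section GradedPart

variable {M : Type*} [Ring M] {k : ℕ} {π : Fin k → M} {t : Fin k → ℕ}

open scoped Classical in
/-- The part of degree `d` of `a` for the `ℤ / r`-grading given by degrees `t x` of the orthogonal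
idempotents `π x`. -/
noncomputable def gradedPart (π : Fin k → M) (t : Fin k → ℕ) (r d : ℕ) (a : M) : M :=
  ∑ x, ∑ y, if t x ≡ d + t y [MOD r] then π x * a * π y else 0

theorem sum_gradedPart (hπ : ∑ x, π x = 1) {r : ℕ} (hr : 0 < r) (a : M) :
    ∑ d ∈ Finset.range r, gradedPart π t r d a = a := by
  classical
  have h1 : a = ∑ x, ∑ y, π x * a * π y := by
    simp_rw [← Finset.mul_sum, hπ, mul_one, ← Finset.sum_mul, hπ, one_mul]
  conv_rhs => rw [h1]
  unfold gradedPart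
  rw [Finset.sum_comm]
  refine Finset.sum_congr rfl fun x _ => ?_
  rw [Finset.sum_comm]
  refine Finset.sum_congr rfl fun y _ => ?_
  -- the degree of `π x * a * π y` is `t x - t y` modulo `r`
  set d₀ := (t x + (r - t y % r)) % r with hd₀
  have hlt : t y % r < r := Nat.mod_lt _ hr
  have hd : ∀ d < r, (t x ≡ d + t y [MOD r] ↔ d = d₀) := by
    intro d hd
    have e1 : (t x + (r - t y % r)) + t y ≡ t x [MOD r] := by
      have h2 : t x + (r - t y % r) + t y = t x + r * (1 + t y / r) := by
        have := Nat.div_add_mod (t y) r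
        rw [mul_add, mul_one]
        omega
      rw [h2]
      unfold Nat.ModEq
      rw [Nat.add_mul_mod_self_left]
    have e2 : d₀ ≡ t x + (r - t y % r) [MOD r] := Nat.mod_modEq _ _
    constructor
    · intro h
      have h3 : d ≡ d₀ [MOD r] :=
        Nat.ModEq.add_right_cancel' (t y) ((h.symm.trans e1.symm).trans (e2.symm.add_right _))
      exact Nat.ModEq.eq_of_lt_of_lt h3 hd (Nat.mod_lt _ hr)
    · rintro rfl
      exact (e1.symm.trans (e2.symm.add_right _))
  rw [Finset.sum_eq_single d₀]
  · rw [if_pos ((hd d₀ (Nat.mod_lt _ hr)).2 rfl)]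
  · intro d hdr hne
    rw [if_neg fun h => hne ((hd d (Finset.mem_range.1 hdr)).1 h)]
  · intro h
    exact absurd (Finset.mem_range.2 (Nat.mod_lt _ hr)) h

theorem proj_mul_gradedPart_eq_zero (hππ : ∀ x y, π x * π y = if x = y then π x else 0)
    {r d : ℕ} {a : M} {x : Fin k} (h : ∀ y, ¬ t x ≡ d + t y [MOD r]) :
    π x * gradedPart π t r d a = 0 := by
  classical
  unfold gradedPart
  rw [Finset.mul_sum]
  refine Finset.sum_eq_zero fun z _ => ?_
  rw [Finset.mul_sum]
  refine Finset.sum_eq_zero fun y _ => ?_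
  by_cases hz : x = z
  · subst hz
    rw [if_neg (h y), mul_zero]
  · rw [mul_ite, mul_zero, ← mul_assoc, ← mul_assoc, hππ, if_neg hz, zero_mul, zero_mul, ite_self]

variable {F K : Type*} [Field F] [Fintype F] [Field K] [Algebra F K] [Algebra K M]
  {L : IntermediateField F K} {φ : L →+* M}

theorem smul_mul_gradedPart (hππ : ∀ x y, π x * π y = if x = y then π x else 0) (r d : ℕ) (a : M)
    {c c' : Fin k → K} (h : ∀ x y, t x ≡ d + t y [MOD r] → c x = c' y) :
    (∑ x, c x • π x) * gradedPart π t r d a = gradedPart π t r d a * ∑ y, c' y • π y := by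
  classical
  unfold gradedPart
  have h1 : ∀ z b, (∑ x, c x • π x) * (π z * b) = c z • (π z * b) := by
    intro z b
    rw [← mul_assoc, Finset.sum_mul, Finset.sum_eq_single z]
    · rw [smul_mul_assoc, hππ, if_pos rfl, smul_mul_assoc]
    · intro x _ hx
      rw [smul_mul_assoc, hππ, if_neg hx, smul_zero]
    · simp
  have h2 : ∀ z b, (b * π z) * (∑ x, c' x • π x) = c' z • (b * π z) := by
    intro z b
    rw [mul_assoc, Finset.mul_sum, Finset.sum_eq_single z]
    · rw [mul_smul_comm, hππ, if_pos rfl, mul_smul_comm]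
    · intro x _ hx
      rw [mul_smul_comm, hππ, if_neg (Ne.symm hx), smul_zero]
    · simp
  rw [Finset.mul_sum, Finset.sum_mul]
  refine Finset.sum_congr rfl fun x _ => ?_
  rw [Finset.mul_sum, Finset.sum_mul]
  refine Finset.sum_congr rfl fun y _ => ?_
  by_cases hxy : t x ≡ d + t y [MOD r]
  · rw [if_pos hxy, h2, mul_assoc, h1, h x y hxy]
  · rw [if_neg hxy, mul_zero, zero_mul]

/-- The graded parts of `a` are obtained from `a` by averaging over the unit group of a finite
subfield `E`. -/
theorem gradedPart_eq_neg_sum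
    (hφ : ∀ l : L, φ l = ∑ x, (l : K) ^ Fintype.card F ^ t x • π x)
    {E : IntermediateField F K} [Finite E] [Fintype Eˣ] (hEL : E ≤ L) (d : ℕ) (a : M) :
    gradedPart π t (Module.finrank F E) d a =
      -∑ z : Eˣ, φ (IntermediateField.inclusion hEL z) * a *
        φ (IntermediateField.inclusion hEL ((z⁻¹ : Eˣ) : E)) ^ Fintype.card F ^ d := by
  classical
  have h1 : ∀ z : Eˣ, φ (IntermediateField.inclusion hEL z) * a *
      φ (IntermediateField.inclusion hEL ((z⁻¹ : Eˣ) : E)) ^ Fintype.card F ^ d =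
      ∑ x, ∑ y, (((z : E) : K) ^ Fintype.card F ^ t x *
        (((z⁻¹ : Eˣ) : E) : K) ^ Fintype.card F ^ (d + t y)) • (π x * a * π y) := by
    intro z
    rw [← map_pow, hφ, hφ, Finset.sum_mul, Finset.sum_mul]
    refine Finset.sum_congr rfl fun x _ => ?_
    rw [Finset.mul_sum]
    refine Finset.sum_congr rfl fun y _ => ?_
    rw [smul_mul_assoc, smul_mul_assoc, mul_smul_comm, smul_smul, pow_add, pow_mul]
    rfl
  simp_rw [h1]
  rw [Finset.sum_comm, ← Finset.sum_neg_distrib]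
  unfold gradedPart
  refine Finset.sum_congr rfl fun x _ => ?_
  rw [Finset.sum_comm, ← Finset.sum_neg_distrib]
  refine Finset.sum_congr rfl fun y _ => ?_
  rw [← Finset.sum_smul, sum_units_pow_mul_inv_pow]
  split_ifs <;> simp

theorem gradedPart_mem {R : Subring M}
    (hφ : ∀ l : L, φ l = ∑ x, (l : K) ^ Fintype.card F ^ t x • π x) (hφR : ∀ l, φ l ∈ R)
    {E : IntermediateField F K} [Finite E] (hEL : E ≤ L) (d : ℕ) {a : M} (ha : a ∈ R) :
    gradedPart π t (Module.finrank F E) d a ∈ R := by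
  have := Fintype.ofFinite Eˣ
  rw [gradedPart_eq_neg_sum hφ hEL]
  exact R.neg_mem (R.sum_mem fun z _ =>
    R.mul_mem (R.mul_mem (hφR _) ha) (R.pow_mem (hφR _) _))

end GradedPart

/-! ### Closed rings with only trivial idempotents -/

section Local

theorem exists_pow_isSemisimple {K V : Type*} [Field K] [PerfectField K] [AddCommGroup V]
    [Module K V] [FiniteDimensional K V] (p : ℕ) [Fact p.Prime] [CharP K p]
    (a : Module.End K V) : ∃ N : ℕ, (a ^ p ^ N).IsSemisimple := by
  rcases subsingleton_or_nontrivial V with hV | hV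
  · refine ⟨0, ?_⟩
    rw [Subsingleton.elim (a ^ p ^ 0) 0]
    exact Module.End.isSemisimple_zero
  have : CharP (Module.End K V) p :=
    charP_of_injective_algebraMap (algebraMap K (Module.End K V)).injective p
  have : ExpChar (Module.End K V) p := ExpChar.prime Fact.out
  obtain ⟨n, hn, s, hs, ⟨m, hm⟩, hss, h⟩ := a.exists_isNilpotent_isSemisimple
  have hcomm : Commute n s := Algebra.commute_of_mem_adjoin_singleton_of_commute hs <|
    (Algebra.commute_of_mem_adjoin_self hn).symm
  obtain ⟨N, hN⟩ := pow_unbounded_of_one_lt m (Fact.out : p.Prime).one_lt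
  refine ⟨N, ?_⟩
  rw [h, add_pow_expChar_pow_of_commute p N hcomm, pow_eq_zero_of_le hN.le hm, zero_add]
  exact hss.pow _

end Local

section Local

theorem polyFun_self {K : Type*} [Field K] {g : K → K} (hg : g ∈ polyFun K K) :
    ∃ f : Polynomial K, ∀ x, f.eval x = g x := by
  induction hg using Algebra.adjoin_induction with
  | mem x hx =>
    obtain ⟨l, rfl⟩ := hx
    refine ⟨Polynomial.C (l 1) * Polynomial.X, fun x => ?_⟩
    change _ = l x
    have : l x = x * l 1 := by
      rw [← smul_eq_mul, ← map_smul, smul_eq_mul, mul_one]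
    rw [Polynomial.eval_mul, Polynomial.eval_C, Polynomial.eval_X, this, mul_comm]
  | algebraMap r => exact ⟨Polynomial.C r, fun A => by simp⟩
  | add x y _ _ hx hy =>
    obtain ⟨p, hp⟩ := hx
    obtain ⟨q, hq⟩ := hy
    exact ⟨p + q, fun A => by simp [hp, hq]⟩
  | mul x y _ _ hx hy =>
    obtain ⟨p, hp⟩ := hx
    obtain ⟨q, hq⟩ := hy
    exact ⟨p * q, fun A => by simp [hp, hq]⟩

/-- If the torus is a copy of `K`, then the graded parts of nonzero degree modulo a large number are
nilpotent, since they annihilate the eigenspace with the least or the one with the greatest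
exponent. -/
theorem isNilpotent_gradedPart_of_large {K V : Type*} [Field K] [AddCommGroup V] [Module K V]
    {R : Subring (Module.End K V)}
    (hR : ∀ a ∈ R, IsNilpotent a ∨ ∃ b ∈ R, a * b = 1 ∧ b * a = 1)
    {k : ℕ} {π : Fin k → Module.End K V} {t : Fin k → ℕ} (hk : Nonempty (Fin k))
    (hππ : ∀ x y, π x * π y = if x = y then π x else 0) (hπ0 : ∀ x, π x ≠ 0)
    {r : ℕ} (hr : ∀ x, 2 * t x < r) {a : Module.End K V} {d : ℕ}
    (ha : gradedPart π t r d a ∈ R) (hd : 0 < d) (hdr : d < r) :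
    IsNilpotent (gradedPart π t r d a) := by
  refine (hR _ ha).resolve_right ?_
  rintro ⟨w, -, hw, -⟩
  have hne : ∀ x, ∃ y, t x ≡ d + t y [MOD r] := by
    intro x
    by_contra! h
    apply hπ0 x
    rw [← mul_one (π x), ← hw, ← mul_assoc, proj_mul_gradedPart_eq_zero hππ h, zero_mul]
  have heq : ∀ x y, t x ≡ d + t y [MOD r] → t x = d + t y ∨ t x + r = d + t y := by
    intro x y h
    have h1 := hr x
    have h2 := hr y
    unfold Nat.ModEq at h
    rw [Nat.mod_eq_of_lt (by omega)] at h
    by_cases h3 : d + t y < r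
    · rw [Nat.mod_eq_of_lt h3] at h
      exact Or.inl h
    · rw [Nat.mod_eq_sub_mod (by omega), Nat.mod_eq_of_lt (by omega)] at h
      right
      omega
  obtain ⟨x₀, hx₀⟩ := Finite.exists_min t
  obtain ⟨x₁, hx₁⟩ := Finite.exists_max t
  obtain ⟨y₀, hy₀⟩ := hne x₀
  obtain ⟨y₁, hy₁⟩ := hne x₁
  have e0 := heq _ _ hy₀
  have e1 := heq _ _ hy₁
  have a0 := hx₀ y₀
  have a1 := hx₁ y₁
  have a2 := hx₀ x₁
  have b0 := hr x₀
  have b1 := hr x₁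
  have b2 := hr y₀
  have b3 := hr y₁
  have a3 := hx₁ y₀
  omega

variable {F K V : Type*} [Field F] [Field K] [IsAlgClosed K] [Algebra F K] [AddCommGroup V]
  [Module K V] [FiniteDimensional K V] [Nontrivial V]

/-- In a ring whose elements are nilpotent or invertible, an element commuting with a maximal
torus `φ L` lies in `φ L` up to a nilpotent element: some `p ^ N`-th power of it is semisimple,
hence in `φ L`, and `L` is perfect. -/
theorem exists_isNilpotent_sub_of_commute {p : ℕ} [Fact p.Prime] [CharP K p]
    {R : Subring (Module.End K V)} {L : IntermediateField F K} {φ : L →+* Module.End K V}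
    (hL : Finite L ∨ L = ⊤)
    (hmax : ∀ a ∈ R, a.IsSemisimple → (∀ l, Commute a (φ l)) → ∃ l, a = φ l)
    {a : Module.End K V} (ha : a ∈ R) (hac : ∀ l, Commute a (φ l)) :
    ∃ l, IsNilpotent (a - φ l) := by
  have : CharP (Module.End K V) p :=
    charP_of_injective_algebraMap (algebraMap K (Module.End K V)).injective p
  have : ExpChar (Module.End K V) p := ExpChar.prime Fact.out
  have : ExpChar K p := ExpChar.prime Fact.out
  obtain ⟨N, hN⟩ := exists_pow_isSemisimple p a
  obtain ⟨l', hl'⟩ := hmax _ (R.pow_mem ha _) hN fun l => (hac l).pow_left _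
  have hperf : ∃ l : L, l ^ p ^ N = l' := by
    have hpos : 0 < p ^ N := pow_pos (Fact.out : p.Prime).pos N
    rcases hL with hfin | rfl
    · have hinj : Function.Injective fun l : L => l ^ p ^ N := by
        intro x y hxy
        apply Subtype.ext
        refine iterateFrobenius_inj K p N ?_
        rw [iterateFrobenius_def, iterateFrobenius_def]
        exact congrArg Subtype.val hxy
      exact Finite.injective_iff_surjective.1 hinj l'
    · obtain ⟨z, hz⟩ := IsAlgClosed.exists_pow_nat_eq (l' : K) hpos
      exact ⟨⟨z, IntermediateField.mem_top⟩, Subtype.ext hz⟩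
  obtain ⟨l, rfl⟩ := hperf
  refine ⟨l, p ^ N, ?_⟩
  rw [sub_pow_expChar_pow_of_commute p N (hac l), hl', map_pow, sub_self]

theorem isNilpotent_sub_trans {M : Type*} [Ring M] [Nontrivial M] {R : Subring M}
    (hR : ∀ a ∈ R, IsNilpotent a ∨ ∃ b ∈ R, a * b = 1 ∧ b * a = 1) {a b c : M} (ha : a ∈ R)
    (hb : b ∈ R) (hc : c ∈ R) (h : IsNilpotent (a - b)) (h' : IsNilpotent (b - c)) :
    IsNilpotent (a - c) := by
  have := isNilpotent_add_of_isNilpotent hR (R.sub_mem ha hb) (R.sub_mem hb hc) h h'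
  rwa [sub_add_sub_cancel] at this

/-- If the torus is a finite field, then the graded parts of nonzero degree are nilpotent: the
residue division ring is finite, hence commutative, but an invertible element of degree `d` would
induce the nontrivial automorphism `l ↦ l ^ q ^ d` of the torus. -/
theorem isNilpotent_gradedPart_of_finite [Fintype F] {p : ℕ} [Fact p.Prime] [CharP K p]
    {R : Subring (Module.End K V)}
    (hR : ∀ a ∈ R, IsNilpotent a ∨ ∃ b ∈ R, a * b = 1 ∧ b * a = 1)
    {L : IntermediateField F K} [Finite L] {φ : L →+* Module.End K V} {k : ℕ}
    {π : Fin k → Module.End K V} {t : Fin k → ℕ} (hφR : ∀ l, φ l ∈ R)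
    (hπ : ∑ x, π x = 1) (hππ : ∀ x y, π x * π y = if x = y then π x else 0)
    (hφ : ∀ l : L, φ l = ∑ x, (l : K) ^ Fintype.card F ^ t x • π x)
    (hmax : ∀ a ∈ R, a.IsSemisimple → (∀ l, Commute a (φ l)) → ∃ l, a = φ l)
    {a : Module.End K V} (ha : a ∈ R) {d : ℕ} (hd : 0 < d) (hdr : d < Module.finrank F L) :
    IsNilpotent (gradedPart π t (Module.finrank F L) d a) := by
  classical
  set r := Module.finrank F L with hr
  have hmem : ∀ d, ∀ a ∈ R, gradedPart π t r d a ∈ R := fun d a ha =>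
    gradedPart_mem hφ hφR le_rfl d ha
  have hcomm : ∀ d a l, φ l * gradedPart π t r d a =
      gradedPart π t r d a * φ l ^ Fintype.card F ^ d := by
    intro d a l
    rw [← map_pow, hφ, hφ]
    refine smul_mul_gradedPart hππ r d a fun x y hxy => ?_
    rw [IntermediateField.coe_pow, ← pow_mul, ← pow_add]
    exact congrArg Subtype.val ((frobenius_pow_eq_iff L _ _).2 hxy l)
  have hinv : ∀ d (u w : Module.End K V), (∀ l, φ l * u = u * φ l ^ Fintype.card F ^ d) →
      u * w = 1 → w * u = 1 → ∀ l, w * φ l = φ l ^ Fintype.card F ^ d * w := by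
    intro d u w hu huw hwu l
    calc w * φ l = w * (φ l * u) * w := by rw [mul_assoc, mul_assoc, huw, mul_one]
      _ = φ l ^ Fintype.card F ^ d * w := by rw [hu, ← mul_assoc w, hwu, one_mul]
  -- In each degree, the residue classes form a vector space of dimension at most `1` over `L`.
  have hu : ∀ d : ℕ, ∃ u ∈ R, ∀ a ∈ R, ∃ l, IsNilpotent (gradedPart π t r d a - φ l * u) := by
    intro d
    by_cases h : ∀ a ∈ R, IsNilpotent (gradedPart π t r d a)
    · exact ⟨0, R.zero_mem, fun a ha => ⟨0, by simpa using h a ha⟩⟩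
    push Not at h
    obtain ⟨a₀, ha₀, hnil⟩ := h
    set u := gradedPart π t r d a₀ with hu
    obtain ⟨w, hw, huw, hwu⟩ := (hR _ (hmem d a₀ ha₀)).resolve_left hnil
    refine ⟨u, hmem d a₀ ha₀, fun a ha => ?_⟩
    have h1 : ∀ l, Commute (gradedPart π t r d a * w) (φ l) := by
      intro l
      change gradedPart π t r d a * w * φ l = φ l * (gradedPart π t r d a * w)
      rw [mul_assoc, hinv d u w (hcomm d a₀) huw hwu, ← mul_assoc, ← mul_assoc, hcomm]
    obtain ⟨l, hl⟩ := exists_isNilpotent_sub_of_commute (p := p) (Or.inl ‹_›) hmax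
      (R.mul_mem (hmem d a ha) hw) h1
    refine ⟨l, ?_⟩
    have h2 := isNilpotent_mul_comm (isNilpotent_mul_of_isNilpotent hR (hmem d a₀ ha₀)
      (R.sub_mem (R.mul_mem (hmem d a ha) hw) (hφR l)) hl)
    rwa [sub_mul, mul_assoc, hwu, mul_one] at h2
  choose u huR hu using hu
  -- So there are finitely many residue classes, and the residue division ring is commutative.
  have hcom := fun a b => isNilpotent_commutator hR
    (f := fun l : Fin r → L => ∑ d, φ (l d) * u d)
    (fun l => R.sum_mem fun d _ => R.mul_mem (hφR _) (huR _))
    (fun a ha => by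
      choose l hl using fun d : Fin r => hu d a ha
      refine ⟨l, ?_⟩
      have h1 : a = ∑ d : Fin r, gradedPart π t r d a := by
        rw [Fin.sum_univ_eq_sum_range (fun d => gradedPart π t r d a) r]
        exact (sum_gradedPart hπ Module.finrank_pos a).symm
      conv in (a - _) => rw [h1]
      rw [← Finset.sum_sub_distrib]
      exact isNilpotent_sum_of_isNilpotent hR _ (fun d _ => R.sub_mem (hmem d a ha)
        (R.mul_mem (hφR _) (huR _))) fun d _ => hl d)
    (a := a) (b := b)
  by_contra hnil
  obtain ⟨w, hw, huw, hwu⟩ := (hR _ (hmem d a ha)).resolve_left hnil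
  have hfix : ∀ l : L, l ^ Fintype.card F ^ d = l ^ Fintype.card F ^ 0 := by
    intro l
    by_contra hne
    have h1 := hcom (φ l) (gradedPart π t r d a) (hφR l) (hmem d a ha)
    rw [hcomm d a l, ← mul_sub] at h1
    have h2 := isNilpotent_mul_of_isNilpotent hR hw
      (R.mul_mem (hmem d a ha) (R.sub_mem (R.pow_mem (hφR l) _) (hφR l))) h1
    rw [← mul_assoc, hwu, one_mul, ← map_pow, ← map_sub] at h2
    have hne' : l ^ Fintype.card F ^ d - l ≠ 0 := by
      rw [pow_zero, pow_one] at hne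
      exact sub_ne_zero.2 hne
    refine mul_ne_one_of_isNilpotent h2 (c := φ (l ^ Fintype.card F ^ d - l)⁻¹) ?_
    rw [← map_mul, inv_mul_cancel₀ hne', map_one]
  have h3 := (frobenius_pow_eq_iff L d 0).1 hfix
  exact hd.ne' (Nat.ModEq.eq_of_lt_of_lt h3 hdr (hd.trans hdr))

/-- The structure of closed rings of matrices whose elements are nilpotent or invertible: modulo
nilpotent elements such a ring is a finite field or `K`, and this residue field lifts to a
subfield acting by powers of the Frobenius map on its simultaneous eigenspaces. -/
theorem exists_residue_field_lift {R : Subring (Module.End K V)}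
    (hRc : PolyClosed K (R : Set (Module.End K V)))
    (hRF : ∀ c : F, algebraMap F K c • (1 : Module.End K V) ∈ R)
    (hR : ∀ a ∈ R, IsNilpotent a ∨ ∃ b ∈ R, a * b = 1 ∧ b * a = 1) :
    ∃ L : IntermediateField F K, (Finite L ∨ L = ⊤) ∧ ∃ (φ : L →+* Module.End K V) (k : ℕ)
      (π : Fin k → Module.End K V) (t : Fin k → ℕ), (∀ l, φ l ∈ R) ∧
      (∀ x, π x ∈ Submodule.span K (R : Set (Module.End K V))) ∧ ∑ x, π x = 1 ∧
      (∀ x y, π x * π y = if x = y then π x else 0) ∧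
      (∀ l : L, φ l = ∑ x, (l : K) ^ frobeniusBase F ^ t x • π x) ∧
      ∀ a ∈ R, ∃ l, IsNilpotent (a - φ l) := by
  rcases finite_or_infinite F with hF | hF
  · have := Fintype.ofFinite F
    have hq : frobeniusBase F = Fintype.card F := by
      rw [frobeniusBase, if_pos hF, Nat.card_eq_fintype_card]
    obtain ⟨L, hL, φ, k, π, t, hφR, hπR, hπ1, hππ, hπ0, hφ, hmax⟩ :=
      exists_torus_parametrization hRc hRF hR
    refine ⟨L, hL, φ, k, π, t, hφR, hπR, hπ1, hππ, fun l => by rw [hq, hφ], fun a ha => ?_⟩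
    obtain ⟨p, hpF⟩ := CharP.exists F
    have hp : Fact p.Prime := ⟨CharP.char_is_prime F p⟩
    have hpK : CharP K p := charP_of_injective_algebraMap (algebraMap F K).injective p
    have hk : Nonempty (Fin k) := by
      by_contra h
      rw [not_nonempty_iff] at h
      rw [Finset.univ_eq_empty, Finset.sum_empty] at hπ1
      exact zero_ne_one hπ1
    -- A finite subfield by which `R` is graded: `L` itself, or a sufficiently large one if `L = ⊤`.
    obtain ⟨E, hE, hEL, hEt, hEnil⟩ : ∃ E : IntermediateField F K, Finite E ∧ E ≤ L ∧
        (∀ x y, t x ≡ 0 + t y [MOD Module.finrank F E] → ∀ l : L,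
          (l : K) ^ Fintype.card F ^ t x = (l : K) ^ Fintype.card F ^ t y) ∧
        ∀ d, 0 < d → d < Module.finrank F E →
          IsNilpotent (gradedPart π t (Module.finrank F E) d a) := by
      by_cases hfin : Finite L
      · refine ⟨L, hfin, le_rfl, fun x y hxy l => ?_, fun d hd hdr =>
          isNilpotent_gradedPart_of_finite (p := p) hR hφR hπ1 hππ hφ hmax ha hd hdr⟩
        rw [zero_add] at hxy
        exact congrArg Subtype.val ((frobenius_pow_eq_iff L _ _).2 hxy l)
      · obtain rfl := hL.resolve_left hfin
        obtain ⟨E, hE, hEr⟩ := exists_finite_subfield (F := F) (K := K)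
          (∑ x, 2 * t x + 1)
        have hr : ∀ x, 2 * t x < Module.finrank F E := fun x => by
          have : 2 * t x ≤ ∑ x, 2 * t x := Finset.single_le_sum (f := fun x => 2 * t x)
            (fun _ _ => Nat.zero_le _) (Finset.mem_univ x)
          omega
        refine ⟨E, hE, le_top, fun x y hxy l => ?_, fun d hd hdr =>
          isNilpotent_gradedPart_of_large hR hk hππ hπ0 hr
            (gradedPart_mem hφ hφR le_top d ha) hd hdr⟩
        rw [zero_add] at hxy
        have h1 := hr x
        have h2 := hr y
        rw [Nat.ModEq.eq_of_lt_of_lt hxy (by omega) (by omega)]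
    have hmem : ∀ d, gradedPart π t (Module.finrank F E) d a ∈ R := fun d =>
      gradedPart_mem hφ hφR hEL d ha
    have hcomm : ∀ l, Commute (gradedPart π t (Module.finrank F E) 0 a) (φ l) := by
      intro l
      rw [hφ]
      exact (smul_mul_gradedPart hππ _ 0 a fun x y hxy => hEt x y hxy l).symm
    obtain ⟨l, hl⟩ := exists_isNilpotent_sub_of_commute (p := p) hL hmax (hmem 0) hcomm
    refine ⟨l, isNilpotent_sub_trans hR ha (hmem 0) (hφR l) ?_ hl⟩
    have hpos : 0 < Module.finrank F E := Module.finrank_pos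
    have h1 := sum_gradedPart (t := t) hπ1 hpos a
    obtain ⟨r, hr⟩ := Nat.exists_eq_succ_of_ne_zero hpos.ne'
    have h2 : a - gradedPart π t (Module.finrank F E) 0 a =
        ∑ d ∈ Finset.range r, gradedPart π t (Module.finrank F E) (d + 1) a := by
      rw [sub_eq_iff_eq_add, ← Finset.sum_range_succ' fun d =>
        gradedPart π t (Module.finrank F E) d a, ← Nat.succ_eq_add_one, ← hr, h1]
    rw [h2]
    refine isNilpotent_sum_of_isNilpotent hR _ (fun d _ => hmem _) fun d hd =>
      hEnil _ (Nat.succ_pos d) ?_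
    have := Finset.mem_range.1 hd
    omega
  · -- `R` is closed and contains the infinitely many scalars from `F`, hence all scalars.
    have hsc : ∀ c : K, c • (1 : Module.End K V) ∈ R := by
      intro c
      let T : K →ₗ[K] Module.End K V := LinearMap.toSpanSingleton K _ 1
      refine hRc.preimage T c fun g hg hgR => ?_
      obtain ⟨f, hf⟩ := polyFun_self hg
      have hf0 : f = 0 := by
        refine Polynomial.eq_zero_of_infinite_isRoot f ?_
        refine (Set.infinite_range_of_injective (algebraMap F K).injective).mono ?_
        rintro _ ⟨b, rfl⟩
        exact (hf _).trans (hgR _ (hRF b))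
      rw [← hf, hf0, Polynomial.eval_zero]
    refine ⟨⊤, Or.inr rfl, (algebraMap K (Module.End K V)).comp
      (algebraMap (⊤ : IntermediateField F K) K), 1, fun _ => 1, fun _ => 0, fun l => ?_,
      fun x => ?_, by simp, fun x y => by simp [Subsingleton.elim x y], fun l => ?_, fun a ha => ?_⟩
    · rw [RingHom.comp_apply, Algebra.algebraMap_eq_smul_one]
      exact hsc _
    · exact Submodule.subset_span R.one_mem
    · rw [RingHom.comp_apply, Algebra.algebraMap_eq_smul_one]
      simp only [pow_zero, pow_one, Finset.sum_const, Finset.card_univ, Fintype.card_fin, one_smul]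
      rfl
    · obtain ⟨c, hc⟩ := Module.End.exists_eigenvalue a
      refine ⟨⟨c, IntermediateField.mem_top⟩, ?_⟩
      change IsNilpotent (a - algebraMap K (Module.End K V) c)
      refine (hR _ (R.sub_mem ha ?_)).resolve_right ?_
      · rw [Algebra.algebraMap_eq_smul_one]
        exact hsc c
      · rintro ⟨b, -, -, hb⟩
        obtain ⟨v, hv⟩ := hc.exists_hasEigenvector
        apply hv.2
        have h1 : (a - algebraMap K (Module.End K V) c) v = 0 := by
          rw [LinearMap.sub_apply, hv.apply_eq_smul, Module.algebraMap_end_apply, sub_self]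
        have h2 := congrArg (fun f : Module.End K V => f v) hb
        simp only [Module.End.mul_apply, h1, map_zero, Module.End.one_apply] at h2
        exact h2.symm

end Local

/-! ### Primitive idempotents -/

/-- A primitive idempotent of an algebra without unit: a nonzero idempotent `e` such that `0` and
`e` are the only idempotents of the corner `e A e`. -/
structure IsPrimitiveIdempotent {F M : Type*} [Field F] [Ring M] [Algebra F M]
    (A : NonUnitalSubalgebra F M) (e : M) : Prop where
  mem : e ∈ A
  idem : e * e = e
  ne_zero : e ≠ 0
  eq_zero_or_eq : ∀ f ∈ A, f * f = f → e * f = f → f * e = f → f = 0 ∨ f = e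

theorem algebraMap_pow_frobeniusBase {F K : Type*} [Field F] [Field K] [Algebra F K] (c : F)
    (t : ℕ) : algebraMap F K c ^ frobeniusBase F ^ t = algebraMap F K c := by
  rw [← map_pow]
  congr 1
  rcases finite_or_infinite F with hF | hF
  · have := Fintype.ofFinite F
    rw [frobeniusBase, if_pos hF, Nat.card_eq_fintype_card, FiniteField.pow_card_pow]
  · rw [frobeniusBase, if_neg (not_finite_iff_infinite.2 hF), one_pow, pow_one]

section Corner

variable {F K M : Type*} [Field F] [Field K] [Ring M] [Algebra F M] [Algebra K M]
  [FiniteDimensional K M] {A : NonUnitalSubalgebra F M} {e : M}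

/-- The corner of a primitive idempotent in a closed algebra is a local ring. -/
theorem IsPrimitiveIdempotent.isNilpotent_or_exists_inverse (he : IsPrimitiveIdempotent A e)
    (hA : PolyClosed K (A : Set M)) {z : M} (hz : z ∈ A) (hez : e * z = z) (hze : z * e = z) :
    IsNilpotent z ∨ ∃ c ∈ A, e * c = c ∧ c * e = c ∧ z * c = e ∧ c * z = e := by
  refine (ZariskiClosedAlgebra.isNilpotent_or_exists_inverse (A := A.toNonUnitalSubring) hA
    hz).imp_right ?_
  rintro ⟨b, hb, h1, h2, h3⟩
  replace hb : b ∈ A := hb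
  have hid : z * b * (z * b) = z * b := by rw [mul_assoc, ← mul_assoc b, h2]
  have hzb : z * b = e := (he.eq_zero_or_eq _ (A.mul_mem hz hb) hid (by rw [← mul_assoc, hez])
    (by rw [h1, mul_assoc, hze])).resolve_left h3
  refine ⟨b, hb, ?_, ?_, hzb, h1 ▸ hzb⟩
  · rw [← hzb, h1, h2]
  · rw [← hzb, ← mul_assoc, h2]

/-- The nilpotent elements of the corner of a primitive idempotent belong to the radical. -/
theorem IsPrimitiveIdempotent.mem_radical (he : IsPrimitiveIdempotent A e)
    (hA : PolyClosed K (A : Set M)) {z : M} (hz : z ∈ A) (hez : e * z = z) (hze : z * e = z)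
    (hnil : IsNilpotent z) : z ∈ radical A := by
  refine (mem_radical_iff hA).2 ⟨hz, fun y hy => ?_⟩
  have h1 : z * y = z * (e * y) := by rw [← mul_assoc, hze]
  rw [h1]
  apply isNilpotent_mul_comm
  refine (he.isNilpotent_or_exists_inverse hA (A.mul_mem (A.mul_mem he.mem hy) hz)
    (by rw [← mul_assoc, ← mul_assoc, he.idem]) (by rw [mul_assoc, hze])).resolve_right ?_
  rintro ⟨c, -, -, -, -, hc⟩
  obtain ⟨k, hk⟩ := hnil
  have key : ∀ k, z ^ (k + 1) = 0 → z = 0 := by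
    intro k
    induction k with
    | zero => simp
    | succ k ih =>
      intro h
      apply ih
      have h2 : z ^ (k + 1) = e * z ^ (k + 1) := by rw [pow_succ', ← mul_assoc, hez]
      rw [h2, ← hc, mul_assoc, mul_assoc, ← pow_succ', h, mul_zero, mul_zero]
  have h0 : z = 0 := key k (by rw [pow_succ, hk, zero_mul])
  rw [h0, mul_zero, mul_zero] at hc
  exact he.ne_zero hc.symm

end Corner

section Residue

/-- An idempotent matrix splits, so that its corner is the endomorphism algebra of its range. -/
theorem exists_corner_equiv.{u, v} {K : Type u} {n : Type v} [Field K] [Fintype n] [DecidableEq n]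
    {e : Matrix n n K} (he : e * e = e) :
    ∃ (W : Type (max u v)) (_ : AddCommGroup W) (_ : Module K W) (_ : FiniteDimensional K W)
      (β : Module.End K W →ₗ[K] Matrix n n K),
      β 1 = e ∧ (∀ S T, β (S * T) = β S * β T) ∧ Function.Injective β ∧
      ∀ a, e * a = a → a * e = a → ∃ T, β T = a := by
  let Φ : Matrix n n K ≃ₐ[K] Module.End K (n → K) := Matrix.toLinAlgEquiv'
  let W : Submodule K (n → K) := LinearMap.range (Φ e)
  let Q : W →ₗ[K] (n → K) := W.subtype
  let P : (n → K) →ₗ[K] W := (Φ e).rangeRestrict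
  have hΦe : Φ e ∘ₗ Φ e = Φ e := by
    rw [← Module.End.mul_eq_comp, ← map_mul, he]
  have hPQ : P ∘ₗ Q = LinearMap.id := by
    ext1 ⟨w, hw⟩
    obtain ⟨v, rfl⟩ := hw
    apply Subtype.ext
    exact LinearMap.congr_fun hΦe v
  let β : Module.End K W →ₗ[K] Matrix n n K :=
    Φ.symm.toLinearMap ∘ₗ
      { toFun := fun T => Q ∘ₗ T ∘ₗ P
        map_add' := fun S T => by rw [LinearMap.add_comp, LinearMap.comp_add]
        map_smul' := fun c T => by rw [LinearMap.smul_comp, LinearMap.comp_smul]; rfl }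
  have hβ : ∀ T, Φ (β T) = Q ∘ₗ T ∘ₗ P := fun T => Φ.apply_symm_apply _
  refine ⟨W, inferInstance, inferInstance, inferInstance, β, Φ.injective (by rw [hβ]; rfl),
    fun S T => ?_, fun S T h => ?_, fun a hea hae => ?_⟩
  · apply Φ.injective
    rw [map_mul Φ, hβ, hβ, hβ, Module.End.mul_eq_comp, Module.End.mul_eq_comp]
    refine LinearMap.ext fun v => ?_
    have := LinearMap.congr_fun hPQ (T (P v))
    simp only [LinearMap.comp_apply, LinearMap.id_apply] at this ⊢
    rw [this]
  · have h1 : Q ∘ₗ S ∘ₗ P = Q ∘ₗ T ∘ₗ P := by rw [← hβ, ← hβ, h]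
    ext1 w
    have h2 := LinearMap.congr_fun h1 (Q w)
    have h3 : P (Q w) = w := LinearMap.congr_fun hPQ w
    simp only [LinearMap.comp_apply, h3] at h2
    exact Subtype.ext h2
  · refine ⟨P ∘ₗ Φ a ∘ₗ Q, Φ.injective ?_⟩
    have h1 : Q ∘ₗ (P ∘ₗ Φ a ∘ₗ Q) ∘ₗ P = Φ (e * a * e) := by
      rw [map_mul, map_mul]
      rfl
    rw [hβ, h1, hea, hae]

variable {F K n : Type*} [Field F] [Field K] [IsAlgClosed K] [Algebra F K] [Fintype n]
  [DecidableEq n]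

/-- The residue field of the corner `e A e` of a primitive idempotent is a finite field or `K`,
and it lifts to a subfield of `e A e` acting by powers of the Frobenius map. -/
theorem IsPrimitiveIdempotent.exists_residue_field_lift
    {A : NonUnitalSubalgebra F (Matrix n n K)} {e : Matrix n n K}
    (he : IsPrimitiveIdempotent A e) (hA : PolyClosed K (A : Set (Matrix n n K))) :
    ∃ L : IntermediateField F K, (Finite L ∨ L = ⊤) ∧ ∃ (φ : L →ₙₐ[F] Matrix n n K) (k : ℕ)
      (π : Fin k → Matrix n n K) (t : Fin k → ℕ), (∀ l, φ l ∈ A) ∧ φ 1 = e ∧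
      (∀ x, π x ∈ Submodule.span K (A : Set (Matrix n n K))) ∧ ∑ x, π x = e ∧
      (∀ x y, π x * π y = if x = y then π x else 0) ∧
      (∀ l : L, φ l = ∑ x, (l : K) ^ frobeniusBase F ^ t x • π x) ∧
      ∀ a ∈ A, e * a = a → a * e = a → ∃ l, IsNilpotent (a - φ l) := by
  obtain ⟨W, _, _, _, β, hβ1, hβmul, hβinj, hβsurj⟩ := exists_corner_equiv he.idem
  have hWnt : Nontrivial W := by
    by_contra h
    rw [not_nontrivial_iff_subsingleton] at h
    apply he.ne_zero
    rw [← hβ1, Subsingleton.elim (1 : Module.End K W) 0, map_zero]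
  have hβpow : ∀ T k, β (T ^ (k + 1)) = β T ^ (k + 1) := by
    intro T k
    induction k with
    | zero => simp
    | succ k ih => rw [pow_succ, hβmul, ih, ← pow_succ]
  have hβnil : ∀ T, IsNilpotent T → IsNilpotent (β T) := by
    rintro T ⟨k, hk⟩
    exact ⟨k + 1, by rw [← hβpow, pow_succ, hk, zero_mul, map_zero]⟩
  let R : Subring (Module.End K W) :=
    { carrier := {T | β T ∈ A}
      mul_mem' := fun {S T} hS hT => by
        change β (S * T) ∈ A
        rw [hβmul]
        exact A.mul_mem hS hT
      one_mem' := by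
        change β 1 ∈ A
        rw [hβ1]
        exact he.mem
      add_mem' := fun {S T} hS hT => by
        change β (S + T) ∈ A
        rw [map_add]
        exact A.add_mem hS hT
      zero_mem' := by
        change β 0 ∈ A
        rw [map_zero]
        exact A.zero_mem
      neg_mem' := fun {T} hT => by
        change β (-T) ∈ A
        rw [map_neg]
        exact neg_mem hT }
  have hmemR : ∀ T, T ∈ R ↔ β T ∈ A := fun T => Iff.rfl
  have heβ : ∀ T, e * β T = β T := fun T => by rw [← hβ1, ← hβmul, one_mul]
  have hβe : ∀ T, β T * e = β T := fun T => by rw [← hβ1, ← hβmul, mul_one]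
  have hRc : PolyClosed K (R : Set (Module.End K W)) := hA.preimage β
  have hRF : ∀ c : F, algebraMap F K c • (1 : Module.End K W) ∈ R := by
    intro c
    rw [hmemR, map_smul, hβ1, algebraMap_smul]
    exact SMulMemClass.smul_mem c he.mem
  have hR : ∀ a ∈ R, IsNilpotent a ∨ ∃ b ∈ R, a * b = 1 ∧ b * a = 1 := by
    intro a ha
    refine (ZariskiClosedAlgebra.isNilpotent_or_exists_inverse (A := R.toNonUnitalSubring) hRc
      ha).imp_right ?_
    rintro ⟨b, hb, h1, h2, h3⟩
    replace hb : b ∈ R := hb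
    have hid : a * b * (a * b) = a * b := by rw [mul_assoc, ← mul_assoc b, h2]
    have hab : a * b = 1 := by
      apply hβinj
      rw [hβ1]
      refine (he.eq_zero_or_eq _ ((hmemR _).1 (R.mul_mem ha hb)) (by rw [← hβmul, hid]) (heβ _)
        (hβe _)).resolve_left fun h => h3 (hβinj (by rw [h, map_zero]))
    exact ⟨b, hb, hab, h1 ▸ hab⟩
  obtain ⟨L, hL, φ, k, π, t, hφR, hπR, hπ1, hππ, hφ, hres⟩ :=
    ZariskiClosedAlgebra.exists_residue_field_lift hRc hRF hR
  have hφ' : ∀ l : L, β (φ l) = ∑ x, (l : K) ^ frobeniusBase F ^ t x • β (π x) := by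
    intro l
    rw [hφ, map_sum]
    exact Finset.sum_congr rfl fun x _ => map_smul _ _ _
  let ψ : L →ₙₐ[F] Matrix n n K :=
    { toFun := fun l => β (φ l)
      map_smul' := fun c l => by
        simp only [hφ', MonoidHom.id_apply, Finset.smul_sum]
        refine Finset.sum_congr rfl fun x _ => ?_
        rw [IntermediateField.coe_smul, Algebra.smul_def c (l : K), mul_pow,
          algebraMap_pow_frobeniusBase, mul_smul, algebraMap_smul]
      map_zero' := by rw [map_zero, map_zero]
      map_add' := fun l l' => by rw [map_add, map_add]
      map_mul' := fun l l' => by rw [map_mul, hβmul] }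
  have hψ : ∀ l, ψ l = β (φ l) := fun l => rfl
  refine ⟨L, hL, ψ, k, fun x => β (π x), t, hφR, ?_, ?_, ?_, ?_, hφ', ?_⟩
  · rw [hψ, map_one, hβ1]
  · intro x
    have h1 : Submodule.span K (R : Set (Module.End K W)) ≤
        (Submodule.span K (A : Set (Matrix n n K))).comap β :=
      Submodule.span_le.2 fun T hT => Submodule.subset_span hT
    exact h1 (hπR x)
  · rw [← map_sum, hπ1, hβ1]
  · intro x y
    rw [← hβmul, hππ]
    split_ifs
    · rfl
    · exact map_zero _
  · intro a ha hea hae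
    obtain ⟨T, rfl⟩ := hβsurj a hea hae
    obtain ⟨l, hl⟩ := hres T ha
    refine ⟨l, ?_⟩
    rw [hψ, ← map_sub]
    exact hβnil _ hl

end Residue

/-! ### Orthogonal primitive idempotents -/

section Idempotents

variable {F K M : Type*} [Field F] [Field K] [Ring M] [Algebra F M] [Algebra K M]
  {A : NonUnitalSubalgebra F M}

theorem exists_isPrimitiveIdempotent (K : Type*) {M : Type*} [Field K] [Ring M] [Algebra F M]
    [Algebra K M] [FiniteDimensional K M] {A : NonUnitalSubalgebra F M} {g : M} (hg : g ∈ A)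
    (hgg : g * g = g) (hg0 : g ≠ 0) : ∃ h, IsPrimitiveIdempotent A h ∧ g * h = h ∧ h * g = h := by
  induction hd : Module.finrank K (LinearMap.range (LinearMap.mulLeft K g))
    using Nat.strong_induction_on generalizing g with
  | _ d ih =>
    by_cases hp : ∀ f ∈ A, f * f = f → g * f = f → f * g = f → f = 0 ∨ f = g
    · exact ⟨g, ⟨hg, hgg, hg0, hp⟩, hgg, hgg⟩
    push Not at hp
    obtain ⟨f, hf, hff, hgf, hfg, hf0, hne⟩ := hp
    have hlt : LinearMap.range (LinearMap.mulLeft K f) <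
        LinearMap.range (LinearMap.mulLeft K g) := by
      refine lt_of_le_of_ne ?_ fun h => ?_
      · rintro _ ⟨x, rfl⟩
        exact ⟨f * x, by rw [LinearMap.mulLeft_apply, LinearMap.mulLeft_apply, ← mul_assoc, hgf]⟩
      · have : g ∈ LinearMap.range (LinearMap.mulLeft K f) := h ▸ ⟨1, mul_one g⟩
        obtain ⟨y, hy⟩ := this
        rw [LinearMap.mulLeft_apply] at hy
        apply hne
        rw [← hfg, ← hy, ← mul_assoc, hff]
    obtain ⟨h, hh, h1, h2⟩ := ih _ (hd ▸ Submodule.finrank_lt_finrank_of_lt hlt) hf hff hf0 rfl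
    exact ⟨h, hh, by rw [← h1, ← mul_assoc, hgf], by rw [← h2, mul_assoc, hfg]⟩

theorem card_le_finrank_of_orthogonal [FiniteDimensional K M] (S : Finset M)
    (hS : ∀ f ∈ S, f * f = f ∧ f ≠ 0) (hort : ∀ f ∈ S, ∀ g ∈ S, f ≠ g → f * g = 0) :
    S.card ≤ Module.finrank K M := by
  classical
  have hli : LinearIndependent K fun f : S => (f : M) := by
    rw [linearIndependent_iff']
    intro s c hc g hg
    have h1 : (g : M) * ∑ f ∈ s, c f • (f : M) = c g • (g : M) := by
      rw [Finset.mul_sum, Finset.sum_eq_single g]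
      · rw [mul_smul_comm, (hS g g.2).1]
      · intro f _ hfg
        rw [mul_smul_comm, hort _ g.2 _ f.2 fun h => hfg (Subtype.ext h.symm), smul_zero]
      · exact fun h => absurd hg h
    rw [hc, mul_zero] at h1
    exact (smul_eq_zero.1 h1.symm).resolve_right (hS g g.2).2
  have := hli.fintype_card_le_finrank
  rwa [Fintype.card_coe] at this

/-- A closed algebra contains a finite family of orthogonal primitive idempotents whose sum is a
unit element modulo the radical. -/
theorem exists_orthogonal_idempotents [FiniteDimensional K M] (hA : PolyClosed K (A : Set M)) :
    ∃ S : Finset M, (∀ f ∈ S, IsPrimitiveIdempotent A f) ∧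
      (∀ f ∈ S, ∀ g ∈ S, f ≠ g → f * g = 0) ∧
      ∀ a ∈ A, (∑ f ∈ S, f) * a = 0 → a * (∑ f ∈ S, f) = 0 → IsNilpotent a := by
  classical
  let T : Set ℕ := {m | ∃ S : Finset M, S.card = m ∧ (∀ f ∈ S, IsPrimitiveIdempotent A f) ∧
    ∀ f ∈ S, ∀ g ∈ S, f ≠ g → f * g = 0}
  have hT : BddAbove T := by
    refine ⟨Module.finrank K M, ?_⟩
    rintro _ ⟨S, rfl, h1, h2⟩
    exact card_le_finrank_of_orthogonal S (fun f hf => ⟨(h1 f hf).idem, (h1 f hf).ne_zero⟩) h2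
  have hT0 : T.Nonempty := ⟨0, ∅, rfl, by simp, by simp⟩
  obtain ⟨S, hS, hprim, hort⟩ := Nat.sSup_mem hT0 hT
  refine ⟨S, hprim, hort, fun a ha h1 h2 => ?_⟩
  refine (isNilpotent_or_exists_inverse (A := A.toNonUnitalSubring) hA ha).resolve_right ?_
  rintro ⟨b, hb, hab, hbab, hne⟩
  replace hb : b ∈ A := hb
  obtain ⟨h, hh, hgh, hhg⟩ := exists_isPrimitiveIdempotent K (A.mul_mem ha hb)
    (by rw [mul_assoc, ← mul_assoc b, hbab]) hne
  have hl : (∑ f ∈ S, f) * h = 0 := by rw [← hgh, ← mul_assoc, ← mul_assoc, h1, zero_mul, zero_mul]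
  have hr : h * (∑ f ∈ S, f) = 0 := by
    rw [← hhg, hab, mul_assoc, mul_assoc, h2, mul_zero, mul_zero]
  have hfl : ∀ f ∈ S, f * h = 0 := by
    intro f hf
    have : f * (∑ f ∈ S, f) = f := by
      rw [Finset.mul_sum, Finset.sum_eq_single f, (hprim f hf).idem]
      · exact fun g hg hgf => hort f hf g hg hgf.symm
      · exact fun h => absurd hf h
    rw [← this, mul_assoc, hl, mul_zero]
  have hfr : ∀ f ∈ S, h * f = 0 := by
    intro f hf
    have : (∑ f ∈ S, f) * f = f := by
      rw [Finset.sum_mul, Finset.sum_eq_single f, (hprim f hf).idem]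
      · exact fun g hg hgf => hort g hg f hf hgf
      · exact fun h => absurd hf h
    rw [← this, ← mul_assoc, hr, zero_mul]
  have hhS : h ∉ S := fun hmem => hh.ne_zero (by rw [← hh.idem, hfl h hmem])
  have hmem : (insert h S).card ∈ T := by
    refine ⟨_, rfl, ?_, ?_⟩
    · intro f hf
      rcases Finset.mem_insert.1 hf with rfl | hf
      exacts [hh, hprim f hf]
    · intro f hf g hg hfg
      rcases Finset.mem_insert.1 hf with rfl | hf'
      · rcases Finset.mem_insert.1 hg with rfl | hg'
        · exact absurd rfl hfg
        · exact hfr g hg'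
      · rcases Finset.mem_insert.1 hg with rfl | hg'
        · exact hfl f hf'
        · exact hort f hf' g hg' hfg
  have h3 := le_csSup hT hmem
  rw [← hS, Finset.card_insert_of_notMem hhS] at h3
  omega

/-- Equivalence of idempotents of an algebra `A` without unit: `e A` and `f A` are isomorphic right
modules. -/
def IdempotentEquiv (A : NonUnitalSubalgebra F M) (e f : M) : Prop :=
  ∃ a ∈ A, ∃ b ∈ A, e * a = a ∧ a * f = a ∧ f * b = b ∧ b * e = b ∧ a * b = e ∧ b * a = f

theorem IsPrimitiveIdempotent.equiv_of_mul_eq {e f a b : M} (he : e ≠ 0)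
    (hf : IsPrimitiveIdempotent A f) (ha : a ∈ A) (hb : b ∈ A) (hea : e * a = a) (haf : a * f = a)
    (hfb : f * b = b) (hbe : b * e = b) (hab : a * b = e) : IdempotentEquiv A e f := by
  refine ⟨a, ha, b, hb, hea, haf, hfb, hbe, hab, ?_⟩
  refine (hf.eq_zero_or_eq _ (A.mul_mem hb ha) ?_ ?_ ?_).resolve_left ?_
  · rw [mul_assoc, ← mul_assoc a, hab, hea]
  · rw [← mul_assoc, hfb]
  · rw [mul_assoc, haf]
  · intro h
    apply he
    rw [← hab, ← hea, ← hab, mul_assoc, mul_assoc, ← mul_assoc b, h, zero_mul, mul_zero]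

theorem IdempotentEquiv.refl {e : M} (he : e ∈ A) (hee : e * e = e) : IdempotentEquiv A e e :=
  ⟨e, he, e, he, hee, hee, hee, hee, hee, hee⟩

theorem IdempotentEquiv.symm {e f : M} (h : IdempotentEquiv A e f) : IdempotentEquiv A f e := by
  obtain ⟨a, ha, b, hb, h1, h2, h3, h4, h5, h6⟩ := h
  exact ⟨b, hb, a, ha, h3, h4, h1, h2, h6, h5⟩

theorem IdempotentEquiv.trans {e f g : M} (h : IdempotentEquiv A e f)
    (h' : IdempotentEquiv A f g) : IdempotentEquiv A e g := by
  obtain ⟨a, ha, b, hb, h1, h2, h3, h4, h5, h6⟩ := h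
  obtain ⟨c, hc, d, hd, k1, k2, k3, k4, k5, k6⟩ := h'
  refine ⟨a * c, A.mul_mem ha hc, d * b, A.mul_mem hd hb, ?_, ?_, ?_, ?_, ?_, ?_⟩
  · rw [← mul_assoc, h1]
  · rw [mul_assoc, k2]
  · rw [← mul_assoc, k3]
  · rw [mul_assoc, h4]
  · rw [mul_assoc, ← mul_assoc c, k5, h3, h5]
  · rw [mul_assoc, ← mul_assoc b, h6, k1, k6]

/-- The Peirce component of two inequivalent primitive idempotents is contained in the
radical. -/
theorem IsPrimitiveIdempotent.mem_radical_of_not_equiv [FiniteDimensional K M]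
    (hA : PolyClosed K (A : Set M)) {e f : M} (he : IsPrimitiveIdempotent A e)
    (hf : IsPrimitiveIdempotent A f) (hef : ¬ IdempotentEquiv A e f) {x : M} (hx : x ∈ A)
    (hex : e * x = x) (hxf : x * f = x) : x ∈ radical A := by
  refine (mem_radical_iff hA).2 ⟨hx, fun y hy => ?_⟩
  -- An inverse of `x * y * e` in the corner of `e` would make `e` and `f` equivalent.
  have h1 : IsNilpotent (x * y * e) := by
    refine (he.isNilpotent_or_exists_inverse hA (A.mul_mem (A.mul_mem hx hy) he.mem)
      (by rw [← mul_assoc, ← mul_assoc, hex]) (by rw [mul_assoc, he.idem])).resolve_right ?_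
    rintro ⟨c, hc, hec, hce, hzc, -⟩
    refine hef (hf.equiv_of_mul_eq he.ne_zero hx (b := f * (y * (e * c)))
      (A.mul_mem hf.mem (A.mul_mem hy (A.mul_mem he.mem hc))) hex hxf ?_ ?_ ?_)
    · rw [← mul_assoc, hf.idem]
    · simp only [mul_assoc, hce]
    · rw [← mul_assoc, hxf, ← mul_assoc, ← mul_assoc, hzc]
  have h2 := isNilpotent_mul_comm h1
  rwa [← mul_assoc, hex] at h2

section Complement

variable [FiniteDimensional K M] (hA : PolyClosed K (A : Set M)) {f : M} (hf : f ∈ A)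
  (hff : f * f = f) (hnil : ∀ a ∈ A, f * a = 0 → a * f = 0 → IsNilpotent a)

include hA hf hff hnil

theorem mem_radical_of_mul_eq_zero {x : M} (hx : x ∈ A) (hfx : f * x = 0) : x ∈ radical A := by
  refine (mem_radical_iff hA).2 ⟨hx, fun y hy => ?_⟩
  have h1 : IsNilpotent (x * y * (1 - f)) := by
    rw [mul_sub, mul_one]
    refine hnil _ (sub_mem (A.mul_mem hx hy) (A.mul_mem (A.mul_mem hx hy) hf)) ?_ ?_
    · rw [mul_sub, ← mul_assoc, ← mul_assoc, ← mul_assoc, hfx, zero_mul, zero_mul, sub_zero]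
    · rw [sub_mul, mul_assoc _ f, hff, sub_self]
  have h2 := isNilpotent_mul_comm h1
  rwa [sub_mul, one_mul, ← mul_assoc, hfx, zero_mul, sub_zero] at h2

theorem mem_radical_of_mul_eq_zero' {x : M} (hx : x ∈ A) (hxf : x * f = 0) : x ∈ radical A := by
  refine (mem_radical_iff hA).2 ⟨hx, fun y hy => isNilpotent_mul_comm ?_⟩
  have h1 : IsNilpotent ((1 - f) * (y * x)) := by
    rw [sub_mul, one_mul]
    refine hnil _ (sub_mem (A.mul_mem hy hx) (A.mul_mem hf (A.mul_mem hy hx))) ?_ ?_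
    · rw [mul_sub, ← mul_assoc f f, hff, sub_self]
    · rw [sub_mul, mul_assoc f, mul_assoc y, hxf, mul_zero, mul_zero, sub_zero]
  have h2 := isNilpotent_mul_comm h1
  rwa [mul_sub, mul_one, mul_assoc, hxf, mul_zero, sub_zero] at h2

/-- Peirce decomposition modulo the radical. -/
theorem mem_radical_of_mul_mul_mem {x : M} (hx : x ∈ A) (hfxf : f * x * f ∈ radical A) :
    x ∈ radical A := by
  have h1 : x - f * x ∈ radical A := mem_radical_of_mul_eq_zero hA hf hff hnil
    (sub_mem hx (A.mul_mem hf hx)) (by rw [mul_sub, ← mul_assoc, hff, sub_self])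
  have h2 : f * x - f * x * f ∈ radical A := mem_radical_of_mul_eq_zero' hA hf hff hnil
    (sub_mem (A.mul_mem hf hx) (A.mul_mem (A.mul_mem hf hx) hf))
    (by rw [sub_mul, mul_assoc _ f, hff, sub_self])
  have h3 := add_mem h1 (add_mem h2 hfxf)
  rwa [sub_add_cancel, sub_add_cancel] at h3

end Complement

end Idempotents

/-! ### The semisimple part -/

section MatrixUnits

variable {M ι : Type*} {κ : ι → Type*} [Ring M] [Fintype ι] [∀ u, Fintype (κ u)]
  [∀ u, DecidableEq (κ u)] {e : ι → M} {a b : ∀ u, κ u → M}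

theorem row_mul_sum (hab : ∀ u i j, a u i * b u j = if i = j then e u else 0)
    (hab' : ∀ u v i j, u ≠ v → a u i * b v j = 0) {w : ∀ u, κ u → κ u → M} {v : ι}
    (hw : ∀ i j, e v * w v i j = w v i j) (i : κ v) :
    a v i * ∑ u, ∑ i, ∑ j, b u i * w u i j * a u j = ∑ j, w v i j * a v j := by
  rw [Finset.mul_sum, Finset.sum_eq_single v, Finset.mul_sum, Finset.sum_eq_single i,
    Finset.mul_sum]
  · refine Finset.sum_congr rfl fun j _ => ?_
    rw [← mul_assoc, ← mul_assoc, hab, if_pos rfl, hw]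
  · intro i' _ hi
    rw [Finset.mul_sum]
    refine Finset.sum_eq_zero fun j _ => ?_
    rw [← mul_assoc, ← mul_assoc, hab, if_neg hi.symm, zero_mul, zero_mul]
  · exact fun h => absurd (Finset.mem_univ _) h
  · intro u _ hu
    rw [Finset.mul_sum]
    refine Finset.sum_eq_zero fun i' _ => ?_
    rw [Finset.mul_sum]
    refine Finset.sum_eq_zero fun j _ => ?_
    rw [← mul_assoc, ← mul_assoc, hab' _ _ _ _ hu.symm, zero_mul, zero_mul]
  · exact fun h => absurd (Finset.mem_univ _) h

theorem row_mul_sum_mul_col (hab : ∀ u i j, a u i * b u j = if i = j then e u else 0)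
    (hab' : ∀ u v i j, u ≠ v → a u i * b v j = 0) {w : ∀ u, κ u → κ u → M} {v : ι}
    (hw : ∀ i j, e v * w v i j = w v i j) (hw' : ∀ i j, w v i j * e v = w v i j) (i j : κ v) :
    a v i * (∑ u, ∑ i, ∑ j, b u i * w u i j * a u j) * b v j = w v i j := by
  rw [row_mul_sum hab hab' hw, Finset.sum_mul, Finset.sum_eq_single j]
  · rw [mul_assoc, hab, if_pos rfl, hw']
  · intro j' _ hj
    rw [mul_assoc, hab, if_neg hj, mul_zero]
  · exact fun h => absurd (Finset.mem_univ _) h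

theorem row_mul_sum_mul_col_of_ne (hab : ∀ u i j, a u i * b u j = if i = j then e u else 0)
    (hab' : ∀ u v i j, u ≠ v → a u i * b v j = 0) {w : ∀ u, κ u → κ u → M} {u v : ι}
    (hw : ∀ i j, e u * w u i j = w u i j) (huv : u ≠ v) (i : κ u) (j : κ v) :
    a u i * (∑ u, ∑ i, ∑ j, b u i * w u i j * a u j) * b v j = 0 := by
  rw [row_mul_sum hab hab' hw, Finset.sum_mul]
  refine Finset.sum_eq_zero fun j' _ => ?_
  rw [mul_assoc, hab' _ _ _ _ huv, mul_zero]

end MatrixUnits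

/-- A semisimple complement of the radical of `A`, given by matrix units: for every simple
component `u` there are a copy `lift u (fld u)` of its center, with unit element
`e u = lift u 1`, and elements `row u i ∈ e u * A` and `col u i ∈ A * e u` with
`row u i * col u j = δ i j • e u`. The simple component consists of the sums of the
`col u i * lift u l * row u j`. The projections `proj u x` are the simultaneous eigenprojections of
`lift u (fld u)`, whose eigencharacters are powers of the Frobenius map. -/
structure SemisimpleFrame {F K n : Type*} [Field F] [Field K] [Algebra F K]
    [Fintype n] [DecidableEq n] (A : NonUnitalSubalgebra F (Matrix n n K)) where
  numSimple : ℕ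
  deg : Fin numSimple → ℕ
  deg_pos : ∀ u, 0 < deg u
  fld : Fin numSimple → IntermediateField F K
  fld_closed : ∀ u, Finite (fld u) ∨ fld u = ⊤
  lift : ∀ u, fld u →ₙₐ[F] Matrix n n K
  lift_mem : ∀ u l, lift u l ∈ A
  lift_one_ne_zero : ∀ u, lift u 1 ≠ 0
  row : ∀ u, Fin (deg u) → Matrix n n K
  row_mem : ∀ u i, row u i ∈ A
  col : ∀ u, Fin (deg u) → Matrix n n K
  col_mem : ∀ u i, col u i ∈ A
  row_mul_col : ∀ u i j, row u i * col u j = if i = j then lift u 1 else 0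
  row_mul_col_of_ne : ∀ u v i j, u ≠ v → row u i * col v j = 0
  lift_one_mul_row : ∀ u i, lift u 1 * row u i = row u i
  col_mul_lift_one : ∀ u i, col u i * lift u 1 = col u i
  numEig : Fin numSimple → ℕ
  proj : ∀ u, Fin (numEig u) → Matrix n n K
  exponent : ∀ u, Fin (numEig u) → ℕ
  proj_mem_span : ∀ u x, proj u x ∈ Submodule.span K (A : Set (Matrix n n K))
  sum_proj : ∀ u, ∑ x, proj u x = lift u 1
  proj_mul_proj : ∀ u x y, proj u x * proj u y = if x = y then proj u x else 0
  lift_eq : ∀ u (l : fld u),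
    lift u l = ∑ x, (l : K) ^ frobeniusBase F ^ exponent u x • proj u x
  exists_sub_mem_radical : ∀ a ∈ A, ∃ z : ∀ u, Matrix (Fin (deg u)) (Fin (deg u)) (fld u),
    a - ∑ u, ∑ i, ∑ j, col u i * lift u (z u i j) * row u j ∈ radical A

variable {F K n : Type*} [Field F] [Field K] [Algebra F K] [Fintype n] [DecidableEq n]
  {A : NonUnitalSubalgebra F (Matrix n n K)}

/-- The Wedderburn principal theorem for closed algebras: the simple components correspond to the
equivalence classes in a maximal orthogonal family of primitive idempotents, and the matrix units
are the elements realizing the equivalences with a representative of the class. -/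
theorem exists_semisimpleFrame [IsAlgClosed K] (hA : PolyClosed K (A : Set (Matrix n n K))) :
    Nonempty (SemisimpleFrame A) := by
  classical
  obtain ⟨T, hT, hort, hnil⟩ := exists_orthogonal_idempotents hA
  let s : Setoid T :=
    { r := fun e f => IdempotentEquiv A (e : Matrix n n K) f
      iseqv := ⟨fun e => .refl (hT e e.2).mem (hT e e.2).idem, fun h => h.symm,
        fun h h' => h.trans h'⟩ }
  let N := Fintype.card (Quotient s)
  let ε : Fin N ≃ Quotient s := (Fintype.equivFin _).symm
  let rep : Fin N → T := fun u => (ε u).out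
  let d : Fin N → ℕ := fun u => Fintype.card {f : T // ⟦f⟧ = ε u}
  let δ : ∀ u, Fin (d u) ≃ {f : T // ⟦f⟧ = ε u} := fun u => (Fintype.equivFin _).symm
  have hrep : ∀ u, ⟦rep u⟧ = ε u := fun u => Quotient.out_eq _
  have hprim : ∀ f : T, IsPrimitiveIdempotent A (f : Matrix n n K) := fun f => hT f f.2
  have hequiv : ∀ u i, IdempotentEquiv A (rep u : Matrix n n K) (δ u i).1 := fun u i =>
    Quotient.exact (s := s) ((hrep u).trans (δ u i).2.symm)
  choose a ha b hb hea haf hfb hbe hab hba using hequiv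
  choose L hL φ k π t hφA hφ1 hπA hπ1 hππ hφ hres using
    fun u => (hprim (rep u)).exists_residue_field_lift hA
  have hδ : ∀ u v i j, ((δ u i).1 : T) = (δ v j).1 → u = v := by
    intro u v i j h
    apply ε.injective
    rw [← (δ u i).2, ← (δ v j).2, h]
  have hrc : ∀ u i j, a u i * b u j = if i = j then (rep u : Matrix n n K) else 0 := by
    intro u i j
    split_ifs with h
    · rw [← h, hab]
    · rw [← haf, mul_assoc, ← hfb, ← mul_assoc ((δ u i).1 : Matrix n n K),
        hort _ (δ u i).1.2 _ (δ u j).1.2, zero_mul, mul_zero]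
      intro h'
      exact h ((δ u).injective (Subtype.ext (Subtype.ext h')))
  have hrc' : ∀ u v i j, u ≠ v → a u i * b v j = 0 := by
    intro u v i j h
    rw [← haf, mul_assoc, ← hfb, ← mul_assoc ((δ u i).1 : Matrix n n K),
      hort _ (δ u i).1.2 _ (δ v j).1.2, zero_mul, mul_zero]
    intro h'
    exact h (hδ u v i j (Subtype.ext h'))
  have hsum : ∑ f ∈ T, f = ∑ u, ∑ i, b u i * a u i := by
    simp only [hba]
    have h1 : ∀ u, ∑ i, ((δ u i).1 : Matrix n n K) =
        ∑ f : {f : T // ⟦f⟧ = ε u}, ((f : T) : Matrix n n K) := fun u =>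
      Equiv.sum_comp (δ u) fun f => ((f : T) : Matrix n n K)
    rw [Finset.sum_congr rfl fun u _ => h1 u,
      Equiv.sum_comp ε fun q => ∑ f : {f : T // ⟦f⟧ = q}, ((f : T) : Matrix n n K),
      Fintype.sum_fiberwise (fun f : T => (⟦f⟧ : Quotient s)) fun f => (f : Matrix n n K),
      Finset.sum_coe_sort T fun f => f]
  have hsumA : ∑ f ∈ T, f ∈ A := sum_mem fun f hf => (hT f hf).mem
  have hidem : (∑ f ∈ T, f) * ∑ f ∈ T, f = ∑ f ∈ T, f := by
    rw [Finset.sum_mul]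
    refine Finset.sum_congr rfl fun f hf => ?_
    rw [Finset.mul_sum, Finset.sum_eq_single f, (hT f hf).idem]
    · exact fun g hg hgf => hort f hf g hg hgf.symm
    · exact fun h => absurd hf h
  -- The Peirce components `a u i * x * b u j` lie in a local corner, where residues lift.
  have hcorner : ∀ x ∈ A, ∀ u i j, ∃ l : L u, a u i * x * b u j - φ u l ∈ radical A := by
    intro x hx u i j
    have hxA : a u i * x * b u j ∈ A := A.mul_mem (A.mul_mem (ha u i) hx) (hb u j)
    have h1 : (rep u : Matrix n n K) * (a u i * x * b u j) = a u i * x * b u j := by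
      rw [← mul_assoc, ← mul_assoc, hea]
    have h2 : (a u i * x * b u j) * (rep u : Matrix n n K) = a u i * x * b u j := by
      rw [mul_assoc, hbe]
    obtain ⟨l, hl⟩ := hres u _ hxA h1 h2
    refine ⟨l, (hprim (rep u)).mem_radical hA (sub_mem hxA (hφA u l)) ?_ ?_ hl⟩
    · rw [mul_sub, h1, ← hφ1, ← map_mul, one_mul]
    · rw [sub_mul, h2, ← hφ1, ← map_mul, mul_one]
  let S : (∀ x ∈ A, ∃ z : ∀ u, Matrix (Fin (d u)) (Fin (d u)) (L u),
      x - ∑ u, ∑ i, ∑ j, b u i * φ u (z u i j) * a u j ∈ radical A) → SemisimpleFrame A := fun h =>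
    { numSimple := N
      deg := d
      deg_pos := fun u => Fintype.card_pos_iff.2 ⟨⟨rep u, hrep u⟩⟩
      fld := L
      fld_closed := hL
      lift := φ
      lift_mem := hφA
      lift_one_ne_zero := fun u => by rw [hφ1]; exact (hprim (rep u)).ne_zero
      row := a
      row_mem := ha
      col := b
      col_mem := hb
      row_mul_col := fun u i j => by rw [hφ1, hrc]
      row_mul_col_of_ne := hrc'
      lift_one_mul_row := fun u i => by rw [hφ1, hea]
      col_mul_lift_one := fun u i => by rw [hφ1, hbe]
      numEig := k
      proj := π
      exponent := t
      proj_mem_span := hπA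
      sum_proj := fun u => by rw [hπ1, hφ1]
      proj_mul_proj := hππ
      lift_eq := hφ
      exists_sub_mem_radical := h }
  refine ⟨S fun x hx => ?_⟩
  choose z hz using hcorner x hx
  have hφ1' : ∀ u l, (rep u : Matrix n n K) * φ u l = φ u l := fun u l => by
    rw [← hφ1, ← map_mul, one_mul]
  have hφ1'' : ∀ u l, φ u l * (rep u : Matrix n n K) = φ u l := fun u l => by
    rw [← hφ1, ← map_mul, mul_one]
  have hxA : x - ∑ u, ∑ i, ∑ j, b u i * φ u (z u i j) * a u j ∈ A :=
    sub_mem hx (sum_mem fun u _ => sum_mem fun i _ => sum_mem fun j _ =>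
      A.mul_mem (A.mul_mem (hb u i) (hφA u _)) (ha u j))
  refine ⟨z, mem_radical_of_mul_mul_mem hA hsumA hidem hnil hxA ?_⟩
  have hmem : ∀ u v i j, a u i * (x - ∑ u, ∑ i, ∑ j, b u i * φ u (z u i j) * a u j) * b v j ∈
      radical A := by
    intro u v i j
    by_cases huv : u = v
    · subst huv
      rw [mul_sub, sub_mul, row_mul_sum_mul_col hrc hrc' (w := fun u i j => φ u (z u i j))
        (fun i j => hφ1' _ _) fun i j => hφ1'' _ _]
      exact hz u i j
    · refine (hprim (rep u)).mem_radical_of_not_equiv hA (hprim (rep v)) (fun h => huv ?_)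
        (A.mul_mem (A.mul_mem (ha u i) hxA) (hb v j)) ?_ ?_
      · apply ε.injective
        rw [← hrep u, ← hrep v]
        exact Quotient.sound (s := s) h
      · rw [← mul_assoc, ← mul_assoc, hea]
      · rw [mul_assoc, hbe]
  rw [hsum]
  simp only [Finset.sum_mul, Finset.mul_sum]
  refine sum_mem fun v _ => sum_mem fun j _ => sum_mem fun u _ => sum_mem fun i _ => ?_
  have h1 := mul_mem_radical hA (mul_mem_radical' hA (hb u i) (hmem u v i j)) (ha v j)
  simp only [mul_assoc] at h1 ⊢
  exact h1

/-! ### Bases adapted to the annihilator filtration -/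

/-- The range of an idempotent stabilizing a filtration has a basis, with coordinate functionals
`c i`, which is adapted to the filtration. It is obtained by splitting off a vector in the first
nonzero step of the induced filtration of the range. -/
theorem exists_adapted_basis {K V : Type*} [Field K] [AddCommGroup V] [Module K V]
    [FiniteDimensional K V] {U : ℕ → Submodule K V} (hU : Monotone U) {m : ℕ} (hm : U m = ⊤)
    {π : Module.End K V} (hππ : π * π = π) (hπU : ∀ k, ∀ v ∈ U k, π v ∈ U k) :
    ∃ (d : ℕ) (w : Fin d → V) (c : Fin d → Module.Dual K V),
      (∀ i j, c i (w j) = if i = j then 1 else 0) ∧ (∀ v, ∑ i, c i v • w i = π v) ∧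
      (∀ i, π (w i) = w i) ∧ (∀ i v, c i (π v) = c i v) ∧
      ∀ k i, ∀ v ∈ U k, c i v ≠ 0 → w i ∈ U k := by
  classical
  induction hd : Module.finrank K (LinearMap.range π) using Nat.strong_induction_on
    generalizing π with
  | _ r ih =>
    by_cases hπ0 : π = 0
    · exact ⟨0, Fin.elim0, Fin.elim0, fun i => i.elim0, fun v => by simp [hπ0], fun i => i.elim0,
        fun i => i.elim0, fun k i => i.elim0⟩
    have hππ' : ∀ v, π (π v) = π v := fun v => LinearMap.congr_fun hππ v
    have hex : ∃ k, ∃ w ∈ U k, w ≠ 0 ∧ π w = w := by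
      obtain ⟨v, hv⟩ : ∃ v, π v ≠ 0 := by
        by_contra! h
        exact hπ0 (LinearMap.ext h)
      exact ⟨m, π v, hm ▸ Submodule.mem_top, hv, hππ' v⟩
    -- Split off `w`, taken from the first step of the filtration which meets the range of `π`.
    obtain ⟨w, hwU, hw0, hπw⟩ := Nat.find_spec hex
    obtain ⟨l, hl⟩ : ∃ l : Module.Dual K V, l w ≠ 0 := by
      by_contra! h
      exact hw0 ((Module.forall_dual_apply_eq_zero_iff K w).1 h)
    let c : Module.Dual K V := (l w)⁻¹ • (l ∘ₗ π)
    have hc : ∀ v, c v = (l w)⁻¹ * l (π v) := fun v => rfl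
    have hcw : c w = 1 := by rw [hc, hπw, inv_mul_cancel₀ hl]
    have hcπ : ∀ v, c (π v) = c v := fun v => by rw [hc, hc, hππ']
    have hcU : ∀ k, ∀ v ∈ U k, c v ≠ 0 → w ∈ U k := by
      intro k v hv hcv
      refine hU (Nat.find_min' hex ⟨π v, hπU k v hv, fun h => hcv ?_, hππ' v⟩) hwU
      rw [hc, h, map_zero, mul_zero]
    let π' : Module.End K V := π - c.smulRight w
    have hπ' : ∀ v, π' v = π v - c v • w := fun v => rfl
    have hπ'π : ∀ v, π' (π v) = π' v := fun v => by rw [hπ', hπ', hππ', hcπ]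
    have hππ'v : ∀ v, π (π' v) = π' v := fun v => by
      rw [hπ', map_sub, hππ', map_smul, hπw]
    have hπ'w : π' w = 0 := by rw [hπ', hπw, hcw, one_smul, sub_self]
    have hcπ' : ∀ v, c (π' v) = 0 := fun v => by
      rw [hπ', map_sub, hcπ, map_smul, hcw, smul_eq_mul, mul_one, sub_self]
    have hid : π' * π' = π' := by
      refine LinearMap.ext fun v => ?_
      change π' (π' v) = π' v
      conv_lhs => rw [hπ' v]
      rw [map_sub, hπ'π, map_smul, hπ'w, smul_zero, sub_zero]
    have hlt : LinearMap.range π' < LinearMap.range π := by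
      refine lt_of_le_of_ne ?_ fun h => ?_
      · rintro _ ⟨v, rfl⟩
        exact ⟨_, hππ'v v⟩
      · have : w ∈ LinearMap.range π' := h ▸ ⟨w, hπw⟩
        obtain ⟨v, hv⟩ := this
        have h1 := hcπ' v
        rw [hv, hcw] at h1
        exact one_ne_zero h1
    have hπ'U : ∀ k, ∀ v ∈ U k, π' v ∈ U k := by
      intro k v hv
      rw [hπ']
      refine Submodule.sub_mem _ (hπU k v hv) ?_
      by_cases h : c v = 0
      · rw [h, zero_smul]
        exact Submodule.zero_mem _
      · exact Submodule.smul_mem _ _ (hcU k v hv h)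
    obtain ⟨d, w', c', h1, h2, h3, h4, h5⟩ :=
      ih _ (hd ▸ Submodule.finrank_lt_finrank_of_lt hlt) hid hπ'U rfl
    refine ⟨d + 1, Fin.cons w w', Fin.cons c c', ?_, ?_, ?_, ?_, ?_⟩
    · intro i j
      induction i using Fin.cases with
      | zero =>
        induction j using Fin.cases with
        | zero => simpa using hcw
        | succ j =>
          simp only [Fin.cons_zero, Fin.cons_succ, (Fin.succ_ne_zero j).symm, if_false]
          rw [← h3, hcπ']
      | succ i =>
        induction j using Fin.cases with
        | zero =>
          simp only [Fin.cons_zero, Fin.cons_succ, Fin.succ_ne_zero i, if_false]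
          rw [← h4, hπ'w, map_zero]
        | succ j => simp only [Fin.cons_succ, Fin.succ_inj, h1]
    · intro v
      rw [Fin.sum_univ_succ]
      simp only [Fin.cons_zero, Fin.cons_succ, h2, hπ', add_sub_cancel]
    · intro i
      induction i using Fin.cases with
      | zero => exact hπw
      | succ i => rw [Fin.cons_succ, ← h3, hππ'v]
    · intro i v
      induction i using Fin.cases with
      | zero => exact hcπ v
      | succ i => rw [Fin.cons_succ, ← h4, hπ'π, h4]
    · intro k i v hv
      induction i using Fin.cases with
      | zero => exact hcU k v hv
      | succ i => exact h5 k i v hv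

section Filtration

variable {F K n : Type*} [Field F] [Field K] [Algebra F K] [Fintype n] [DecidableEq n]
  {A : NonUnitalSubalgebra F (Matrix n n K)}

/-- The annihilator filtration: `annihilator A k` is the space of vectors annihilated by the `k`-th
power of the radical of `A`. -/
def annihilator (A : NonUnitalSubalgebra F (Matrix n n K)) (k : ℕ) : Submodule K (n → K) where
  carrier := {v | ∀ x ∈ radical A ^ k, x.mulVec v = 0}
  zero_mem' := fun x _ => Matrix.mulVec_zero x
  add_mem' := fun {v w} hv hw x hx => by rw [Matrix.mulVec_add, hv x hx, hw x hx, add_zero]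
  smul_mem' := fun c v hv x hx => by rw [Matrix.mulVec_smul, hv x hx, smul_zero]

theorem annihilator_zero : annihilator A 0 = ⊥ := by
  refine (Submodule.eq_bot_iff _).2 fun v hv => ?_
  have := hv 1 (by rw [pow_zero]; exact Submodule.one_le.1 le_rfl)
  rwa [Matrix.one_mulVec] at this

theorem annihilator_eq_top {m : ℕ} (hm : radical A ^ m = 0) : annihilator A m = ⊤ := by
  refine (Submodule.eq_top_iff').2 fun v x hx => ?_
  rw [hm] at hx
  rw [(Submodule.mem_bot F).1 hx, Matrix.zero_mulVec]

theorem monotone_annihilator : Monotone (annihilator A) := by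
  refine monotone_nat_of_le_succ fun k v hv x hx => ?_
  rw [pow_succ'] at hx
  induction hx using Submodule.mul_induction_on' with
  | mem_mul_mem y _ z hz => rw [← Matrix.mulVec_mulVec, hv z hz, Matrix.mulVec_zero]
  | add x _ y _ hx hy => rw [Matrix.add_mulVec, hx, hy, add_zero]

theorem mulVec_mem_annihilator_of_mem_radical {k : ℕ} {x : Matrix n n K} (hx : x ∈ radical A)
    {v : n → K} (hv : v ∈ annihilator A (k + 1)) : x.mulVec v ∈ annihilator A k := by
  intro y hy
  rw [Matrix.mulVec_mulVec]
  refine hv _ ?_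
  rw [pow_succ]
  exact Submodule.mul_mem_mul hy hx

theorem mul_mem_pow_radical (hA : PolyClosed K (A : Set (Matrix n n K))) {k : ℕ}
    {x a : Matrix n n K} (hx : x ∈ radical A ^ (k + 1)) (ha : a ∈ A) :
    x * a ∈ radical A ^ (k + 1) := by
  rw [pow_succ] at hx ⊢
  induction hx using Submodule.mul_induction_on' with
  | mem_mul_mem y hy z hz =>
    rw [mul_assoc]
    exact Submodule.mul_mem_mul hy (mul_mem_radical hA hz ha)
  | add x _ y _ hx hy =>
    rw [add_mul]
    exact add_mem hx hy

theorem mulVec_mem_annihilator (hA : PolyClosed K (A : Set (Matrix n n K))) {k : ℕ}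
    {a : Matrix n n K} (ha : a ∈ Submodule.span K (A : Set (Matrix n n K))) {v : n → K}
    (hv : v ∈ annihilator A k) : a.mulVec v ∈ annihilator A k := by
  induction ha using Submodule.span_induction with
  | mem a ha =>
    rcases k with - | k
    · rw [annihilator_zero, Submodule.mem_bot] at hv ⊢
      rw [hv, Matrix.mulVec_zero]
    · intro x hx
      rw [Matrix.mulVec_mulVec]
      exact hv _ (mul_mem_pow_radical hA hx ha)
  | zero =>
    rw [Matrix.zero_mulVec]
    exact Submodule.zero_mem _
  | add a b _ _ ha hb =>
    rw [Matrix.add_mulVec]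
    exact Submodule.add_mem _ ha hb
  | smul c a _ ha =>
    rw [Matrix.smul_mulVec]
    exact Submodule.smul_mem _ _ ha

end Filtration

/-! ### Branches of the full quiver -/

section Quiver

variable {F K R : Type*} [Field F] [Field K] [Algebra F K] [Ring R] [Algebra F R]
  {A : NonUnitalSubalgebra F R}

theorem mem_of_mem_radical {x : R} (hx : x ∈ radical A) : x ∈ A := hx.1

theorem mem_of_mem_pow_radical {k : ℕ} {x : R} (hx : x ∈ radical A ^ (k + 1)) : x ∈ A := by
  induction k generalizing x with
  | zero => exact mem_of_mem_radical (by simpa using hx)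
  | succ k ih =>
    rw [pow_succ] at hx
    induction hx using Submodule.mul_induction_on' with
    | mem_mul_mem y hy z hz => exact A.mul_mem (ih hy) (mem_of_mem_radical hz)
    | add x _ y _ hx hy => exact A.add_mem hx hy

/-- Off the diagonal, the semisimple part of `A` does not contribute to the full quiver. -/
theorem WedderburnBlockForm.adj_iff (W : WedderburnBlockForm K A) {r s : Fin W.numBlocks} :
    W.fullQuiver.Adj r s ↔ ∃ a : A, (a : R) ∈ radical A ∧
      ∃ (i : Fin (W.blockSize r)) (j : Fin (W.blockSize s)), W.rep a ⟨r, i⟩ ⟨s, j⟩ ≠ 0 := by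
  constructor
  · rintro ⟨hrs, a, i, j, h⟩
    obtain ⟨z, b, hb, rfl⟩ := W.decomposition a
    refine ⟨b, hb, i, j, ?_⟩
    rwa [map_add, Matrix.add_apply, W.rep_semisimple_offDiag r s hrs, zero_add] at h
  · rintro ⟨a, ha, i, j, h⟩
    refine ⟨?_, a, i, j, h⟩
    rintro rfl
    exact h (W.rep_radical a ha r r le_rfl i j)

/-- A nonzero entry of a product of elements of the radical gives rise to a path. -/
theorem WedderburnBlockForm.exists_path (W : WedderburnBlockForm K A) {k : ℕ} {x : R}
    (hx : x ∈ radical A ^ (k + 1)) (hxA : x ∈ A) {r s} (h : W.rep ⟨x, hxA⟩ r s ≠ 0) :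
    ∃ p : Fin (k + 1 + 1) → Fin W.numBlocks, p 0 = r.1 ∧
      ∀ i : Fin (k + 1), W.fullQuiver.Adj (p i.castSucc) (p i.succ) := by
  induction k generalizing x r s with
  | zero =>
    refine ⟨Fin.cons r.1 fun _ => s.1, rfl, fun i => ?_⟩
    rw [Fin.fin_one_eq_zero i]
    exact W.adj_iff.2 ⟨⟨x, hxA⟩, by simpa using hx, r.2, s.2, h⟩
  | succ k ih =>
    rw [pow_succ'] at hx
    induction hx using Submodule.mul_induction_on' with
    | mem_mul_mem y hy z hz =>
      have hyA := mem_of_mem_radical hy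
      have hzA := mem_of_mem_pow_radical hz
      have h1 : (⟨y * z, hxA⟩ : A) = ⟨y, hyA⟩ * ⟨z, hzA⟩ := rfl
      rw [h1, map_mul, Matrix.mul_apply] at h
      obtain ⟨q, -, hq⟩ := Finset.exists_ne_zero_of_sum_ne_zero h
      obtain ⟨p, hp0, hp⟩ := ih hz hzA (right_ne_zero_of_mul hq)
      refine ⟨Fin.cons r.1 p, rfl, fun i => ?_⟩
      induction i using Fin.cases with
      | zero =>
        change W.fullQuiver.Adj r.1 (p 0)
        rw [hp0]
        exact W.adj_iff.2 ⟨⟨y, hyA⟩, hy, r.2, q.2, left_ne_zero_of_mul hq⟩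
      | succ i => exact hp i
    | add x hx' y hy' hx hy =>
      rw [← pow_succ'] at hx' hy'
      have hxA' := mem_of_mem_pow_radical hx'
      have hyA' := mem_of_mem_pow_radical hy'
      have h1 : (⟨x + y, hxA⟩ : A) = ⟨x, hxA'⟩ + ⟨y, hyA'⟩ := rfl
      rw [h1, map_add, Matrix.add_apply] at h
      by_cases h0 : W.rep ⟨x, hxA'⟩ r s = 0
      · rw [h0, zero_add] at h
        exact hy hyA' h
      · exact hx hxA' h0

/-- If the blocks have levels in `{1, …, L + 1}` which increase along the arrows, where `L + 1` is
the nilpotency class of the radical, then the branches have length at most `L`; a nonzero product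
of `L` elements of the radical gives a branch of length `L`. -/
theorem WedderburnBlockForm.isGreatest_branch (hA0 : A ≠ ⊥) (W : WedderburnBlockForm K A) {L : ℕ}
    (hL : nilpotencyClass (radical A) = L + 1) {lev : Fin W.numBlocks → ℕ}
    (hlev : ∀ r, 1 ≤ lev r ∧ lev r ≤ L + 1)
    (hrad : ∀ a : A, (a : R) ∈ radical A → ∀ r s i j, W.rep a ⟨r, i⟩ ⟨s, j⟩ ≠ 0 →
      lev r < lev s) :
    IsGreatest {l : ℕ | ∃ p, IsBranch W.fullQuiver l p} L := by
  have hadj : ∀ r s, W.fullQuiver.Adj r s → lev r < lev s := by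
    intro r s h
    obtain ⟨a, ha, i, j, h⟩ := W.adj_iff.1 h
    exact hrad a ha r s i j h
  have hpath : ∀ (l : ℕ) (p : Fin (l + 1) → Fin W.numBlocks),
      (∀ i : Fin l, W.fullQuiver.Adj (p i.castSucc) (p i.succ)) →
      ∀ i : Fin (l + 1), lev (p 0) + i ≤ lev (p i) := by
    intro l p hp i
    induction i using Fin.induction with
    | zero => simp
    | succ i ih =>
      have := hadj _ _ (hp i)
      rw [Fin.val_castSucc] at ih
      rw [Fin.val_succ]
      omega
  refine ⟨?_, ?_⟩
  · obtain ⟨p, hp⟩ : ∃ p : Fin (L + 1) → Fin W.numBlocks,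
        ∀ i : Fin L, W.fullQuiver.Adj (p i.castSucc) (p i.succ) := by
      obtain ⟨x₀, hx₀, hx₀0⟩ : ∃ x ∈ A, x ≠ 0 := by
        by_contra! h
        exact hA0 (eq_bot_iff.2 fun x hx => NonUnitalAlgebra.mem_bot.2 (h x hx))
      have : Nontrivial R := ⟨x₀, 0, hx₀0⟩
      have hnil : IsNilpotent (radical A) := by
        rw [← pos_nilpotencyClass_iff, hL]
        exact Nat.succ_pos L
      have hentry : ∀ x : A, (x : R) ≠ 0 → ∃ r s, W.rep x r s ≠ 0 := by
        intro x hx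
        by_contra! h
        apply hx
        have h1 : W.rep x = W.rep 0 := by
          rw [map_zero]
          ext r s
          exact h r s
        rw [W.rep_injective h1]
        rfl
      rcases L with - | L
      · obtain ⟨r, -, -⟩ := hentry ⟨x₀, hx₀⟩ hx₀0
        exact ⟨fun _ => r.1, fun i => i.elim0⟩
      · have hne : radical A ^ (L + 1) ≠ 0 := by
          have := pow_pred_nilpotencyClass hnil
          rwa [hL] at this
        obtain ⟨x, hx, hx0⟩ := Submodule.exists_mem_ne_zero_of_ne_bot hne
        have hxA := mem_of_mem_pow_radical hx
        obtain ⟨r, s, h⟩ := hentry ⟨x, hxA⟩ hx0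
        obtain ⟨p, -, hp⟩ := W.exists_path hx hxA h
        exact ⟨p, hp⟩
    have h1 := hpath L p hp (Fin.last L)
    rw [Fin.val_last] at h1
    -- The levels along the path are `1, …, L + 1`, which leaves no room for a further arrow.
    refine ⟨p, hp, fun v hv => ?_, fun v hv => ?_⟩
    · have h2 := hadj _ _ hv
      have h3 := (hlev v).1
      have h4 := (hlev (p (Fin.last L))).2
      omega
    · have h2 := hadj _ _ hv
      have h3 := (hlev (p 0)).1
      have h4 := (hlev v).2
      omega
  · rintro l ⟨p, hp, -⟩
    have h1 := hpath l p hp (Fin.last l)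
    rw [Fin.val_last] at h1
    have h2 := (hlev (p 0)).1
    have h3 := (hlev (p (Fin.last l))).2
    omega

end Quiver

/-! ### The diagonal blocks -/

namespace SemisimpleFrame

variable {F K n : Type*} [Field F] [Field K] [Algebra F K] [Fintype n] [DecidableEq n]
  {A : NonUnitalSubalgebra F (Matrix n n K)} (S : SemisimpleFrame A)

/-- The unit element of the semisimple part. -/
def one : Matrix n n K := ∑ u, ∑ i, S.col u i * S.row u i

theorem one_mem : S.one ∈ A :=
  sum_mem fun u _ => sum_mem fun i _ => A.mul_mem (S.col_mem u i) (S.row_mem u i)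

theorem row_mul_one (v) (j : Fin (S.deg v)) : S.row v j * S.one = S.row v j := by
  rw [one, Finset.mul_sum, Finset.sum_eq_single v, Finset.mul_sum, Finset.sum_eq_single j]
  · rw [← mul_assoc, S.row_mul_col, if_pos rfl, S.lift_one_mul_row]
  · intro i _ hi
    rw [← mul_assoc, S.row_mul_col, if_neg hi.symm, zero_mul]
  · exact fun h => absurd (Finset.mem_univ _) h
  · intro u _ hu
    rw [Finset.mul_sum]
    refine Finset.sum_eq_zero fun i _ => ?_
    rw [← mul_assoc, S.row_mul_col_of_ne _ _ _ _ hu.symm, zero_mul]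
  · exact fun h => absurd (Finset.mem_univ _) h

theorem one_mul_col (v) (j : Fin (S.deg v)) : S.one * S.col v j = S.col v j := by
  rw [one, Finset.sum_mul, Finset.sum_eq_single v, Finset.sum_mul, Finset.sum_eq_single j]
  · rw [mul_assoc, S.row_mul_col, if_pos rfl, S.col_mul_lift_one]
  · intro i _ hi
    rw [mul_assoc, S.row_mul_col, if_neg hi, mul_zero]
  · exact fun h => absurd (Finset.mem_univ _) h
  · intro u _ hu
    rw [Finset.sum_mul]
    refine Finset.sum_eq_zero fun i _ => ?_
    rw [mul_assoc, S.row_mul_col_of_ne _ _ _ _ hu, mul_zero]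
  · exact fun h => absurd (Finset.mem_univ _) h

theorem one_mul_one : S.one * S.one = S.one := by
  conv_rhs => rw [one]
  conv_lhs => rw [one, Finset.sum_mul]
  refine Finset.sum_congr rfl fun u _ => ?_
  rw [Finset.sum_mul]
  refine Finset.sum_congr rfl fun i _ => ?_
  rw [mul_assoc, ← one, S.row_mul_one]

/-- The element of the semisimple part of `A` with given components. -/
def ofComponents (z : ∀ u, Matrix (Fin (S.deg u)) (Fin (S.deg u)) (S.fld u)) : Matrix n n K :=
  ∑ u, ∑ i, ∑ j, S.col u i * S.lift u (z u i j) * S.row u j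

theorem ofComponents_mem (z) : S.ofComponents z ∈ A :=
  sum_mem fun u _ => sum_mem fun i _ => sum_mem fun j _ =>
    A.mul_mem (A.mul_mem (S.col_mem u i) (S.lift_mem u _)) (S.row_mem u j)

theorem lift_one_mul (u) (l : S.fld u) : S.lift u 1 * S.lift u l = S.lift u l := by
  rw [← map_mul, one_mul]

theorem lift_mul_one (u) (l : S.fld u) : S.lift u l * S.lift u 1 = S.lift u l := by
  rw [← map_mul, mul_one]

theorem row_mul_ofComponents (z) (v) (i : Fin (S.deg v)) :
    S.row v i * S.ofComponents z = ∑ j, S.lift v (z v i j) * S.row v j :=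
  row_mul_sum S.row_mul_col S.row_mul_col_of_ne (w := fun u i j => S.lift u (z u i j))
    (fun _ _ => S.lift_one_mul _ _) i

theorem row_mul_ofComponents_mul_col (z) (v) (i j : Fin (S.deg v)) :
    S.row v i * S.ofComponents z * S.col v j = S.lift v (z v i j) :=
  row_mul_sum_mul_col S.row_mul_col S.row_mul_col_of_ne (w := fun u i j => S.lift u (z u i j))
    (fun _ _ => S.lift_one_mul _ _) (fun _ _ => S.lift_mul_one _ _) i j

theorem row_mul_ofComponents_mul_col_of_ne (z) {u v} (huv : u ≠ v) (i : Fin (S.deg u))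
    (j : Fin (S.deg v)) : S.row u i * S.ofComponents z * S.col v j = 0 :=
  row_mul_sum_mul_col_of_ne S.row_mul_col S.row_mul_col_of_ne
    (w := fun u i j => S.lift u (z u i j)) (fun _ _ => S.lift_one_mul _ _) huv i j

/-- The embedding of the semisimple part into `A`. -/
def semisimple : (∀ u, Matrix (Fin (S.deg u)) (Fin (S.deg u)) (S.fld u)) →ₙₐ[F] A where
  toFun z := ⟨S.ofComponents z, S.ofComponents_mem z⟩
  map_smul' c z := by
    apply Subtype.ext
    simp [ofComponents, Finset.smul_sum]
  map_zero' := by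
    apply Subtype.ext
    simp [ofComponents]
  map_add' y z := by
    apply Subtype.ext
    simp [ofComponents, Finset.sum_add_distrib, mul_add, add_mul]
  map_mul' y z := by
    apply Subtype.ext
    change S.ofComponents (y * z) = S.ofComponents y * S.ofComponents z
    conv_rhs => rw [ofComponents, Finset.sum_mul]
    refine Finset.sum_congr rfl fun u _ => ?_
    rw [Finset.sum_mul]
    refine Finset.sum_congr rfl fun i _ => ?_
    simp only [Finset.sum_mul, mul_assoc, S.row_mul_ofComponents, Pi.mul_apply, Matrix.mul_apply,
      map_sum, Finset.mul_sum, map_mul]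
    exact Finset.sum_comm

/-- If `A` has a unit element, then it is the unit element of the semisimple part, since their
difference is an idempotent element of the radical. -/
theorem one_eq_of_unit (hA : PolyClosed K (A : Set (Matrix n n K))) {e : Matrix n n K} (he : e ∈ A)
    (hl : ∀ a ∈ A, e * a = a) (hr : ∀ a ∈ A, a * e = a) : S.one = e := by
  obtain ⟨z, hz⟩ := S.exists_sub_mem_radical e he
  change e - S.ofComponents z ∈ radical A at hz
  have h1 : S.one * S.ofComponents z = S.ofComponents z := by
    simp only [ofComponents, Finset.mul_sum, ← mul_assoc, S.one_mul_col]
  have h2 : e - S.one = (e - S.one) * (e - S.ofComponents z) := by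
    rw [mul_sub, sub_mul, sub_mul, hl e he, hr _ S.one_mem, hl _ (S.ofComponents_mem z), h1,
      sub_self, sub_zero]
  have h3 : e - S.one ∈ radical A := by
    rw [h2]
    exact mul_mem_radical' hA (sub_mem he S.one_mem) hz
  have h4 : (e - S.one) * (e - S.one) = e - S.one := by
    rw [mul_sub, sub_mul, sub_mul, hl e he, hr _ S.one_mem, hl _ S.one_mem, S.one_mul_one, sub_self,
      sub_zero]
  obtain ⟨k, hk⟩ := isNilpotent_of_mem_radical hA h3
  have h5 : (e - S.one) ^ (k + 1) = e - S.one := IsIdempotentElem.pow_succ_eq k h4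
  rw [pow_succ, hk, zero_mul] at h5
  exact (sub_eq_zero.1 h5.symm).symm

/-- The sizes of the blocks: those of a simple component, or `1` for the zero blocks. -/
def blockDeg : Option (Fin S.numSimple) → ℕ
  | none => 1
  | some u => S.deg u

/-- The row units of the simple components, and an idempotent `e` for the zero blocks. -/
def blockRow (e : Matrix n n K) : ∀ o, Fin (S.blockDeg o) → Matrix n n K
  | none => fun _ => e
  | some u => S.row u

/-- The column units of the simple components, and an idempotent `e` for the zero blocks. -/
def blockCol (e : Matrix n n K) : ∀ o, Fin (S.blockDeg o) → Matrix n n K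
  | none => fun _ => e
  | some u => S.col u

/-- The idempotents `lift u 1`, and an idempotent `e` for the zero blocks. -/
def blockOne (e : Matrix n n K) : Option (Fin S.numSimple) → Matrix n n K
  | none => e
  | some u => S.lift u 1

/-- The number of eigencharacters of the center of a simple component, and `1` for the zero
blocks. -/
def blockNumEig : Option (Fin S.numSimple) → ℕ
  | none => 1
  | some u => S.numEig u

/-- The eigenprojections of the center of a simple component, and an idempotent `e` for the zero
blocks. -/
def blockProj (e : Matrix n n K) : ∀ o, Fin (S.blockNumEig o) → Matrix n n K
  | none => fun _ => e
  | some u => S.proj u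

/-- The exponents of the eigencharacters; those of the zero blocks are irrelevant. -/
def blockExponent : ∀ o, Fin (S.blockNumEig o) → ℕ
  | none => fun _ => 0
  | some u => S.exponent u

variable {e : Matrix n n K}

theorem blockRow_mul_blockCol (hee : e * e = e) (o i j) :
    S.blockRow e o i * S.blockCol e o j = if i = j then S.blockOne e o else 0 := by
  rcases o with - | u
  · have h : i = j := Subsingleton.elim (α := Fin 1) i j
    rw [if_pos h]
    exact hee
  · exact S.row_mul_col u i j

theorem blockRow_mul_blockCol_of_ne (hrow : ∀ u i, S.row u i * e = 0)
    (hcol : ∀ u i, e * S.col u i = 0) {o o'} (ho : o ≠ o') (i j) :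
    S.blockRow e o i * S.blockCol e o' j = 0 := by
  rcases o with - | u <;> rcases o' with - | v
  · exact absurd rfl ho
  · exact hcol v j
  · exact hrow u i
  · exact S.row_mul_col_of_ne u v i j fun h => ho (h ▸ rfl)

theorem sum_blockProj (o) : ∑ x, S.blockProj e o x = S.blockOne e o := by
  rcases o with - | u
  · exact Fintype.sum_unique (ι := Fin 1) fun _ => e
  · exact S.sum_proj u

theorem blockProj_mul_blockProj (hee : e * e = e) (o x y) :
    S.blockProj e o x * S.blockProj e o y = if x = y then S.blockProj e o x else 0 := by
  rcases o with - | u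
  · have h : x = y := Subsingleton.elim (α := Fin 1) x y
    rw [if_pos h]
    exact hee
  · exact S.proj_mul_proj u x y

theorem blockCol_mul_blockOne (hee : e * e = e) (o i) :
    S.blockCol e o i * S.blockOne e o = S.blockCol e o i := by
  rcases o with - | u
  exacts [hee, S.col_mul_lift_one u i]

theorem sum_blockCol_mul_blockRow (hee : e * e = e) :
    ∑ o, ∑ i, S.blockCol e o i * S.blockRow e o i = e + S.one := by
  rw [Fintype.sum_option]
  congr 1
  exact (Fintype.sum_unique (ι := Fin 1) fun _ => e * e).trans hee

theorem lift_mul_proj (u) (l : S.fld u) (x) :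
    S.lift u l * S.proj u x = (l : K) ^ frobeniusBase F ^ S.exponent u x • S.proj u x := by
  rw [S.lift_eq, Finset.sum_mul, Finset.sum_eq_single x]
  · rw [smul_mul_assoc, S.proj_mul_proj, if_pos rfl]
  · intro y _ hy
    rw [smul_mul_assoc, S.proj_mul_proj, if_neg hy, smul_zero]
  · exact fun h => absurd (Finset.mem_univ _) h

end SemisimpleFrame

namespace SemisimpleFrame

variable {F K n : Type*} [Field F] [Field K] [Algebra F K] [Fintype n] [DecidableEq n]
  {A : NonUnitalSubalgebra F (Matrix n n K)}

theorem blockDeg_of_eq (S : SemisimpleFrame A) {o : Option (Fin S.numSimple)} {u}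
    (h : o = some u) : S.blockDeg o = S.deg u := by
  rw [h]
  rfl

theorem mul_ofComponents_eq_zero (S : SemisimpleFrame A) {e : Matrix n n K}
    (hcol : ∀ u i, e * S.col u i = 0) (z) : e * S.ofComponents z = 0 := by
  simp only [ofComponents, Finset.mul_sum, ← mul_assoc, hcol, zero_mul, Finset.sum_const_zero]

theorem ofComponents_mul_eq_zero (S : SemisimpleFrame A) {e : Matrix n n K}
    (hrow : ∀ u i, S.row u i * e = 0) (z) : S.ofComponents z * e = 0 := by
  simp only [ofComponents, Finset.sum_mul, mul_assoc, hrow, mul_zero, Finset.sum_const_zero]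

theorem row_mul_ofComponents_mul_col_mulVec (S : SemisimpleFrame A) (z) (u)
    (i j : Fin (S.deg u)) {x} {w : n → K} (hw : (S.proj u x).mulVec w = w) :
    (S.row u i * S.ofComponents z * S.col u j).mulVec w =
      (z u i j : K) ^ frobeniusBase F ^ S.exponent u x • w := by
  conv_lhs => rw [← hw]
  rw [Matrix.mulVec_mulVec, S.row_mul_ofComponents_mul_col, S.lift_mul_proj, Matrix.smul_mulVec,
    hw]

/-- A basis, indexed by diagonal blocks, of the range of the idempotent `e + S.one`, with its
coordinate functionals. The semisimple part acts on it by Frobenius twists of its components, and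
by zero in the blocks without component, which span the range of `e`; the radical strictly
decreases the level of a basis vector, which is its position in the annihilator filtration. -/
structure BlockBasis (S : SemisimpleFrame A) (e : Matrix n n K) (ι : Type) [Fintype ι] where
  component : ι → Option (Fin S.numSimple)
  exponent : ι → ℕ
  level : ι → ℕ
  vec : ∀ r, Fin (S.blockDeg (component r)) → n → K
  coord : ∀ r, Fin (S.blockDeg (component r)) → Module.Dual K (n → K)
  coord_vec : ∀ r i j, coord r i (vec r j) = if i = j then 1 else 0
  coord_vec_of_ne : ∀ r s i j, r ≠ s → coord r i (vec s j) = 0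
  sum_coord_smul_vec : ∀ v, ∑ r, ∑ i, coord r i v • vec r i = (e + S.one).mulVec v
  component_surjective : ∀ u, ∃ r, component r = some u
  ne_zero_of_component_eq_none : ∀ r, component r = none → e ≠ 0
  coord_ofComponents : ∀ r u (h : component r = some u) z i j,
    coord r i ((S.ofComponents z).mulVec (vec r j)) =
      ((z u (Fin.cast (S.blockDeg_of_eq h) i) (Fin.cast (S.blockDeg_of_eq h) j) : S.fld u) : K) ^
        (frobeniusBase F ^ exponent r)
  coord_ofComponents_of_eq_none : ∀ r, component r = none → ∀ z i j,
    coord r i ((S.ofComponents z).mulVec (vec r j)) = 0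
  coord_ofComponents_of_ne : ∀ r s, r ≠ s → ∀ z i j,
    coord r i ((S.ofComponents z).mulVec (vec s j)) = 0
  level_pos : ∀ r, 1 ≤ level r
  level_le : ∀ m, radical A ^ m = 0 → ∀ r, level r ≤ m
  level_lt : ∀ x ∈ radical A, ∀ r s i j, coord r i (x.mulVec (vec s j)) ≠ 0 → level r < level s

/-- Transport of a block basis along a bijection of the sets of blocks. -/
def BlockBasis.reindex {S : SemisimpleFrame A} {e : Matrix n n K} {ι κ : Type} [Fintype ι]
    [Fintype κ] (B : BlockBasis S e ι) (σ : κ ≃ ι) : BlockBasis S e κ where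
  component r := B.component (σ r)
  exponent r := B.exponent (σ r)
  level r := B.level (σ r)
  vec r := B.vec (σ r)
  coord r := B.coord (σ r)
  coord_vec r := B.coord_vec (σ r)
  coord_vec_of_ne r s i j h := B.coord_vec_of_ne _ _ i j (σ.injective.ne h)
  sum_coord_smul_vec v := by
    rw [← B.sum_coord_smul_vec, ← Equiv.sum_comp σ]
  component_surjective u := by
    obtain ⟨r, hr⟩ := B.component_surjective u
    exact ⟨σ.symm r, by rw [σ.apply_symm_apply, hr]⟩
  ne_zero_of_component_eq_none r := B.ne_zero_of_component_eq_none _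
  coord_ofComponents r := B.coord_ofComponents _
  coord_ofComponents_of_eq_none r := B.coord_ofComponents_of_eq_none _
  coord_ofComponents_of_ne r s h := B.coord_ofComponents_of_ne _ _ (σ.injective.ne h)
  level_pos r := B.level_pos _
  level_le m hm r := B.level_le m hm _
  level_lt x hx r s := B.level_lt x hx _ _

/-- The basis vectors are the transports `S.blockCol e o i * w` of the vectors `w` of adapted bases
of the eigenprojections, and the coordinates are `c ∘ S.blockRow e o i` for the dual functionals
`c`. -/
theorem exists_blockBasis (S : SemisimpleFrame A) (hA : PolyClosed K (A : Set (Matrix n n K)))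
    (hnil : IsNilpotent (radical A)) {e : Matrix n n K} (hee : e * e = e)
    (hrow : ∀ u i, S.row u i * e = 0) (hcol : ∀ u i, e * S.col u i = 0)
    (heU : ∀ k, ∀ v ∈ annihilator A k, e.mulVec v ∈ annihilator A k) :
    ∃ (ι : Type) (_ : Fintype ι), Nonempty (BlockBasis S e ι) := by
  classical
  obtain ⟨m, hm⟩ := hnil
  have hrowU : ∀ o i k, ∀ v ∈ annihilator A k, (S.blockRow e o i).mulVec v ∈ annihilator A k := by
    rintro (_ | u) i k v hv
    · exact heU k v hv
    · exact mulVec_mem_annihilator hA (Submodule.subset_span (S.row_mem u i)) hv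
  have hcolU : ∀ o i k, ∀ v ∈ annihilator A k, (S.blockCol e o i).mulVec v ∈ annihilator A k := by
    rintro (_ | u) i k v hv
    · exact heU k v hv
    · exact mulVec_mem_annihilator hA (Submodule.subset_span (S.col_mem u i)) hv
  have hprojU : ∀ o x k, ∀ v ∈ annihilator A k, (S.blockProj e o x).mulVec v ∈ annihilator A k := by
    rintro (_ | u) x k v hv
    · exact heU k v hv
    · exact mulVec_mem_annihilator hA (S.proj_mem_span u x) hv
  have hbasis := fun o x => exists_adapted_basis (U := annihilator A) monotone_annihilator
    (annihilator_eq_top hm) (π := Matrix.mulVecLin (S.blockProj e o x)) (by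
      rw [Module.End.mul_eq_comp, ← Matrix.mulVecLin_mul, S.blockProj_mul_blockProj hee,
        if_pos rfl]) (hprojU o x)
  simp only [Matrix.mulVecLin_apply] at hbasis
  choose d w c hcw hsum hw hc hU using hbasis
  -- Vectors and functionals belonging to different eigenprojections of a component are orthogonal.
  have hcw' : ∀ o x y i j, x ≠ y → c o x i (w o y j) = 0 := by
    intro o x y i j hxy
    rw [← hc, ← hw, Matrix.mulVec_mulVec, S.blockProj_mul_blockProj hee, if_neg hxy,
      Matrix.zero_mulVec, map_zero]
  have hw0 : ∀ o x i, w o x i ≠ 0 := by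
    intro o x i h
    have := hcw o x i i
    rw [h, map_zero, if_pos rfl] at this
    exact zero_ne_one this
  have hex : ∀ o x i, ∃ k, w o x i ∈ annihilator A k := fun o x i =>
    ⟨m, annihilator_eq_top hm ▸ Submodule.mem_top⟩
  have hone : ∀ o x i, (S.blockOne e o).mulVec (w o x i) = w o x i := by
    intro o x i
    conv_lhs => rw [← hw]
    rw [Matrix.mulVec_mulVec, ← S.sum_blockProj, Finset.sum_mul, Finset.sum_eq_single x,
      S.blockProj_mul_blockProj hee, if_pos rfl, hw]
    · intro y _ hy
      rw [S.blockProj_mul_blockProj hee, if_neg hy]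
    · exact fun h => absurd (Finset.mem_univ _) h
  let ι : Type := Σ o : Option (Fin S.numSimple), Σ x : Fin (S.blockNumEig o), Fin (d o x)
  refine ⟨ι, inferInstance, ⟨
    { component := fun β => β.1
      exponent := fun β => S.blockExponent β.1 β.2.1
      level := fun β => Nat.find (hex β.1 β.2.1 β.2.2)
      vec := fun β i => (S.blockCol e β.1 i).mulVec (w β.1 β.2.1 β.2.2)
      coord := fun β i => c β.1 β.2.1 β.2.2 ∘ₗ Matrix.mulVecLin (S.blockRow e β.1 i)
      coord_vec := ?_
      coord_vec_of_ne := ?_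
      sum_coord_smul_vec := ?_
      component_surjective := ?_
      ne_zero_of_component_eq_none := ?_
      coord_ofComponents := ?_
      coord_ofComponents_of_eq_none := ?_
      coord_ofComponents_of_ne := ?_
      level_pos := ?_
      level_le := fun k hk β => Nat.find_min' _ (annihilator_eq_top hk ▸ Submodule.mem_top)
      level_lt := ?_ }⟩⟩
  · rintro ⟨o, x, l⟩ i j
    simp only [LinearMap.comp_apply, Matrix.mulVecLin_apply, Matrix.mulVec_mulVec]
    rw [S.blockRow_mul_blockCol hee]
    split_ifs
    · rw [hone, hcw, if_pos rfl]
    · rw [Matrix.zero_mulVec, map_zero]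
  · rintro ⟨o, x, l⟩ ⟨o', x', l'⟩ i j h
    simp only [LinearMap.comp_apply, Matrix.mulVecLin_apply, Matrix.mulVec_mulVec]
    by_cases ho : o = o'
    · subst ho
      rw [S.blockRow_mul_blockCol hee]
      split_ifs
      · rw [hone]
        by_cases hx : x = x'
        · subst hx
          rw [hcw, if_neg]
          rintro rfl
          exact h rfl
        · exact hcw' _ _ _ _ _ hx
      · rw [Matrix.zero_mulVec, map_zero]
    · rw [S.blockRow_mul_blockCol_of_ne hrow hcol ho, Matrix.zero_mulVec, map_zero]
  · intro v
    rw [← S.sum_blockCol_mul_blockRow hee, Fintype.sum_sigma, Matrix.sum_mulVec]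
    refine Finset.sum_congr rfl fun o _ => ?_
    refine (Finset.sum_comm (s := Finset.univ) (t := Finset.univ)
      (f := fun (y : Σ x, Fin (d o x)) (i : Fin (S.blockDeg o)) =>
        c o y.1 y.2 ((S.blockRow e o i).mulVec v) •
          (S.blockCol e o i).mulVec (w o y.1 y.2))).trans ?_
    rw [Matrix.sum_mulVec]
    refine Finset.sum_congr rfl fun i _ => ?_
    simp only [← Matrix.mulVec_smul]
    rw [← Matrix.mulVec_sum, Fintype.sum_sigma]
    simp only [hsum]
    rw [← Matrix.sum_mulVec, S.sum_blockProj, Matrix.mulVec_mulVec, Matrix.mulVec_mulVec,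
      S.blockCol_mul_blockOne hee]
  · intro u
    have h1 : ∃ x, S.proj u x ≠ 0 := by
      by_contra! h
      apply S.lift_one_ne_zero u
      rw [← S.sum_proj, Finset.sum_eq_zero fun x _ => h x]
    obtain ⟨x, hx⟩ := h1
    have h2 : 0 < d (some u) x := by
      by_contra h
      have h0 : IsEmpty (Fin (d (some u) x)) := by
        rw [Nat.eq_zero_of_not_pos h]
        infer_instance
      apply hx
      refine Matrix.mulVec_injective (funext fun v => ?_)
      have := hsum (some u) x v
      rw [Finset.univ_eq_empty, Finset.sum_empty] at this
      rw [Matrix.zero_mulVec]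
      exact this.symm
    exact ⟨⟨some u, x, ⟨0, h2⟩⟩, rfl⟩
  · rintro ⟨o, x, l⟩ h h0
    replace h : o = none := h
    subst h
    apply hw0 none x l
    rw [← hw]
    change e.mulVec _ = 0
    rw [h0, Matrix.zero_mulVec]
  · rintro ⟨o, x, l⟩ u h z i j
    replace h : o = some u := h
    subst h
    have h1 := S.row_mul_ofComponents_mul_col_mulVec z u i j (hw (some u) x l)
    simp only [← Matrix.mulVec_mulVec] at h1
    refine (congrArg (c (some u) x l) h1).trans ?_
    rw [map_smul, hcw, if_pos rfl, smul_eq_mul, mul_one]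
    rfl
  · rintro ⟨o, x, l⟩ h z i j
    replace h : o = none := h
    subst h
    change c none x l (e.mulVec ((S.ofComponents z).mulVec _)) = 0
    rw [Matrix.mulVec_mulVec, S.mul_ofComponents_eq_zero hcol, Matrix.zero_mulVec, map_zero]
  · rintro ⟨o, x, l⟩ ⟨o', x', l'⟩ h z i j
    rcases o with - | u
    · change c none x l (e.mulVec ((S.ofComponents z).mulVec _)) = 0
      rw [Matrix.mulVec_mulVec, S.mul_ofComponents_eq_zero hcol, Matrix.zero_mulVec, map_zero]
    rcases o' with - | v
    · change c (some u) x l ((S.row u i).mulVec ((S.ofComponents z).mulVec (e.mulVec _))) = 0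
      rw [Matrix.mulVec_mulVec _ _ e, S.ofComponents_mul_eq_zero hrow, Matrix.zero_mulVec,
        Matrix.mulVec_zero, map_zero]
    by_cases huv : u = v
    · subst huv
      have h1 := S.row_mul_ofComponents_mul_col_mulVec z u i j (hw (some u) x' l')
      simp only [← Matrix.mulVec_mulVec] at h1
      refine (congrArg (c (some u) x l) h1).trans ?_
      rw [map_smul]
      by_cases hx : x = x'
      · subst hx
        rw [hcw, if_neg, smul_zero]
        rintro rfl
        exact h rfl
      · rw [hcw' _ _ _ _ _ hx, smul_zero]
    · have h1 := congrArg (fun M => M.mulVec (w (some v) x' l'))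
        (S.row_mul_ofComponents_mul_col_of_ne z huv i j)
      simp only [← Matrix.mulVec_mulVec, Matrix.zero_mulVec] at h1
      exact (congrArg (c (some u) x l) h1).trans (map_zero _)
  · intro β
    rw [Nat.one_le_iff_ne_zero]
    intro h
    have h1 := Nat.find_spec (hex β.1 β.2.1 β.2.2)
    rw [h, annihilator_zero] at h1
    exact hw0 _ _ _ ((Submodule.mem_bot K).1 h1)
  · rintro y hy ⟨o, x, l⟩ ⟨o', x', l'⟩ i j h
    simp only [LinearMap.comp_apply, Matrix.mulVecLin_apply] at h
    change Nat.find (hex o x l) < Nat.find (hex o' x' l')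
    have h1 := Nat.find_spec (hex o' x' l')
    obtain ⟨k, hk⟩ : ∃ k, Nat.find (hex o' x' l') = k + 1 := by
      refine Nat.exists_eq_succ_of_ne_zero fun h0 => ?_
      rw [h0, annihilator_zero] at h1
      exact hw0 _ _ _ ((Submodule.mem_bot K).1 h1)
    rw [hk] at h1 ⊢
    exact Nat.lt_succ_of_le (Nat.find_min' _ (hU _ _ _ _ _ (hrowU _ _ _ _
      (mulVec_mem_annihilator_of_mem_radical hy (hcolU _ _ _ _ h1))) h))

end SemisimpleFrame

/-! ### The representation -/

namespace SemisimpleFrame.BlockBasis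

variable {F K n : Type*} [Field F] [Field K] [Algebra F K] [Fintype n] [DecidableEq n]
  {A : NonUnitalSubalgebra F (Matrix n n K)} {S : SemisimpleFrame A} {e : Matrix n n K}
  {N : ℕ} (B : S.BlockBasis e (Fin N))

/-- The matrix whose rows are the coordinate functionals of a block basis. -/
def coordMatrix : Matrix (Σ r, Fin (S.blockDeg (B.component r))) n K :=
  Matrix.of fun p k => B.coord p.1 p.2 (Pi.single k 1)

/-- The matrix whose columns are the vectors of a block basis. -/
def vecMatrix : Matrix n (Σ r, Fin (S.blockDeg (B.component r))) K :=
  Matrix.of fun k p => B.vec p.1 p.2 k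

theorem coordMatrix_mulVec (v : n → K) (p) : B.coordMatrix.mulVec v p = B.coord p.1 p.2 v := by
  conv_rhs => rw [← Finset.univ_sum_single v, map_sum]
  refine Finset.sum_congr rfl fun k _ => ?_
  have h : (Pi.single k (v k) : n → K) = v k • Pi.single k 1 := by
    rw [← Pi.single_smul, smul_eq_mul, mul_one]
  rw [h, map_smul, smul_eq_mul, mul_comm]
  rfl

theorem coordMatrix_mul_mul_vecMatrix (a : Matrix n n K) (p q) :
    (B.coordMatrix * a * B.vecMatrix) p q = B.coord p.1 p.2 (a.mulVec (B.vec q.1 q.2)) := by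
  rw [← coordMatrix_mulVec, Matrix.mulVec_mulVec]
  rfl

theorem coordMatrix_mul_vecMatrix : B.coordMatrix * B.vecMatrix = 1 := by
  ext ⟨r, i⟩ ⟨s, j⟩
  have h := B.coordMatrix_mul_mul_vecMatrix 1 ⟨r, i⟩ ⟨s, j⟩
  rw [Matrix.mul_one, Matrix.one_mulVec] at h
  rw [h, Matrix.one_apply]
  by_cases hrs : r = s
  · subst hrs
    simp [B.coord_vec]
  · rw [B.coord_vec_of_ne _ _ _ _ hrs, if_neg]
    intro h'
    exact hrs (congrArg Sigma.fst h')

theorem vecMatrix_mul_coordMatrix : B.vecMatrix * B.coordMatrix = e + S.one := by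
  refine Matrix.mulVec_injective (funext fun v => ?_)
  rw [← Matrix.mulVec_mulVec, ← B.sum_coord_smul_vec]
  ext k
  rw [Finset.sum_apply]
  simp only [Finset.sum_apply, Pi.smul_apply, smul_eq_mul]
  rw [← Fintype.sum_sigma fun p : Σ r, Fin (S.blockDeg (B.component r)) =>
    B.coord p.1 p.2 v * B.vec p.1 p.2 k]
  refine Finset.sum_congr rfl fun p _ => ?_
  rw [coordMatrix_mulVec, mul_comm]
  rfl

theorem vecMatrix_mul_mul_coordMatrix (hl : ∀ a ∈ A, (e + S.one) * a = a)
    (hr : ∀ a ∈ A, a * (e + S.one) = a) {a : Matrix n n K} (ha : a ∈ A) :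
    B.vecMatrix * (B.coordMatrix * a * B.vecMatrix) * B.coordMatrix = a := by
  have h : B.vecMatrix * (B.coordMatrix * a * B.vecMatrix) * B.coordMatrix =
      (B.vecMatrix * B.coordMatrix) * a * (B.vecMatrix * B.coordMatrix) := by
    simp only [Matrix.mul_assoc]
  rw [h, vecMatrix_mul_coordMatrix, hl a ha, hr a ha]

/-- The representation by matrices with respect to a block basis with increasing levels. -/
noncomputable def wedderburnBlockForm (hlevel : Monotone B.level)
    (hl : ∀ a ∈ A, (e + S.one) * a = a) (hr : ∀ a ∈ A, a * (e + S.one) = a)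
    (hunit : (∃ e : A, ∀ a : A, e * a = a ∧ a * e = a) → e = 0) : WedderburnBlockForm K A where
  numBlocks := N
  blockSize r := S.blockDeg (B.component r)
  blockSize_pos r := by
    rcases h : B.component r with - | u
    exacts [Nat.one_pos, S.deg_pos u]
  rep :=
    { toFun := fun a => B.coordMatrix * (a : Matrix n n K) * B.vecMatrix
      map_smul' := fun c a => by
        simp
      map_zero' := by simp
      map_add' := fun a b => by simp [Matrix.mul_add, Matrix.add_mul]
      map_mul' := fun a b => by
        have h : (a : Matrix n n K) * (b : Matrix n n K) =
            (a : Matrix n n K) * (B.vecMatrix * B.coordMatrix) * (b : Matrix n n K) := by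
          rw [vecMatrix_mul_coordMatrix, hr a a.2]
        rw [NonUnitalSubalgebra.coe_mul, h]
        simp only [Matrix.mul_assoc] }
  rep_injective a b hab := by
    apply Subtype.ext
    rw [← B.vecMatrix_mul_mul_coordMatrix hl hr a.2, ← B.vecMatrix_mul_mul_coordMatrix hl hr b.2]
    exact congrArg (fun M => B.vecMatrix * M * B.coordMatrix) hab
  numSimple := S.numSimple
  deg := S.deg
  deg_pos := S.deg_pos
  fld := S.fld
  fld_closed := S.fld_closed
  semisimple := S.semisimple
  decomposition a := by
    obtain ⟨z, hz⟩ := S.exists_sub_mem_radical a a.2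
    exact ⟨z, a - S.semisimple z, hz, (add_sub_cancel _ _).symm⟩
  component := B.component
  component_surjective := B.component_surjective
  component_ne_none h r hr := B.ne_zero_of_component_eq_none r hr (hunit h)
  blockSize_eq _ _ := S.blockDeg_of_eq
  exponent := B.exponent
  rep_semisimple r u h z i j := (B.coordMatrix_mul_mul_vecMatrix _ ⟨r, i⟩ ⟨r, j⟩).trans
    (B.coord_ofComponents r u h z i j)
  rep_semisimple_zero r h z i j := (B.coordMatrix_mul_mul_vecMatrix _ ⟨r, i⟩ ⟨r, j⟩).trans
    (B.coord_ofComponents_of_eq_none r h z i j)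
  rep_semisimple_offDiag r s h z i j := (B.coordMatrix_mul_mul_vecMatrix _ ⟨r, i⟩ ⟨s, j⟩).trans
    (B.coord_ofComponents_of_ne r s h z i j)
  rep_radical a ha r s hsr i j := by
    by_contra h
    refine (B.level_lt a ha r s i j ?_).not_ge (hlevel hsr)
    rwa [← B.coordMatrix_mul_mul_vecMatrix _ ⟨r, i⟩ ⟨s, j⟩]

variable (hlevel : Monotone B.level) (hl : ∀ a ∈ A, (e + S.one) * a = a)
  (hr : ∀ a ∈ A, a * (e + S.one) = a)
  (hunit : (∃ e : A, ∀ a : A, e * a = a ∧ a * e = a) → e = 0)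

/-- The range of the representation is the inverse image of `A` under a linear map. -/
theorem isZariskiClosed_range_rep (hA : PolyClosed K (A : Set (Matrix n n K))) :
    IsZariskiClosed (Set.range (B.wedderburnBlockForm hlevel hl hr hunit).rep) := by
  refine isZariskiClosed_iff_polyClosed.2 (?_ : PolyClosed K
    (Set.range fun a : A => B.coordMatrix * (a : Matrix n n K) * B.vecMatrix))
  let T : Matrix (Σ r, Fin (S.blockDeg (B.component r))) (Σ r, Fin (S.blockDeg (B.component r))) K
      →ₗ[K] Matrix n n K :=
    { toFun := fun M => B.vecMatrix * M * B.coordMatrix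
      map_add' := fun M M' => by rw [Matrix.mul_add, Matrix.add_mul]
      map_smul' := fun c M => by
        rw [Matrix.mul_smul, Matrix.smul_mul]
        rfl }
  suffices hT : (Set.range fun a : A => B.coordMatrix * (a : Matrix n n K) * B.vecMatrix) =
      T ⁻¹' A by
    rw [hT]
    exact hA.preimage T
  ext M
  constructor
  · rintro ⟨a, rfl⟩
    change B.vecMatrix * (B.coordMatrix * (a : Matrix n n K) * B.vecMatrix) * B.coordMatrix ∈ A
    rw [B.vecMatrix_mul_mul_coordMatrix hl hr a.2]
    exact a.2
  · intro hM
    refine ⟨⟨T M, hM⟩, ?_⟩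
    change B.coordMatrix * (B.vecMatrix * M * B.coordMatrix) * B.vecMatrix = M
    have h1 : B.coordMatrix * (B.vecMatrix * M * B.coordMatrix) * B.vecMatrix =
        (B.coordMatrix * B.vecMatrix) * M * (B.coordMatrix * B.vecMatrix) := by
      simp only [Matrix.mul_assoc]
    rw [h1, coordMatrix_mul_vecMatrix, Matrix.one_mul, Matrix.mul_one]

end SemisimpleFrame.BlockBasis

/-- The idempotent of the zero blocks: `0` if `A` has a unit element, and otherwise the complement
of the unit element of the semisimple part. -/
theorem SemisimpleFrame.exists_zeroBlock_idempotent {F K n : Type*} [Field F] [Field K]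
    [Algebra F K] [Fintype n] [DecidableEq n] {A : NonUnitalSubalgebra F (Matrix n n K)}
    (S : SemisimpleFrame A) (hA : PolyClosed K (A : Set (Matrix n n K))) :
    ∃ e : Matrix n n K, e * e = e ∧ (∀ u i, S.row u i * e = 0) ∧ (∀ u i, e * S.col u i = 0) ∧
      (∀ k, ∀ v ∈ annihilator A k, e.mulVec v ∈ annihilator A k) ∧
      (∀ a ∈ A, (e + S.one) * a = a) ∧ (∀ a ∈ A, a * (e + S.one) = a) ∧
      ((∃ e : A, ∀ a : A, e * a = a ∧ a * e = a) → e = 0) := by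
  by_cases hunit : ∃ e : A, ∀ a : A, e * a = a ∧ a * e = a
  · obtain ⟨e, he⟩ := hunit
    have hl : ∀ a ∈ A, (e : Matrix n n K) * a = a := fun a ha =>
      congrArg Subtype.val (he ⟨a, ha⟩).1
    have hr : ∀ a ∈ A, a * (e : Matrix n n K) = a := fun a ha =>
      congrArg Subtype.val (he ⟨a, ha⟩).2
    have h1 := S.one_eq_of_unit hA e.2 hl hr
    refine ⟨0, zero_mul _, fun _ _ => mul_zero _, fun _ _ => zero_mul _, fun k v _ => ?_,
      fun a ha => ?_, fun a ha => ?_, fun _ => rfl⟩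
    · rw [Matrix.zero_mulVec]
      exact Submodule.zero_mem _
    · rw [zero_add, h1, hl a ha]
    · rw [zero_add, h1, hr a ha]
  · refine ⟨1 - S.one, ?_, fun u i => ?_, fun u i => ?_, fun k v hv => ?_, fun a _ => ?_,
      fun a _ => ?_, fun h => absurd h hunit⟩
    · rw [sub_mul, one_mul, mul_sub, mul_one, S.one_mul_one, sub_self, sub_zero]
    · rw [mul_sub, mul_one, S.row_mul_one, sub_self]
    · rw [sub_mul, one_mul, S.one_mul_col, sub_self]
    · rw [Matrix.sub_mulVec, Matrix.one_mulVec]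
      exact Submodule.sub_mem _ hv
        (mulVec_mem_annihilator hA (Submodule.subset_span S.one_mem) hv)
    · rw [sub_add_cancel, one_mul]
    · rw [sub_add_cancel, mul_one]

end ZariskiClosedAlgebra

theorem mainTheorem4 {F K : Type*} [Field F] [Field K] [IsAlgClosed K] [Algebra F K] {n : ℕ}
    (A : NonUnitalSubalgebra F (Matrix (Fin n) (Fin n) K))
    (hA : ZariskiClosedAlgebra.IsZariskiClosed (A : Set (Matrix (Fin n) (Fin n) K)))
    (hA0 : A ≠ ⊥) :
    IsNilpotent (ZariskiClosedAlgebra.radical A) ∧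
      ∃ W : ZariskiClosedAlgebra.WedderburnBlockForm K A,
        ZariskiClosedAlgebra.IsZariskiClosed (Set.range W.rep) ∧
        ∃ L : ℕ,
          IsGreatest {l : ℕ | ∃ p, ZariskiClosedAlgebra.IsBranch W.fullQuiver l p} L ∧
          nilpotencyClass (ZariskiClosedAlgebra.radical A) = L + 1 := by
  open ZariskiClosedAlgebra in
  rw [isZariskiClosed_iff_polyClosed] at hA
  have hnil : IsNilpotent (radical A) := isNilpotent_submodule_of_nil
    (fun x hx y hy => mul_mem_radical hA hx (mem_of_mem_radical hy))
    fun x hx => isNilpotent_of_mem_radical hA hx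
  obtain ⟨S⟩ := exists_semisimpleFrame hA
  obtain ⟨e, hee, hrow, hcol, heU, hl, hr, hunit⟩ := S.exists_zeroBlock_idempotent hA
  obtain ⟨ι, _, ⟨B₀⟩⟩ := S.exists_blockBasis hA hnil hee hrow hcol heU
  -- The blocks are numbered in the order of their levels.
  let ε := (Fintype.equivFin ι).symm
  let B := B₀.reindex ((Tuple.sort (B₀.level ∘ ε)).trans ε)
  have hlevel : Monotone B.level := Tuple.monotone_sort (B₀.level ∘ ε)
  have : Nontrivial (Submodule F (Matrix (Fin n) (Fin n) K)) := by
    refine ⟨⟨A.toSubmodule, ⊥, fun h => hA0 (eq_bot_iff.2 fun x hx => ?_)⟩⟩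
    have h1 : x ∈ A.toSubmodule := hx
    rw [h] at h1
    exact NonUnitalAlgebra.mem_bot.2 ((Submodule.mem_bot F).1 h1)
  obtain ⟨L, hL⟩ := Nat.exists_eq_succ_of_ne_zero (pos_nilpotencyClass_iff.2 hnil).ne'
  refine ⟨hnil, B.wedderburnBlockForm hlevel hl hr hunit,
    B.isZariskiClosed_range_rep hlevel hl hr hunit hA, L, ?_, hL⟩
  refine WedderburnBlockForm.isGreatest_branch hA0 _ hL (lev := B.level)
    (fun r => ⟨B.level_pos r, B.level_le _ ?_ r⟩) fun a ha r s i j h => ?_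
  · rw [← Nat.succ_eq_add_one, ← hL]
    exact pow_nilpotencyClass hnil
  · refine B.level_lt a ha r s i j ?_
    rwa [← B.coordMatrix_mul_mul_vecMatrix _ ⟨r, i⟩ ⟨s, j⟩]
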